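/- **Setting.** Let $\mathcal S_1,\mathcal S_2,\mathcal X,\mathcal Y_1,\mathcal Y_2$ be finite sets with $\mathcal X\ne\emptyset$, let $p_{(S_1,S_2)}$ be a probability distribution on $\mathcal S_1\times\mathcal S_2$, let $p_{Y_1,Y_2|X}$ be a discrete memoryless broadcast channel with input alphabet $\mathcal X$ and output alphabets $\mathcal Y_1,\mathcal Y_2$, and let $\kappa\ge 0$. Let $(S_1(t),S_2(t))$, $t=1,2,\dots$, be i.i.d. with law $p_{(S_1,S_2)}$. We say that $p_{(S_1,S_2)}$ is *admissible* for $p_{Y_1,Y_2|X}$ subject to bandwidth expansion constraint $\kappa$ if for every $\epsilon>0$ there are integers $m\ge 1$ and $n\ge 0$ with $n/m\le\kappa+\epsilon$, an encoding function $f:\mathcal S_1^m\times\mathcal S_2^m\to\mathcal X^n$ and decoding functions $g_i:\mathcal Y_i^n\to\mathcal S_i^m$, $i=1,2$, such that, when $X^n=f(S_1^m,S_2^m)$ is sent over the channel and $\hat S_i^m=g_i(Y_i^n)$, $$\frac1m\sum_{t=1}^m\Pr(S_i(t)\ne\hat S_i(t))\le\epsilon,\qquad i=1,2.$$ For an input distribution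 $p_X$ on $\mathcal X$, a conditional distribution $p_{U|(S_1,S_2)}$ and a conditional distribution $p_{V_0,V_1,V_2|X}$ (with finite alphabets $\mathcal U,\mathcal V_0,\mathcal V_1,\mathcal V_2$), consider $(U,S_1,S_2)\sim p_{U|(S_1,S_2)}p_{(S_1,S_2)}$ and $(V_0,V_1,V_2,X,Y_1,Y_2)\sim p_{V_0,V_1,V_2|X}\,p_X\,p_{Y_1,Y_2|X}$ and the inequalities $$\begin{aligned} &I(U;S_i)\le\kappa I(V_0;Y_i),\quad i=1,2,\\ &H(S_i)\le\kappa I(V_0,V_i;Y_i),\quad i=1,2,\\ &I(U;S_1)+H(S_2|U)\le\kappa[I(V_0;Y_1)+I(V_2;Y_2|V_0)],\\ &I(U;S_2)+H(S_1|U)\le\kappa[I(V_0;Y_2)+I(V_1;Y_1|V_0)],\\ &I(U;S_1)+H(S_1,S_2|U)\le\kappa[I(V_0,V_1;Y_1)+I(X;Y_2|V_0,V_1)],\\ &I(U;S_2)+H(S_1,S_2|U)\le\kappa[I(V_0,V_2;Y_2)+I(X;Y_1|V_0,V_2)],\\ &I(U;S_1)+H(S_1,S_2|U)\le\kappa[I(V_0;Y_1)+I(V_2;Y_2|V_0)+I(X;Y_1|V_0,V_2)],\\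 &I(U;S_2)+H(S_1,S_2|U)\le\kappa[I(V_0;Y_2)+I(V_1;Y_1|V_0)+I(X;Y_2|V_0,V_1)]. \end{aligned}\tag{$*$}$$ **Theorem.** 1. If $p_{(S_1,S_2)}$ is admissible for $p_{Y_1,Y_2|X}$ subject to bandwidth expansion constraint $\kappa$, then there is an input distribution $p_X$ such that for every finite $\mathcal U$ and every $p_{U|(S_1,S_2)}$ there is a $p_{V_0,V_1,V_2|X}$ satisfying $(*)$, with $|\mathcal V_0|\le|\mathcal X|+5$ and $|\mathcal V_i|\le|\mathcal X|$, $i=1,2$. 2. In this condition it suffices to consider $|\mathcal U|\le|\mathcal S_1|\,|\mathcal S_2|$, $|\mathcal V_0|\le|\mathcal X|+5$ and $|\mathcal V_i|\le|\mathcal X|$: for every $p_X$ (whether or not the source is admissible), if for every $p_{U|(S_1,S_2)}$ with $|\mathcal U|\le|\mathcal S_1|\,|\mathcal S_2|$ there is some $p_{V_0,V_1,V_2|X}$ with arbitrary finite alphabets satisfying $(*)$, then for every $p_{U|(S_1,S_2)}$ with arbitrary finite $\mathcal U$ there is such a $p_{V_0,V_1,V_2|X}$ with $|\mathcal V_0|\le|\mathcal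 X|+5$ and $|\mathcal V_i|\le|\mathcal X|$, $i=1,2$. 3. Let $S_0$ be the common part of $S_1$ and $S_2$ in the sense of Gács–Körner and Witsenhausen, i.e. $S_0=\varphi_1(S_1)=\varphi_2(S_2)$ almost surely and every random variable that is almost surely both a function of $S_1$ and a function of $S_2$ is almost surely a function of $S_0$. Then for all $p_X$ and $p_{V_0,V_1,V_2|X}$ the inequalities $(*)$ with $U=S_0$ hold if and only if the inequalities of the Gohari–Anantharam outer bound hold, namely, with $\mu=\min\{I(V_0;Y_1),I(V_0;Y_2)\}$, $$\begin{aligned} &H(S_0)\le\kappa\mu,\qquad H(S_i)\le\kappa[\mu+I(V_i;Y_i|V_0)],\quad i=1,2,\\ &H(S_1,S_2)\le\kappa[\mu+I(V_1;Y_1|V_0)+I(X;Y_2|V_0,V_1)],\\ &H(S_1,S_2)\le\kappa[\mu+I(V_2;Y_2|V_0)+I(X;Y_1|V_0,V_2)]. \end{aligned}$$ -/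

import Mathlib

open scoped BigOperators

noncomputable section

namespace BroadcastSource

/-! ### Shannon information measures of random variables on a finite probability space -/

section Information

variable {Ω α β γ : Type*}

/-- The probability `Pr(A = a)` under the law `P`. -/
def prob (P : PMF Ω) (A : Ω → α) (a : α) : ℝ := (P.map A a).toReal

/-- The joint random variable `(A, B)`. -/
def pair (A : Ω → α) (B : Ω → β) : Ω → α × β := fun ω => (A ω, B ω)

/-- The Shannon entropy `H(A)`, in nats. -/
def entropy [Fintype α] (P : PMF Ω) (A : Ω → α) : ℝ :=
  ∑ a, Real.negMulLog (prob P A a)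

/-- The conditional entropy `H(A | B) = ∑ b, Pr(B = b) H(A | B = b)`. -/
def condEntropy [Fintype α] [Fintype β] (P : PMF Ω) (A : Ω → α) (B : Ω → β) : ℝ :=
  ∑ b, prob P B b * ∑ a, Real.negMulLog (prob P (pair A B) (a, b) / prob P B b)

/-- The mutual information `I(A; B) = H(A) - H(A | B)`. -/
def mutualInfo [Fintype α] [Fintype β] (P : PMF Ω) (A : Ω → α) (B : Ω → β) : ℝ :=
  entropy P A - condEntropy P A B

/-- The conditional mutual information `I(A; B | C) = H(A | C) - H(A | B, C)`. -/
def condMutualInfo [Fintype α] [Fintype β] [Fintype γ] (P : PMF Ω)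
    (A : Ω → α) (B : Ω → β) (C : Ω → γ) : ℝ :=
  condEntropy P A C - condEntropy P A (pair B C)

end Information

/-! ### Block codes and admissibility -/

section Coding

/-- The law of independent random variables `A(1), …, A(n)` with `A(t)` distributed as `q t`. -/
def productPMF {α : Type*} [Fintype α] {n : ℕ} (q : Fin n → PMF α) : PMF (Fin n → α) :=
  PMF.ofFintype (fun a => ∏ t, q t (a t)) (by
    have h : ∀ t, ∑ a, q t a = 1 := fun t => by
      rw [← (q t).tsum_coe, tsum_fintype]
    classical
    rw [← Fintype.prod_sum (fun t a => q t a)]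
    simp [h])

variable {S₁ S₂ X Y₁ Y₂ : Type*} [Fintype S₁] [Fintype S₂] [Fintype Y₁] [Fintype Y₂]

/-- The joint law of an i.i.d. source block of length `m` and of the output block that results when
its encoding `f` is sent over the memoryless broadcast channel `W`. -/
def blockLaw (p : PMF (S₁ × S₂)) (W : X → PMF (Y₁ × Y₂)) {m n : ℕ}
    (f : (Fin m → S₁) × (Fin m → S₂) → (Fin n → X)) :
    PMF ((Fin m → S₁ × S₂) × (Fin n → Y₁ × Y₂)) :=
  (productPMF fun _ : Fin m => p).bind fun s =>
    (productPMF fun q : Fin n => W (f (fun t => (s t).1, fun t => (s t).2) q)).map fun y => (s, y)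

/-- `p` is admissible for the broadcast channel `W` subject to bandwidth expansion constraint `κ`:
for every `ε > 0` there are a code with source block length `m ≥ 1` and channel block length
`n = ρ m`, `ρ ≤ κ + ε`, whose average symbol error probability is at most `ε` at both receivers. -/
def Admissible (p : PMF (S₁ × S₂)) (W : X → PMF (Y₁ × Y₂)) (κ : ℝ) : Prop :=
  ∀ ε : ℝ, 0 < ε → ∃ (m n : ℕ) (f : (Fin m → S₁) × (Fin m → S₂) → (Fin n → X))
    (g₁ : (Fin n → Y₁) → (Fin m → S₁)) (g₂ : (Fin n → Y₂) → (Fin m → S₂)),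
    0 < m ∧ (n : ℝ) / m ≤ κ + ε ∧
    (1 / (m : ℝ)) * ∑ t : Fin m, ((blockLaw p W f).toOuterMeasure
      {ω | (ω.1 t).1 ≠ g₁ (fun q => (ω.2 q).1) t}).toReal ≤ ε ∧
    (1 / (m : ℝ)) * ∑ t : Fin m, ((blockLaw p W f).toOuterMeasure
      {ω | (ω.1 t).2 ≠ g₂ (fun q => (ω.2 q).2) t}).toReal ≤ ε

end Coding

/-! ### Test distributions and the inequalities of the outer bounds -/

section Bounds

variable {Ω Ω' U S₁ S₂ V₀ V₁ V₂ X Y₁ Y₂ T : Type*} [Fintype U] [Fintype S₁] [Fintype S₂]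
  [Fintype V₀] [Fintype V₁] [Fintype V₂] [Fintype X] [Fintype Y₁] [Fintype Y₂] [Fintype T]

/-- The joint law `p_{U|(S₁,S₂)} p_{(S₁,S₂)}` of `(U, S₁, S₂)`. -/
def sourceJoint {U S₁ S₂ : Type*} (p : PMF (S₁ × S₂)) (pU : S₁ × S₂ → PMF U) :
    PMF (U × S₁ × S₂) :=
  p.bind fun s => (pU s).map fun u => (u, s)

/-- The joint law `p_{V₀,V₁,V₂|X} p_X p_{Y₁,Y₂|X}` of `(V₀, V₁, V₂, X, Y₁, Y₂)`. -/
def channelJoint {V₀ V₁ V₂ X Y₁ Y₂ : Type*} (pX : PMF X) (pV : X → PMF (V₀ × V₁ × V₂))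
    (W : X → PMF (Y₁ × Y₂)) : PMF ((V₀ × V₁ × V₂) × X × Y₁ × Y₂) :=
  pX.bind fun x => (pV x).bind fun v => (W x).map fun y => (v, x, y)

/-- The comparison of the measurements of `(U, S₁, S₂)` under `P` with those of
`(V₀, V₁, V₂, X, Y₁, Y₂)` under `Q`. -/
structure Dominated (κ : ℝ) (P : PMF Ω) (u : Ω → U) (s₁ : Ω → S₁) (s₂ : Ω → S₂)
    (Q : PMF Ω') (v₀ : Ω' → V₀) (v₁ : Ω' → V₁) (v₂ : Ω' → V₂) (x : Ω' → X)
    (y₁ : Ω' → Y₁) (y₂ : Ω' → Y₂) : Prop where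
  common₁ : mutualInfo P u s₁ ≤ κ * mutualInfo Q v₀ y₁
  common₂ : mutualInfo P u s₂ ≤ κ * mutualInfo Q v₀ y₂
  single₁ : entropy P s₁ ≤ κ * mutualInfo Q (pair v₀ v₁) y₁
  single₂ : entropy P s₂ ≤ κ * mutualInfo Q (pair v₀ v₂) y₂
  cross₁ : mutualInfo P u s₁ + condEntropy P s₂ u ≤
    κ * (mutualInfo Q v₀ y₁ + condMutualInfo Q v₂ y₂ v₀)
  cross₂ : mutualInfo P u s₂ + condEntropy P s₁ u ≤
    κ * (mutualInfo Q v₀ y₂ + condMutualInfo Q v₁ y₁ v₀)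
  total₁ : mutualInfo P u s₁ + condEntropy P (pair s₁ s₂) u ≤
    κ * (mutualInfo Q (pair v₀ v₁) y₁ + condMutualInfo Q x y₂ (pair v₀ v₁))
  total₂ : mutualInfo P u s₂ + condEntropy P (pair s₁ s₂) u ≤
    κ * (mutualInfo Q (pair v₀ v₂) y₂ + condMutualInfo Q x y₁ (pair v₀ v₂))
  chain₁ : mutualInfo P u s₁ + condEntropy P (pair s₁ s₂) u ≤
    κ * (mutualInfo Q v₀ y₁ + condMutualInfo Q v₂ y₂ v₀ + condMutualInfo Q x y₁ (pair v₀ v₂))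
  chain₂ : mutualInfo P u s₂ + condEntropy P (pair s₁ s₂) u ≤
    κ * (mutualInfo Q v₀ y₂ + condMutualInfo Q v₁ y₁ v₀ + condMutualInfo Q x y₂ (pair v₀ v₁))

/-- The inequalities of the outer bound, for the test distributions `pU` and `pV`. -/
def BoundHolds (κ : ℝ) (p : PMF (S₁ × S₂)) (W : X → PMF (Y₁ × Y₂)) (pX : PMF X)
    (pU : S₁ × S₂ → PMF U) (pV : X → PMF (V₀ × V₁ × V₂)) : Prop :=
  Dominated κ (sourceJoint p pU) (fun ω => ω.1) (fun ω => ω.2.1) (fun ω => ω.2.2)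
    (channelJoint pX pV W) (fun ω => ω.1.1) (fun ω => ω.1.2.1) (fun ω => ω.1.2.2)
    (fun ω => ω.2.1) (fun ω => ω.2.2.1) (fun ω => ω.2.2.2)

/-- `φ₁(S₁) = φ₂(S₂)` almost surely, and every random variable that is almost surely both a function
of `S₁` and a function of `S₂` is almost surely a function of it: `φ₁(S₁)` is the common part of
`S₁` and `S₂` in the sense of Gács–Körner and Witsenhausen. (The test functions may be taken with
values in `ℕ` because the alphabets are finite.) -/
structure IsCommonPart {S₁ S₂ T : Type*} (p : PMF (S₁ × S₂)) (φ₁ : S₁ → T) (φ₂ : S₂ → T) :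
    Prop where
  agree : ∀ s ∈ p.support, φ₁ s.1 = φ₂ s.2
  maximal : ∀ (ψ₁ : S₁ → ℕ) (ψ₂ : S₂ → ℕ), (∀ s ∈ p.support, ψ₁ s.1 = ψ₂ s.2) →
    ∃ h : T → ℕ, ∀ s ∈ p.support, ψ₁ s.1 = h (φ₁ s.1)

/-- The inequalities of the Gohari–Anantharam outer bound, for a common part `s₀`. -/
structure GohariAnantharam (κ : ℝ) (P : PMF Ω) (s₀ : Ω → T) (s₁ : Ω → S₁) (s₂ : Ω → S₂)
    (Q : PMF Ω') (v₀ : Ω' → V₀) (v₁ : Ω' → V₁) (v₂ : Ω' → V₂) (x : Ω' → X)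
    (y₁ : Ω' → Y₁) (y₂ : Ω' → Y₂) : Prop where
  common : entropy P s₀ ≤ κ * min (mutualInfo Q v₀ y₁) (mutualInfo Q v₀ y₂)
  single₁ : entropy P s₁ ≤
    κ * (min (mutualInfo Q v₀ y₁) (mutualInfo Q v₀ y₂) + condMutualInfo Q v₁ y₁ v₀)
  single₂ : entropy P s₂ ≤
    κ * (min (mutualInfo Q v₀ y₁) (mutualInfo Q v₀ y₂) + condMutualInfo Q v₂ y₂ v₀)
  total₁ : entropy P (pair s₁ s₂) ≤
    κ * (min (mutualInfo Q v₀ y₁) (mutualInfo Q v₀ y₂) + condMutualInfo Q v₁ y₁ v₀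
      + condMutualInfo Q x y₂ (pair v₀ v₁))
  total₂ : entropy P (pair s₁ s₂) ≤
    κ * (min (mutualInfo Q v₀ y₁) (mutualInfo Q v₀ y₂) + condMutualInfo Q v₂ y₂ v₀
      + condMutualInfo Q x y₁ (pair v₀ v₂))

/-- The Gohari–Anantharam inequalities for the source `p`, with common part `φ₁(S₁)`, and the
test distribution `pV`. -/
def GohariAnantharamHolds (κ : ℝ) (p : PMF (S₁ × S₂)) (W : X → PMF (Y₁ × Y₂)) (pX : PMF X)
    (φ₁ : S₁ → T) (pV : X → PMF (V₀ × V₁ × V₂)) : Prop :=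
  GohariAnantharam κ p (fun s => φ₁ s.1) (fun s => s.1) (fun s => s.2)
    (channelJoint pX pV W) (fun ω => ω.1.1) (fun ω => ω.1.2.1) (fun ω => ω.1.2.2)
    (fun ω => ω.2.1) (fun ω => ω.2.2.1) (fun ω => ω.2.2.2)

end Bounds

end BroadcastSource

end

universe w

open BroadcastSource

noncomputable section

namespace BroadcastSource

open scoped Classical Topology Pointwise
open Real Filter

/-! ### Entropy calculus -/

section EntropyCalculus

variable {Ω α β γ δ : Type*}

/-! For a fixed input law, the ten inequalities are affine in a handful of conditional entropies:
`H(S₁|U)`, `H(S₂|U)`, `H(S₁,S₂|U)` on the source side (`sourceSide`), and the entropies of `Y₁` and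
`Y₂` given `V₀`, given `V₀,V₁` and given `V₀,V₂` on the channel side (`channelSide`). Statements
about test distributions thereby become statements about convex sets of entropy vectors.

Alphabets of the `V`s. A letter of `V₀` contributes an input measure together with entropies that
are positively homogeneous in it (`outEntropy_smul`). So attainable points are sums of elements of a
cone, `atoms`, in which `V₀` is constant. A Carathéodory argument that keeps a vector-valued sum
fixed and averages everything else (`mem_convexHull_smallSupport`) is applied twice. Keeping only
the input measure shows that `V₁` and `V₂` need `|X|` letters each, up to a mixture that `V₀`
absorbs. For `V₀` there are `|X| + 6` coordinates to keep; but `H(Y₁|V₀,V₁)` enters only with a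
minus sign (`pointSide_mono`), so it need not be kept, only not increased, which leaves `|X| + 5`
(`exists_atoms_of_mem_convexHull`).

Alphabet of `U`. The same argument writes the source entropies of any `U` as a mixture of those of
variables on at most `|S₁||S₂|` letters (`sourceEntropies_mem_convexHull`). The source entropies
that some channel-side point dominates form a convex set (`convex_feasible`), so feasibility for
small `U` implies feasibility for all.

Converse. A block of independent copies of `U` is attached to the source of a code. With Fano's
inequality, `U^m`, `S₁^m`, `S₂^m` in place of `V₀`, `V₁`, `V₂` satisfy block inequalities up to a
small error (`sourceSide_le_channelSide`). Csiszár's sum identity (`condEntropy_block_sub`) makes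
them single-letter, with `V₀(t)` consisting of `U^m`, the past of `Y₁` and the future of `Y₂`
(`channelSide_block_le`). The input laws at the various times do not involve `U`, and neither does
their average. This is what allows `p_X` to be chosen before `U`. Since the alphabets are bounded,
compactness takes care of vanishing error.

Common part. For `U = S₀` one has `I(U;S_i) = H(S₀)`, and the ten inequalities are the five
Gohari–Anantharam inequalities with each minimum written out (`boundHolds_commonPart_iff`). -/

lemma prob_nonneg (P : PMF Ω) (A : Ω → α) (a : α) : 0 ≤ prob P A a := ENNReal.toReal_nonneg

lemma prob_le_one (P : PMF Ω) (A : Ω → α) (a : α) : prob P A a ≤ 1 := by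
  have h := ENNReal.toReal_mono ENNReal.one_ne_top ((P.map A).coe_le_one a)
  simpa [prob] using h

lemma sum_toReal_pmf [Fintype α] (q : PMF α) : ∑ a, (q a).toReal = 1 := by
  rw [← ENNReal.toReal_sum (fun a _ => q.apply_ne_top a),
    ← tsum_fintype (L := .unconditional _), q.tsum_coe,
    ENNReal.toReal_one]

lemma sum_prob [Fintype α] (P : PMF Ω) (A : Ω → α) : ∑ a, prob P A a = 1 :=
  sum_toReal_pmf _

lemma prob_id (P : PMF α) (a : α) : prob P (fun ω => ω) a = (P a).toReal := by
  have : P.map (fun ω => ω) = P := P.map_id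
  simp [prob, this]

lemma prob_map (P : PMF Ω) (F : Ω → α) (A : α → β) (b : β) :
    prob (P.map F) A b = prob P (fun ω => A (F ω)) b := by
  simp only [prob, PMF.map_comp]
  rfl

/-- The law of a function of a random variable. -/
lemma prob_comp [Fintype α] (P : PMF Ω) (A : Ω → α) (φ : α → β) (b : β) :
    prob P (fun ω => φ (A ω)) b = ∑ a, if φ a = b then prob P A a else 0 := by
  have h : P.map (fun ω => φ (A ω)) = (P.map A).map φ := by
    rw [PMF.map_comp]; rfl
  simp only [prob, h]
  rw [PMF.map_apply, tsum_fintype, ENNReal.toReal_sum]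
  · refine Finset.sum_congr rfl fun a _ => ?_
    by_cases hab : φ a = b
    · simp [hab]
    · simp [hab, Ne.symm hab]
  · intro a _
    split_ifs
    · exact PMF.apply_ne_top _ _
    · simp

lemma sum_prob_comp [Fintype α] [Fintype β] (P : PMF Ω) (A : Ω → α) (φ : α → β) (F : β → ℝ) :
    ∑ b, prob P (fun ω => φ (A ω)) b * F b = ∑ a, prob P A a * F (φ a) := by
  simp_rw [prob_comp P A φ, Finset.sum_mul, ite_mul, zero_mul]
  rw [Finset.sum_comm]
  simp

lemma prob_comp_of_injective [Fintype α] (P : PMF Ω) (A : Ω → α) {φ : α → β}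
    (hφ : Function.Injective φ) (a : α) : prob P (fun ω => φ (A ω)) (φ a) = prob P A a := by
  rw [prob_comp]
  simp [hφ.eq_iff]

lemma prob_eq_zero (P : PMF Ω) {A : Ω → α} {a : α} (h : ∀ ω, A ω ≠ a) : prob P A a = 0 := by
  have : a ∉ (P.map A).support := by
    simp only [PMF.support_map, Set.mem_image, not_exists, not_and]
    exact fun ω _ => h ω
  rw [PMF.mem_support_iff, not_not] at this
  simp [prob, this]

lemma prob_snd_eq_sum [Fintype α] [Fintype β] (P : PMF Ω) (A : Ω → α) (B : Ω → β) (b : β) :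
    prob P B b = ∑ a, prob P (pair A B) (a, b) := by
  have h := prob_comp P (pair A B) Prod.snd b
  simp only [pair] at h
  rw [h, Fintype.sum_prod_type]
  simp

lemma prob_fst_eq_sum [Fintype α] [Fintype β] (P : PMF Ω) (A : Ω → α) (B : Ω → β) (a : α) :
    prob P A a = ∑ b, prob P (pair A B) (a, b) := by
  have h := prob_comp P (pair A B) Prod.fst a
  simp only [pair] at h
  rw [h, Fintype.sum_prod_type_right]
  simp

lemma prob_pair_le_snd [Fintype α] [Fintype β] (P : PMF Ω) (A : Ω → α) (B : Ω → β) (a : α) (b : β) :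
    prob P (pair A B) (a, b) ≤ prob P B b := by
  rw [prob_snd_eq_sum P A B]
  exact Finset.single_le_sum (f := fun a => prob P (pair A B) (a, b))
    (fun _ _ => prob_nonneg _ _ _) (Finset.mem_univ a)

lemma prob_le_prob_comp [Fintype α] (P : PMF Ω) (A : Ω → α) (φ : α → β) (a : α) :
    prob P A a ≤ prob P (fun ω => φ (A ω)) (φ a) := by
  rw [prob_comp P A φ]
  refine le_trans (by simp) (Finset.single_le_sum
    (f := fun a' => if φ a' = φ a then prob P A a' else 0) (fun a' _ => ?_) (Finset.mem_univ a))
  split_ifs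
  · exact prob_nonneg _ _ _
  · exact le_rfl

lemma mul_negMulLog_div (c x : ℝ) (h : c = 0 → x = 0) :
    c * negMulLog (x / c) = negMulLog x + x * log c := by
  rcases eq_or_ne c 0 with hc | hc
  · simp [hc, h hc]
  rcases eq_or_ne x 0 with hx | hx
  · simp [hx]
  · rw [negMulLog, negMulLog, log_div hx hc]
    field_simp
    ring

/-- The chain rule `H(A | B) = H(A, B) - H(B)`. -/
lemma condEntropy_eq [Fintype α] [Fintype β] (P : PMF Ω) (A : Ω → α) (B : Ω → β) :
    condEntropy P A B = entropy P (pair A B) - entropy P B := by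
  simp only [condEntropy, entropy]
  rw [Fintype.sum_prod_type_right, ← Finset.sum_sub_distrib]
  refine Finset.sum_congr rfl fun b _ => ?_
  rw [Finset.mul_sum]
  have h : ∀ a, prob P B b * negMulLog (prob P (pair A B) (a, b) / prob P B b) =
      negMulLog (prob P (pair A B) (a, b)) + prob P (pair A B) (a, b) * log (prob P B b) := by
    intro a
    refine mul_negMulLog_div _ _ fun h0 => ?_
    have := prob_pair_le_snd P A B a b
    exact le_antisymm (by rw [h0] at this; exact this) (prob_nonneg _ _ _)
  simp_rw [h]
  rw [Finset.sum_add_distrib, ← Finset.sum_mul, ← prob_snd_eq_sum P A B b]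
  simp only [negMulLog]
  ring

lemma entropy_eq_sum [Fintype α] (P : PMF Ω) (A : Ω → α) :
    entropy P A = ∑ a, prob P A a * (-log (prob P A a)) := by
  simp [entropy, negMulLog]

lemma entropy_comp_eq_sum [Fintype α] [Fintype β] (P : PMF Ω) (A : Ω → α) (φ : α → β) :
    entropy P (fun ω => φ (A ω)) =
      ∑ a, prob P A a * (-log (prob P (fun ω => φ (A ω)) (φ a))) := by
  rw [entropy_eq_sum, sum_prob_comp P A φ (fun b => -log (prob P (fun ω => φ (A ω)) b))]

/-- The tangent line bound `log x ≤ x - 1` at `x = q / p`; this is the termwise form of Gibbs'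
inequality. -/
lemma mul_log_sub_log_le {p q : ℝ} (hp : 0 ≤ p) (hq : 0 ≤ q) (h : q = 0 → p = 0) :
    p * (log q - log p) ≤ q - p := by
  rcases eq_or_ne p 0 with rfl | hp0
  · simpa using hq
  have hp' : 0 < p := lt_of_le_of_ne hp (Ne.symm hp0)
  have hq' : 0 < q := lt_of_le_of_ne hq fun h0 => hp0 (h h0.symm)
  have h1 := log_le_sub_one_of_pos (div_pos hq' hp')
  rw [log_div hq'.ne' hp0] at h1
  calc p * (log q - log p) ≤ p * (q / p - 1) := mul_le_mul_of_nonneg_left h1 hp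
    _ = q - p := by field_simp

/-- Gibbs' inequality: the conditional entropy is at most the cross entropy of any kernel. -/
lemma condEntropy_le_crossEntropy [Fintype α] [Fintype β] (P : PMF Ω) (A : Ω → α) (B : Ω → β)
    (q : β → α → ℝ) (hq : ∀ b a, 0 ≤ q b a) (hq1 : ∀ b, ∑ a, q b a ≤ 1)
    (hpos : ∀ a b, q b a = 0 → prob P (pair A B) (a, b) = 0) :
    condEntropy P A B ≤ ∑ a, ∑ b, prob P (pair A B) (a, b) * (-log (q b a)) := by
  have hB : entropy P B = ∑ a, ∑ b, prob P (pair A B) (a, b) * (-log (prob P B b)) := by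
    have := entropy_comp_eq_sum P (pair A B) Prod.snd
    rw [Fintype.sum_prod_type] at this
    exact this
  have hAB : entropy P (pair A B) =
      ∑ a, ∑ b, prob P (pair A B) (a, b) * (-log (prob P (pair A B) (a, b))) := by
    rw [entropy_eq_sum, Fintype.sum_prod_type]
  rw [condEntropy_eq, hAB, hB, ← sub_nonpos]
  -- Compares `Pr(a, b)` with `Pr(b) q(a|b)`, whose total mass is at most one; the right-hand sides
  -- then sum to something nonpositive.
  have key : ∀ a b, prob P (pair A B) (a, b) * (-log (prob P (pair A B) (a, b))) -
      prob P (pair A B) (a, b) * (-log (prob P B b)) -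
      prob P (pair A B) (a, b) * (-log (q b a)) ≤
      prob P B b * q b a - prob P (pair A B) (a, b) := by
    intro a b
    rcases eq_or_ne (prob P (pair A B) (a, b)) 0 with h0 | h0
    · rw [h0]; simpa using mul_nonneg (prob_nonneg P B b) (hq b a)
    have hq0 : q b a ≠ 0 := fun h => h0 (hpos a b h)
    have hB0 : prob P B b ≠ 0 := fun h => h0 (le_antisymm
      (by simpa [h] using prob_pair_le_snd P A B a b) (prob_nonneg _ _ _))
    have := mul_log_sub_log_le (prob_nonneg P (pair A B) (a, b))
      (mul_nonneg (prob_nonneg P B b) (hq b a))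
      (fun h => absurd h (mul_ne_zero hB0 hq0))
    rw [log_mul hB0 hq0] at this
    linarith
  have hsum : ∑ a, ∑ b, (prob P B b * q b a - prob P (pair A B) (a, b)) ≤ 0 := by
    rw [Finset.sum_comm]
    refine Finset.sum_nonpos fun b _ => ?_
    rw [Finset.sum_sub_distrib, ← Finset.mul_sum, ← prob_snd_eq_sum P A B b, sub_nonpos]
    exact mul_le_of_le_one_right (prob_nonneg _ _ _) (hq1 b)
  refine le_trans (le_of_eq ?_) (le_trans (Finset.sum_le_sum fun a _ =>
    Finset.sum_le_sum fun b _ => key a b) hsum)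
  simp only [← Finset.sum_sub_distrib]

/-- Conditioning reduces entropy. -/
lemma condEntropy_pair_le [Fintype α] [Fintype β] [Fintype γ] (P : PMF Ω) (A : Ω → α) (B : Ω → β)
    (C : Ω → γ) : condEntropy P A (pair B C) ≤ condEntropy P A C := by
  -- The comparison kernel is `Pr(a|c)`, which ignores `B`; its cross entropy is exactly `H(A|C)`.
  refine le_trans (condEntropy_le_crossEntropy P A (pair B C)
    (fun bc a => prob P (pair A C) (a, bc.2) / prob P C bc.2) ?_ ?_ ?_) (le_of_eq ?_)
  · intro bc a
    exact div_nonneg (prob_nonneg _ _ _) (prob_nonneg _ _ _)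
  · intro bc
    rw [← Finset.sum_div, ← prob_snd_eq_sum P A C]
    exact div_self_le_one _
  · intro a bc h
    have h1 : prob P (pair A (pair B C)) (a, bc) ≤ prob P (pair A C) (a, bc.2) :=
      prob_le_prob_comp P (pair A (pair B C)) (fun x => (x.1, x.2.2)) (a, bc)
    have h2 := prob_pair_le_snd P A C a bc.2
    rcases div_eq_zero_iff.1 h with h | h
    · exact le_antisymm (by rw [h] at h1; exact h1) (prob_nonneg _ _ _)
    · exact le_antisymm (by rw [h] at h2; exact h1.trans h2) (prob_nonneg _ _ _)
  · have hAC := entropy_comp_eq_sum P (pair A (pair B C)) (fun x => (x.1, x.2.2))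
    have hC := entropy_comp_eq_sum P (pair A (pair B C)) (fun x => x.2.2)
    rw [condEntropy_eq]
    change _ = entropy P (fun ω => ((pair A (pair B C) ω).1, (pair A (pair B C) ω).2.2)) -
      entropy P (fun ω => (pair A (pair B C) ω).2.2)
    rw [hAC, hC, ← Finset.sum_sub_distrib, Fintype.sum_prod_type]
    refine Finset.sum_congr rfl fun a _ => Finset.sum_congr rfl fun bc _ => ?_
    change prob P (pair A (pair B C)) (a, bc) * -log (prob P (pair A C) (a, bc.2) / prob P C bc.2) =
      prob P (pair A (pair B C)) (a, bc) * -log (prob P (pair A C) (a, bc.2)) -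
      prob P (pair A (pair B C)) (a, bc) * -log (prob P C bc.2)
    rcases eq_or_ne (prob P (pair A (pair B C)) (a, bc)) 0 with h0 | h0
    · simp [h0]
    have h1 : prob P (pair A (pair B C)) (a, bc) ≤ prob P (pair A C) (a, bc.2) :=
      prob_le_prob_comp P (pair A (pair B C)) (fun x => (x.1, x.2.2)) (a, bc)
    have h2 := prob_pair_le_snd P A C a bc.2
    have hp : 0 < prob P (pair A (pair B C)) (a, bc) :=
      lt_of_le_of_ne (prob_nonneg _ _ _) (Ne.symm h0)
    rw [log_div (hp.trans_le h1).ne' (hp.trans_le (h1.trans h2)).ne']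
    ring

lemma condEntropy_nonneg [Fintype α] [Fintype β] (P : PMF Ω) (A : Ω → α) (B : Ω → β) :
    0 ≤ condEntropy P A B := by
  refine Finset.sum_nonneg fun b _ => mul_nonneg (prob_nonneg _ _ _)
    (Finset.sum_nonneg fun a _ => negMulLog_nonneg
      (div_nonneg (prob_nonneg _ _ _) (prob_nonneg _ _ _)) ?_)
  exact div_le_one_of_le₀ (prob_pair_le_snd P A B a b) (prob_nonneg _ _ _)

lemma entropy_nonneg [Fintype α] (P : PMF Ω) (A : Ω → α) : 0 ≤ entropy P A :=
  Finset.sum_nonneg fun _ _ => negMulLog_nonneg (prob_nonneg _ _ _) (prob_le_one _ _ _)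

/-- The entropy of a function of `B` is at most that of `B`. -/
lemma entropy_comp_le [Fintype α] [Fintype β] (P : PMF Ω) (B : Ω → β) (φ : β → α) :
    entropy P (fun ω => φ (B ω)) ≤ entropy P B := by
  rw [entropy_comp_eq_sum, entropy_eq_sum]
  refine Finset.sum_le_sum fun b _ => ?_
  rcases eq_or_ne (prob P B b) 0 with h0 | h0
  · simp [h0]
  have hp : 0 < prob P B b := lt_of_le_of_ne (prob_nonneg _ _ _) (Ne.symm h0)
  exact mul_le_mul_of_nonneg_left
    (neg_le_neg (log_le_log hp (prob_le_prob_comp P B φ b))) hp.le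

/-- `A` is a function of `B`. -/
def FunctionOf (A : Ω → α) (B : Ω → β) : Prop := ∀ ω ω', B ω = B ω' → A ω = A ω'

lemma FunctionOf.exists_eq_comp (P : PMF Ω) {A : Ω → α} {B : Ω → β} (h : FunctionOf A B) :
    ∃ φ : β → α, A = fun ω => φ (B ω) := by
  -- The law supplies a point of `Ω`, whose value extends the function off the range of `B`.
  have hne : Nonempty Ω := P.support_nonempty.to_type
  refine ⟨fun b => if hb : ∃ ω, B ω = b then A hb.choose else A hne.some, funext fun ω => ?_⟩
  have hb : ∃ ω', B ω' = B ω := ⟨ω, rfl⟩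
  simp only [dif_pos hb]
  exact h _ _ hb.choose_spec.symm

lemma entropy_le_of_functionOf [Fintype α] [Fintype β] (P : PMF Ω) {A : Ω → α} {B : Ω → β}
    (h : FunctionOf A B) : entropy P A ≤ entropy P B := by
  obtain ⟨φ, rfl⟩ := h.exists_eq_comp P
  exact entropy_comp_le P B φ

/-- Entropy depends only on the partition of `Ω` that a variable induces. All regroupings of tuples
and blocks of variables below rest on this. -/
lemma entropy_congr [Fintype α] [Fintype β] (P : PMF Ω) {A : Ω → α} {B : Ω → β}
    (h : ∀ ω ω', A ω = A ω' ↔ B ω = B ω') : entropy P A = entropy P B :=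
  le_antisymm (entropy_le_of_functionOf P fun ω ω' => (h ω ω').2)
    (entropy_le_of_functionOf P fun ω ω' => (h ω ω').1)

lemma entropy_pair_comm [Fintype α] [Fintype β] (P : PMF Ω) (A : Ω → α) (B : Ω → β) :
    entropy P (pair A B) = entropy P (pair B A) :=
  entropy_congr P fun ω ω' => by simp [pair, and_comm]

lemma condEntropy_congr [Fintype α] [Fintype β] [Fintype γ] [Fintype δ] (P : PMF Ω) {A : Ω → α}
    {A' : Ω → γ} {B : Ω → β} {B' : Ω → δ} (hA : ∀ ω ω', A ω = A ω' ↔ A' ω = A' ω')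
    (hB : ∀ ω ω', B ω = B ω' ↔ B' ω = B' ω') : condEntropy P A B = condEntropy P A' B' := by
  rw [condEntropy_eq, condEntropy_eq, entropy_congr P hB,
    entropy_congr P (A := pair A B) (B := pair A' B')]
  intro ω ω'
  simp [pair, hA ω ω', hB ω ω']

lemma condEntropy_mono [Fintype α] [Fintype β] [Fintype γ] (P : PMF Ω) (A : Ω → α) {B : Ω → β}
    {C : Ω → γ} (h : FunctionOf C B) : condEntropy P A B ≤ condEntropy P A C := by
  rw [condEntropy_congr P (A' := A) (B' := pair B C) (fun _ _ => Iff.rfl)]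
  · exact condEntropy_pair_le P A B C
  · intro ω ω'
    simp only [pair, Prod.mk.injEq]
    exact ⟨fun hb => ⟨hb, h _ _ hb⟩, fun hb => hb.1⟩

lemma entropy_unique [Fintype α] [Subsingleton α] (P : PMF Ω) (A : Ω → α) : entropy P A = 0 := by
  refine le_antisymm ?_ (entropy_nonneg P A)
  refine Finset.sum_nonpos fun a _ => ?_
  have h : prob P A a = 1 := by
    rw [← sum_prob P A]
    exact (Fintype.sum_subsingleton _ a).symm
  simp [h]

lemma condEntropy_unit [Fintype α] (P : PMF Ω) (A : Ω → α) :
    condEntropy P A (fun _ => ()) = entropy P A := by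
  rw [condEntropy_eq, entropy_unique P (fun _ => ()), sub_zero]
  exact entropy_congr P fun ω ω' => by simp [pair]

lemma condEntropy_le_entropy [Fintype α] [Fintype β] (P : PMF Ω) (A : Ω → α) (B : Ω → β) :
    condEntropy P A B ≤ entropy P A := by
  rw [← condEntropy_unit]
  exact condEntropy_mono P A fun _ _ _ => rfl

lemma mutualInfo_nonneg [Fintype α] [Fintype β] (P : PMF Ω) (A : Ω → α) (B : Ω → β) :
    0 ≤ mutualInfo P A B := sub_nonneg.2 (condEntropy_le_entropy P A B)

lemma condMutualInfo_nonneg [Fintype α] [Fintype β] [Fintype γ] (P : PMF Ω) (A : Ω → α) (B : Ω → β)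
    (C : Ω → γ) : 0 ≤ condMutualInfo P A B C := sub_nonneg.2 (condEntropy_pair_le P A B C)

lemma mutualInfo_eq [Fintype α] [Fintype β] (P : PMF Ω) (A : Ω → α) (B : Ω → β) :
    mutualInfo P A B = entropy P B - condEntropy P B A := by
  rw [mutualInfo, condEntropy_eq, condEntropy_eq, entropy_pair_comm P A B]
  ring

lemma condMutualInfo_eq [Fintype α] [Fintype β] [Fintype γ] (P : PMF Ω) (A : Ω → α) (B : Ω → β)
    (C : Ω → γ) : condMutualInfo P A B C = condEntropy P B C - condEntropy P B (pair C A) := by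
  simp only [condMutualInfo, condEntropy_eq]
  have h1 : entropy P (pair A (pair B C)) = entropy P (pair B (pair C A)) :=
    entropy_congr P fun ω ω' => by simp [pair]; tauto
  rw [h1, entropy_pair_comm P A C]
  ring

lemma entropy_map [Fintype β] (P : PMF Ω) (F : Ω → α) (A : α → β) :
    entropy (P.map F) A = entropy P (fun ω => A (F ω)) := by
  simp [entropy, prob_map]

end EntropyCalculus

/-! ### Points with small support -/

section SmallSupport

variable {K E : Type*} [Fintype K]

/-- Moves `w` in the direction `g` until the first weight vanishes; the step length is the least
ratio `w k / (-g k)` over the decreasing entries. -/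
lemma exists_boundary_step (w g : K → ℝ) (hw : ∀ k, 0 ≤ w k) (hg : ∀ k, w k = 0 → g k = 0)
    (hneg : ∃ k, g k < 0) :
    ∃ t : ℝ, 0 < t ∧ (∀ k, 0 ≤ w k + t * g k) ∧ ∃ k, w k ≠ 0 ∧ w k + t * g k = 0 := by
  have hne : (Finset.univ.filter fun k => g k < 0).Nonempty := by
    obtain ⟨k, hk⟩ := hneg
    exact ⟨k, by simpa using hk⟩
  obtain ⟨k₀, hk₀, hmin⟩ := Finset.exists_min_image _ (fun k => w k / (-g k)) hne
  simp only [Finset.mem_filter, Finset.mem_univ, true_and] at hk₀ hmin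
  have hw₀ : w k₀ ≠ 0 := fun h => by
    have := hg _ h
    linarith
  have hw₀' : 0 < w k₀ := lt_of_le_of_ne (hw _) (Ne.symm hw₀)
  refine ⟨w k₀ / (-g k₀), div_pos hw₀' (by linarith), fun k => ?_, k₀, hw₀, ?_⟩
  · rcases lt_or_ge (g k) 0 with h | h
    · have h1 := hmin k h
      rw [le_div_iff₀ (by linarith : (0 : ℝ) < -g k)] at h1
      linarith
    · exact add_nonneg (hw k) (mul_nonneg (div_pos hw₀' (by linarith)).le h)
  · have : g k₀ ≠ 0 := hk₀.ne
    field_simp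
    ring

variable [AddCommGroup E] [Module ℝ E]

/-- The weights `w'` with the same support condition and the same weighted sum of the vectors `A k`
as `w`, with at most `dim E` nonzero entries. -/
def smallSupport (A : K → E) (w : K → ℝ) : Set (K → ℝ) :=
  {w' | (∀ k, 0 ≤ w' k) ∧ (∀ k, w k = 0 → w' k = 0) ∧ ∑ k, w' k • A k = ∑ k, w k • A k ∧
    (Finset.univ.filter fun k => w' k ≠ 0).card ≤ Module.finrank ℝ E}

lemma smallSupport_mono (A : K → E) {w v : K → ℝ} (h : ∀ k, w k = 0 → v k = 0)
    (hs : ∑ k, v k • A k = ∑ k, w k • A k) : smallSupport A v ⊆ smallSupport A w :=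
  fun _ hw' => ⟨hw'.1, fun k hk => hw'.2.1 k (h k hk), hw'.2.2.1.trans hs, hw'.2.2.2⟩

/-- Nonnegative weights are a convex combination of weights with small support that yield the same
weighted sum of vectors lying in an open half-space. -/
lemma mem_convexHull_smallSupport [FiniteDimensional ℝ E] (A : K → E) (l : E →ₗ[ℝ] ℝ)
    (w : K → ℝ) (hw : ∀ k, 0 ≤ w k)
    (hpos : ∀ k, w k ≠ 0 → 0 < l (A k)) : w ∈ convexHull ℝ (smallSupport A w) := by
  induction hn : (Finset.univ.filter fun k => w k ≠ 0).card using Nat.strong_induction_on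
    generalizing w with
  | _ n ih =>
  by_cases hd : n ≤ Module.finrank ℝ E
  · exact subset_convexHull ℝ _ ⟨hw, fun _ h => h, rfl, hn.trans_le hd⟩
  -- More than `dim E` vectors carry weight, so there is a linear relation `g` among them; moving
  -- `w` along `g` or `-g` does not change the weighted sum.
  have hdep : ¬ LinearIndependent ℝ fun k : {k // w k ≠ 0} => A k := fun hli => by
    have := hli.fintype_card_le_finrank
    rw [Fintype.card_subtype, hn] at this
    exact hd this
  obtain ⟨g', hg', i, hi⟩ := Fintype.not_linearIndependent_iff.1 hdep
  set g : K → ℝ := fun k => if h : w k ≠ 0 then g' ⟨k, h⟩ else 0 with hgdef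
  have hg0 : ∀ k, w k = 0 → g k = 0 := fun k hk => by simp [hgdef, hk]
  have hgsum : ∑ k, g k • A k = 0 := by
    rw [← hg', ← Fintype.sum_subtype_add_sum_subtype (fun k => w k ≠ 0) fun k => g k • A k]
    have h1 : ∑ k : {k // ¬ w k ≠ 0}, g k • A k = 0 :=
      Finset.sum_eq_zero fun k _ => by rw [hg0 _ (not_not.1 k.2), zero_smul]
    rw [h1, add_zero]
    exact Finset.sum_congr rfl fun k _ => by simp [hgdef, k.2]
  have hl : ∑ k, g k * l (A k) = 0 := by
    have := congrArg l hgsum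
    simpa using this
  -- At the boundary the support has shrunk, so the induction hypothesis covers the endpoint.
  have hstep : ∀ g : K → ℝ, (∀ k, w k = 0 → g k = 0) → ∑ k, g k • A k = 0 → (∃ k, g k < 0) →
      ∃ t : ℝ, 0 < t ∧ (fun k => w k + t * g k) ∈ convexHull ℝ (smallSupport A w) := by
    intro g hg0 hgsum hneg
    obtain ⟨t, ht, hnn, k₁, hk₁, hz⟩ := exists_boundary_step w g hw hg0 hneg
    have hsub : ∀ k, w k = 0 → w k + t * g k = 0 := fun k hk => by simp [hk, hg0 k hk]
    refine ⟨t, ht, convexHull_mono (smallSupport_mono A (v := fun k => w k + t * g k) hsub ?_)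
      (ih _ ?_ (fun k => w k + t * g k) hnn ?_ rfl)⟩
    · simp only [add_smul, Finset.sum_add_distrib, mul_smul, ← Finset.smul_sum, hgsum, smul_zero,
        add_zero]
    · rw [← hn]
      refine Finset.card_lt_card ⟨fun k hk => ?_, fun hss => ?_⟩
      · simp only [Finset.mem_filter, Finset.mem_univ, true_and] at hk ⊢
        exact fun h => hk (hsub k h)
      · have := hss (show k₁ ∈ Finset.univ.filter fun k => w k ≠ 0 by simpa using hk₁)
        simp only [Finset.mem_filter, Finset.mem_univ, true_and] at this
        exact this hz
    · exact fun k hk => hpos k fun h => hk (hsub k h)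
  have hgi : g i ≠ 0 := by simpa [hgdef, i.2] using hi
  -- Since `l` is positive on the vectors in use, a nontrivial relation cannot have all coefficients
  -- nonnegative; hence the boundary is reached in both directions.
  have hneg : ∀ g : K → ℝ, (∀ k, w k = 0 → g k = 0) → ∑ k, g k * l (A k) = 0 → (∃ k, g k ≠ 0) →
      ∃ k, g k < 0 := by
    intro g hg0 hl ⟨k, hk⟩
    by_contra! hcon
    have hterm : ∀ k ∈ Finset.univ, 0 ≤ g k * l (A k) := fun k _ => by
      by_cases hwk : w k = 0
      · simp [hg0 k hwk]
      · exact mul_nonneg (hcon k) (hpos k hwk).le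
    have h0 := (Finset.sum_eq_zero_iff_of_nonneg hterm).1 hl k (Finset.mem_univ k)
    have hwk : w k ≠ 0 := fun h => hk (hg0 k h)
    exact (mul_ne_zero hk (hpos k hwk).ne') h0
  obtain ⟨t, ht, hmt⟩ := hstep g hg0 hgsum (hneg g hg0 hl ⟨i, hgi⟩)
  obtain ⟨s, hs, hms⟩ := hstep (fun k => -g k) (fun k hk => by simp [hg0 k hk])
    (by simpa using hgsum)
    (hneg _ (fun k hk => by simp [hg0 k hk]) (by simpa using hl) ⟨i, by simpa using hgi⟩)
  -- `w` is the convex combination of `w + t g` and `w - s g` with weights `s / (s + t)` and `t / (s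
  -- + t)`.
  have hcomb := (convex_convexHull ℝ (smallSupport A w)) hmt hms
    (div_nonneg hs.le (add_pos hs ht).le) (div_nonneg ht.le (add_pos hs ht).le)
    (by rw [← add_div, div_self (add_pos hs ht).ne'])
  convert hcomb using 1
  ext k
  have : s + t ≠ 0 := (add_pos hs ht).ne'
  simp only [Pi.add_apply, Pi.smul_apply, smul_eq_mul]
  field_simp
  ring

/-- Some point of `s` does at least as well as a given point of its convex hull. -/
lemma exists_le_of_mem_convexHull {F : Type*} [AddCommGroup F] [Module ℝ F] {s : Set F} {x : F}
    (hx : x ∈ convexHull ℝ s) (f : F →ₗ[ℝ] ℝ) : ∃ y ∈ s, f y ≤ f x := by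
  by_contra! h
  have hlt : f x < f x :=
    convexHull_min (t := {y | f x < f y}) h (convex_halfSpace_gt f.isLinear _) hx
  exact lt_irrefl _ hlt

/-- A finite family with few members can be enumerated by `Fin N`, padding with zeros. -/
lemma exists_fin_enumeration.{u, v, r} {K : Type u} {M : Type v} [Zero M]
    (s : Finset K) {N : ℕ} (hs : s.card ≤ N) (F : K → M) :
    ∃ G : Fin N → M, (∀ i, G i = 0 ∨ ∃ k ∈ s, G i = F k) ∧
      ∀ {R : Type r} [AddCommMonoid R] (Φ : M → R), Φ 0 = 0 → ∑ i, Φ (G i) = ∑ k ∈ s, Φ (F k) := by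
  have hcard : Fintype.card s ≤ Fintype.card (Fin N) := by simpa using hs
  obtain ⟨e⟩ := Function.Embedding.nonempty_of_card_le hcard
  refine ⟨fun i => if h : ∃ k : s, e k = i then F h.choose else 0, fun i => ?_, ?_⟩
  · by_cases h : ∃ k : s, e k = i
    · exact Or.inr ⟨h.choose, h.choose.2, by simp only [dif_pos h]⟩
    · exact Or.inl (by simp only [dif_neg h])
  · intro R _ Φ hΦ
    rw [← Finset.sum_coe_sort s fun k => Φ (F k)]
    symm
    refine Finset.sum_of_injOn e e.injective.injOn (fun _ _ => by simp) (fun i _ hi => ?_)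
      fun k _ => ?_
    · have : ¬ ∃ k : s, e k = i := fun ⟨k, hk⟩ => hi ⟨k, by simp, hk⟩
      simp only [dif_neg this, hΦ]
    · have h : ∃ k' : s, e k' = e k := ⟨k, rfl⟩
      simp only [dif_pos h]
      rw [e.injective h.choose_spec]

end SmallSupport

/-! ### Conditional output entropies as functions of the input law -/

section OutEntropy

variable {X Y : Type*} [Fintype X] [Fintype Y]

/-- `w` is a matrix of transition probabilities. -/
structure IsChannel (w : X → Y → ℝ) : Prop where
  nonneg : ∀ x y, 0 ≤ w x y
  sum_one : ∀ x, ∑ y, w x y = 1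

/-- For an input measure `q` of mass `c`, `c` times the output entropy of the input law `q / c`. -/
def outEntropy (w : X → Y → ℝ) (q : X → ℝ) : ℝ :=
  ∑ y, negMulLog (∑ x, q x * w x y) - negMulLog (∑ x, q x)

@[simp] lemma outEntropy_zero (w : X → Y → ℝ) : outEntropy w 0 = 0 := by
  simp [outEntropy]

lemma sum_output {w : X → Y → ℝ} (hw : IsChannel w) (q : X → ℝ) :
    ∑ y, ∑ x, q x * w x y = ∑ x, q x := by
  rw [Finset.sum_comm]
  simp [← Finset.mul_sum, hw.sum_one]

/-- Scaling adds `negMulLog c` times the mass to both terms, and a channel preserves mass, so the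
additions cancel. This homogeneity turns letters of `V₀` into elements of a cone. -/
lemma outEntropy_smul {w : X → Y → ℝ} (hw : IsChannel w) (c : ℝ) (q : X → ℝ) :
    outEntropy w (c • q) = c * outEntropy w q := by
  have h : ∀ y, negMulLog (∑ x, (c • q) x * w x y) =
      (∑ x, q x * w x y) * negMulLog c + c * negMulLog (∑ x, q x * w x y) := fun y => by
    rw [← negMulLog_mul, Finset.mul_sum]
    simp only [Pi.smul_apply, smul_eq_mul, mul_assoc]
  have h' : negMulLog (∑ x, (c • q) x) =
      (∑ x, q x) * negMulLog c + c * negMulLog (∑ x, q x) := by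
    rw [← negMulLog_mul, Finset.mul_sum]
    simp only [Pi.smul_apply, smul_eq_mul]
  rw [outEntropy, h']
  simp_rw [h]
  rw [Finset.sum_add_distrib, ← Finset.sum_mul, sum_output hw, ← Finset.mul_sum, outEntropy]
  ring

lemma outEntropy_single {w : X → Y → ℝ} (hw : IsChannel w) (c : ℝ) (x : X) :
    outEntropy w (Pi.single x c) = c * ∑ y, negMulLog (w x y) := by
  have h : (Pi.single x c : X → ℝ) = c • Pi.single x 1 := by
    ext x'; simp [Pi.single_apply]
  rw [h, outEntropy_smul hw, outEntropy]
  simp [Pi.single_apply]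

lemma outEntropy_eq_of_sum_eq_one (w : X → Y → ℝ) {q : X → ℝ} (hq : ∑ x, q x = 1) :
    outEntropy w q = ∑ y, negMulLog (∑ x, q x * w x y) := by
  simp [outEntropy, hq]

/-- The output entropy is concave in the input law. -/
lemma sum_outEntropy_le {ι : Type*} [Fintype ι] {w : X → Y → ℝ} (hw : IsChannel w) (c : ι → ℝ)
    (q : ι → X → ℝ) (hc : ∀ i, 0 ≤ c i) (hc1 : ∑ i, c i = 1) (hq : ∀ i x, 0 ≤ q i x)
    (hq1 : ∀ i, ∑ x, q i x = 1) :
    ∑ i, c i * outEntropy w (q i) ≤ outEntropy w (∑ i, c i • q i) := by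
  have h1 : ∑ x, (∑ i, c i • q i) x = 1 := by
    simp only [Finset.sum_apply, Pi.smul_apply, smul_eq_mul]
    rw [Finset.sum_comm]
    simp [← Finset.mul_sum, hq1, hc1]
  rw [outEntropy_eq_of_sum_eq_one w h1]
  simp_rw [outEntropy_eq_of_sum_eq_one w (hq1 _), Finset.mul_sum]
  rw [Finset.sum_comm]
  refine Finset.sum_le_sum fun y _ => ?_
  have := concaveOn_negMulLog.le_map_sum (t := Finset.univ) (w := c)
    (p := fun i => ∑ x, q i x * w x y) (fun i _ => hc i) hc1
    (fun i _ => Finset.sum_nonneg fun x _ => mul_nonneg (hq i x) (hw.nonneg x y))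
  refine this.trans (le_of_eq (congrArg _ ?_))
  simp only [Finset.sum_apply, Pi.smul_apply, smul_eq_mul, Finset.sum_mul, Finset.mul_sum]
  rw [Finset.sum_comm]
  simp only [mul_assoc]

lemma continuous_outEntropy (w : X → Y → ℝ) : Continuous (outEntropy w) := by
  unfold outEntropy
  fun_prop

end OutEntropy

/-! ### Markov chains -/

section Markov

variable {Ω V X Y : Type*} [Fintype V] [Fintype X] [Fintype Y]

/-- `V → X → Y` is a Markov chain with transition probabilities `w` from `X` to `Y`. -/
def IsMarkov (P : PMF Ω) (v : Ω → V) (x : Ω → X) (y : Ω → Y) (w : X → Y → ℝ) : Prop :=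
  ∀ a b c, prob P (pair (pair v x) y) ((a, b), c) = prob P (pair v x) (a, b) * w b c

/-- The transition factor does not depend on the value of `v`, so the defining identity may be
summed over a fibre of `φ`. -/
lemma IsMarkov.comp {V' : Type*} [Fintype V'] {P : PMF Ω} {v : Ω → V} {x : Ω → X} {y : Ω → Y}
    {w : X → Y → ℝ} (h : IsMarkov P v x y w) (φ : V → V') :
    IsMarkov P (fun ω => φ (v ω)) x y w := by
  intro a b c
  have h1 := prob_comp P (pair (pair v x) y) (fun z => ((φ z.1.1, z.1.2), z.2)) ((a, b), c)
  have h2 := prob_comp P (pair v x) (fun z => (φ z.1, z.2)) (a, b)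
  change prob P (fun ω => ((φ (v ω), x ω), y ω)) ((a, b), c) =
    prob P (fun ω => (φ (v ω), x ω)) (a, b) * w b c
  simp only [pair] at h1 h2
  rw [h1, h2, Fintype.sum_prod_type, Finset.sum_mul]
  simp only [Prod.mk.injEq]
  refine Finset.sum_congr rfl fun z _ => ?_
  by_cases hz : φ z.1 = a ∧ z.2 = b
  · obtain ⟨hz1, hz2⟩ := hz
    simp only [hz1, hz2, true_and, if_true]
    rw [Finset.sum_ite_eq' Finset.univ c, if_pos (Finset.mem_univ _), ← hz2]
    exact h z.1 z.2 c
  · simp [hz]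

lemma IsMarkov.of_functionOf {V' : Type*} [Fintype V'] {P : PMF Ω} {v : Ω → V} {v' : Ω → V'}
    {x : Ω → X} {y : Ω → Y} {w : X → Y → ℝ} (h : IsMarkov P v x y w) (hf : FunctionOf v' v) :
    IsMarkov P v' x y w := by
  obtain ⟨φ, rfl⟩ := hf.exists_eq_comp P
  exact h.comp φ

/-- `H(Y,V) - H(V)` splits over the letters of `V`, and by the Markov property the probabilities
`Pr(V = a, Y = c)` are the outputs of the input measure on the event `V = a`. -/
lemma IsMarkov.condEntropy_eq {P : PMF Ω} {v : Ω → V} {x : Ω → X} {y : Ω → Y} {w : X → Y → ℝ}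
    (h : IsMarkov P v x y w) :
    condEntropy P y v = ∑ a, outEntropy w fun b => prob P (pair v x) (a, b) := by
  rw [BroadcastSource.condEntropy_eq, entropy, entropy, Fintype.sum_prod_type_right,
    ← Finset.sum_sub_distrib]
  refine Finset.sum_congr rfl fun a _ => ?_
  rw [outEntropy, ← prob_fst_eq_sum P v x a]
  congr 1
  refine Finset.sum_congr rfl fun c _ => congrArg _ ?_
  have h1 := prob_comp P (pair (pair v x) y) (fun z => (z.2, z.1.1)) (c, a)
  change prob P (fun ω => (y ω, v ω)) (c, a) = _
  simp only [pair] at h1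
  rw [h1, Fintype.sum_prod_type, Fintype.sum_prod_type]
  simp only [Prod.mk.injEq, ite_and, Finset.sum_ite_eq', Finset.mem_univ, if_true]
  rw [Finset.sum_comm]
  simp only [Finset.sum_ite_eq', Finset.mem_univ, if_true]
  exact Finset.sum_congr rfl fun b _ => h a b c

lemma IsMarkov.entropy_eq {P : PMF Ω} {v : Ω → V} {x : Ω → X} {y : Ω → Y} {w : X → Y → ℝ}
    (h : IsMarkov P v x y w) : entropy P y = outEntropy w fun b => prob P x b := by
  rw [← condEntropy_unit, (h.comp fun _ => ()).condEntropy_eq]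
  simp only [Finset.univ_unique, Finset.sum_singleton]
  congr 1
  funext b
  exact prob_comp_of_injective P x (φ := fun b => ((), b)) (fun _ _ h => congrArg Prod.snd h) b

lemma IsMarkov.pair_input {P : PMF Ω} {v : Ω → V} {x : Ω → X} {y : Ω → Y} {w : X → Y → ℝ}
    (h : IsMarkov P v x y w) : IsMarkov P (pair v x) x y w := by
  rintro ⟨a, b'⟩ b c
  by_cases hb : b' = b
  · subst hb
    have h1 := prob_comp_of_injective P (pair (pair v x) y) (φ := fun z => ((z.1, z.1.2), z.2))
      (fun z z' hz => by simp only [Prod.mk.injEq] at hz; exact Prod.ext hz.1.1 hz.2) ((a, b'), c)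
    have h2 := prob_comp_of_injective P (pair v x) (φ := fun z => (z, z.2))
      (fun z z' hz => congrArg Prod.fst hz) (a, b')
    calc _ = prob P (pair (pair v x) y) ((a, b'), c) := h1
      _ = _ := h a b' c
      _ = _ := by rw [← h2]; rfl
  · rw [prob_eq_zero, prob_eq_zero, zero_mul]
    · intro ω hω
      simp only [pair, Prod.mk.injEq] at hω
      exact hb (hω.1.2.symm.trans hω.2)
    · intro ω hω
      simp only [pair, Prod.mk.injEq] at hω
      exact hb (hω.1.1.2.symm.trans hω.1.2)

/-- When `X` is part of the conditioning, `H(Y | V)` depends only on the law of `X`. -/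
lemma IsMarkov.condEntropy_eq_of_functionOf {P : PMF Ω} {v : Ω → V} {x : Ω → X} {y : Ω → Y}
    {w : X → Y → ℝ} (hw : IsChannel w) (h : IsMarkov P v x y w) (hx : FunctionOf x v) :
    condEntropy P y v = ∑ b, prob P x b * ∑ c, negMulLog (w b c) := by
  obtain ⟨φ, rfl⟩ := hx.exists_eq_comp P
  -- On the event `V = a` the input is the single letter `φ a`, so the input measure is a point
  -- mass.
  have h1 : ∀ a, (fun b => prob P (pair v fun ω => φ (v ω)) (a, b)) =
      Pi.single (φ a) (prob P v a) := by
    intro a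
    funext b
    have h2 := prob_comp P v (fun a => (a, φ a)) (a, b)
    change prob P (fun ω => (v ω, φ (v ω))) (a, b) = _
    rw [h2]
    simp only [Prod.mk.injEq, ite_and, Finset.sum_ite_eq', Finset.mem_univ, if_true,
      Pi.single_apply]
    simp only [eq_comm]
  rw [h.condEntropy_eq]
  simp_rw [h1, outEntropy_single hw]
  rw [sum_prob_comp P v φ fun b => ∑ c, negMulLog (w b c)]

end Markov

/-! ### The entropies attainable by auxiliary variables with bounded alphabets -/

section Atoms

variable {X Y₁ Y₂ : Type*} [Fintype X] [Fintype Y₁] [Fintype Y₂]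

/-- The sums of output entropies over the decompositions of the input measure `q` into `|X|`
parts. -/
def splitEntropies (w₁ : X → Y₁ → ℝ) (w₂ : X → Y₂ → ℝ) (q : X → ℝ) : Set (ℝ × ℝ) :=
  {b | ∃ A : Fin (Fintype.card X) → X → ℝ, (∀ k x, 0 ≤ A k x) ∧ ∑ k, A k = q ∧
    b = (∑ k, outEntropy w₁ (A k), ∑ k, outEntropy w₂ (A k))}

lemma sum_pos_of_nonneg_of_ne_zero {q : X → ℝ} (hq : ∀ x, 0 ≤ q x) (h : q ≠ 0) :
    0 < ∑ x, q x := by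
  obtain ⟨x, hx⟩ := Function.ne_iff.1 h
  exact Finset.sum_pos' (fun x _ => hq x) ⟨x, Finset.mem_univ x,
    lt_of_le_of_ne (hq x) (Ne.symm hx)⟩

/-- The functional that sums the entries of a vector. -/
def sumEntries (X : Type*) [Fintype X] : (X → ℝ) →ₗ[ℝ] ℝ := ∑ x, LinearMap.proj x

lemma sumEntries_apply (q : X → ℝ) : sumEntries X q = ∑ x, q x := by
  simp [sumEntries]

/-- The linear functional `w ↦ ∑ k, w k * f k`. -/
def weigh {K : Type*} [Fintype K] (f : K → ℝ) : (K → ℝ) →ₗ[ℝ] ℝ := ∑ k, f k • LinearMap.proj k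

lemma weigh_apply {K : Type*} [Fintype K] (f w : K → ℝ) : weigh f w = ∑ k, w k * f k := by
  simp [weigh, mul_comm]

/-- The entropies of any decomposition of `q` are a mixture of those of decompositions into `|X|`
parts. -/
lemma sum_outEntropy_mem_convexHull {w₁ : X → Y₁ → ℝ} {w₂ : X → Y₂ → ℝ} (h₁ : IsChannel w₁)
    (h₂ : IsChannel w₂) {K : Type*} [Fintype K] (A : K → X → ℝ) (hA : ∀ k x, 0 ≤ A k x) :
    (∑ k, outEntropy w₁ (A k), ∑ k, outEntropy w₂ (A k)) ∈
      convexHull ℝ (splitEntropies w₁ w₂ (∑ k, A k)) := by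
  -- Zero parts receive weight zero, because the mass functional must be strictly positive on every
  -- vector in use.
  set u : K → ℝ := fun k => if A k = 0 then 0 else 1 with hu
  have hmem := mem_convexHull_smallSupport A (sumEntries X) u
    (fun k => by simp only [hu]; split_ifs <;> norm_num) (fun k hk => by
      rw [sumEntries_apply]
      refine sum_pos_of_nonneg_of_ne_zero (hA k) fun h0 => hk ?_
      simp [hu, h0])
  have huA : ∑ k, u k • A k = ∑ k, A k := Finset.sum_congr rfl fun k _ => by
    by_cases h : A k = 0 <;> simp [hu, h]
  set Φ := (weigh fun k => outEntropy w₁ (A k)).prod (weigh fun k => outEntropy w₂ (A k)) with hΦ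
  have hΦu : Φ u = (∑ k, outEntropy w₁ (A k), ∑ k, outEntropy w₂ (A k)) := by
    simp only [hΦ, LinearMap.prod_apply, Function.prod_apply, weigh_apply]
    refine Prod.ext (Finset.sum_congr rfl fun k _ => ?_) (Finset.sum_congr rfl fun k _ => ?_) <;>
    · by_cases h : A k = 0 <;> simp [hu, h]
  rw [← hΦu]
  have himg := Set.mem_image_of_mem Φ hmem
  rw [LinearMap.image_convexHull] at himg
  refine convexHull_mono ?_ himg
  rintro _ ⟨w', ⟨hw0, -, hsum, hcard⟩, rfl⟩
  rw [Module.finrank_fintype_fun_eq_card] at hcard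
  obtain ⟨G, hG, hGsum⟩ := exists_fin_enumeration _ hcard fun k => w' k • A k
  have hsupp : ∀ f : K → ℝ, ∑ k ∈ Finset.univ.filter (fun k => w' k ≠ 0), w' k * f k =
      ∑ k, w' k * f k := fun f => Finset.sum_filter_of_ne fun k _ h => left_ne_zero_of_mul h
  -- The rescaled parts `w' k • A k` decompose the same `q`, and by homogeneity their entropies are
  -- the original ones weighted by `w'`. The entropies themselves change and are recovered only on
  -- average.
  refine ⟨G, fun i x => ?_, ?_, ?_⟩
  · rcases hG i with h | ⟨k, -, h⟩
    · simp [h]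
    · rw [h]
      exact mul_nonneg (hw0 k) (hA k x)
  · rw [← huA, ← hsum]
    ext x
    have := hGsum (fun q : X → ℝ => q x) rfl
    simp only [Finset.sum_apply, Pi.smul_apply, smul_eq_mul] at this ⊢
    rw [this, hsupp fun k => A k x]
  · simp only [hΦ, LinearMap.prod_apply, Function.prod_apply, weigh_apply]
    rw [hGsum (outEntropy w₁) (outEntropy_zero _), hGsum (outEntropy w₂) (outEntropy_zero _)]
    simp only [outEntropy_smul h₁, outEntropy_smul h₂]
    rw [hsupp, hsupp]

/-- An input measure together with the entropies of the two outputs, of the two outputs given a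
first refinement, and of the two outputs given a second refinement. -/
abbrev EntropyPoint (X : Type*) : Type _ := (X → ℝ) × (ℝ × ℝ) × (ℝ × ℝ) × (ℝ × ℝ)

/-- The entropy points of a constant `V₀`, with refinements `V₁` and `V₂` on `|X|` letters. -/
def atoms (w₁ : X → Y₁ → ℝ) (w₂ : X → Y₂ → ℝ) : Set (EntropyPoint X) :=
  {p | (∀ x, 0 ≤ p.1 x) ∧ p.2.1 = (outEntropy w₁ p.1, outEntropy w₂ p.1) ∧
    p.2.2.1 ∈ splitEntropies w₁ w₂ p.1 ∧ p.2.2.2 ∈ splitEntropies w₁ w₂ p.1}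

lemma splitEntropies_smul {w₁ : X → Y₁ → ℝ} {w₂ : X → Y₂ → ℝ} (h₁ : IsChannel w₁)
    (h₂ : IsChannel w₂) {q : X → ℝ} {b : ℝ × ℝ} (hb : b ∈ splitEntropies w₁ w₂ q) {c : ℝ}
    (hc : 0 ≤ c) : c • b ∈ splitEntropies w₁ w₂ (c • q) := by
  obtain ⟨A, hA, hs, rfl⟩ := hb
  refine ⟨fun k => c • A k, fun k x => mul_nonneg hc (hA k x), ?_, ?_⟩
  · rw [← Finset.smul_sum, hs]
  · simp [outEntropy_smul h₁, outEntropy_smul h₂, Finset.mul_sum]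

/-- All entries are homogeneous of degree one in the input measure, so the probability of a letter
of `V₀` can be absorbed into its atom. -/
lemma atoms_smul {w₁ : X → Y₁ → ℝ} {w₂ : X → Y₂ → ℝ} (h₁ : IsChannel w₁) (h₂ : IsChannel w₂)
    {p : EntropyPoint X} (hp : p ∈ atoms w₁ w₂) {c : ℝ} (hc : 0 ≤ c) : c • p ∈ atoms w₁ w₂ := by
  obtain ⟨h0, ha, hb, hb'⟩ := hp
  refine ⟨fun x => mul_nonneg hc (h0 x), ?_, splitEntropies_smul h₁ h₂ hb hc,
    splitEntropies_smul h₁ h₂ hb' hc⟩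
  simp [ha, outEntropy_smul h₁, outEntropy_smul h₂]

lemma zero_mem_splitEntropies (w₁ : X → Y₁ → ℝ) (w₂ : X → Y₂ → ℝ) :
    (0 : ℝ × ℝ) ∈ splitEntropies w₁ w₂ 0 :=
  ⟨0, by simp, by simp, by ext <;> simp⟩

lemma zero_mem_atoms (w₁ : X → Y₁ → ℝ) (w₂ : X → Y₂ → ℝ) : (0 : EntropyPoint X) ∈ atoms w₁ w₂ :=
  ⟨by simp, by ext <;> simp, zero_mem_splitEntropies _ _, zero_mem_splitEntropies _ _⟩

lemma eq_zero_of_mem_splitEntropies {w₁ : X → Y₁ → ℝ} {w₂ : X → Y₂ → ℝ} {b : ℝ × ℝ}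
    (hb : b ∈ splitEntropies w₁ w₂ 0) : b = 0 := by
  obtain ⟨A, hA, hs, rfl⟩ := hb
  have h : ∀ k, A k = 0 := fun k => by
    ext x
    have h1 := congrFun hs x
    rw [Finset.sum_apply] at h1
    exact (Finset.sum_eq_zero_iff_of_nonneg fun k _ => hA k x).1 h1 k (Finset.mem_univ k)
  ext <;> simp [h]

/-- Without input mass there is no entropy; atoms with zero input measure can therefore be dropped
from a sum. -/
lemma eq_zero_of_mem_atoms {w₁ : X → Y₁ → ℝ} {w₂ : X → Y₂ → ℝ} {p : EntropyPoint X}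
    (hp : p ∈ atoms w₁ w₂) (h0 : p.1 = 0) : p = 0 := by
  obtain ⟨-, ha, hb, hb'⟩ := hp
  rw [h0] at ha hb hb'
  refine Prod.ext h0 (Prod.ext ?_ (Prod.ext (eq_zero_of_mem_splitEntropies hb)
    (eq_zero_of_mem_splitEntropies hb')))
  rw [ha]
  ext <;> simp

lemma smul_mem_convexHull_atoms {w₁ : X → Y₁ → ℝ} {w₂ : X → Y₂ → ℝ} (h₁ : IsChannel w₁)
    (h₂ : IsChannel w₂) {p : EntropyPoint X} (hp : p ∈ convexHull ℝ (atoms w₁ w₂)) {c : ℝ}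
    (hc : 0 ≤ c) : c • p ∈ convexHull ℝ (atoms w₁ w₂) := by
  have h : c • p ∈ c • convexHull ℝ (atoms w₁ w₂) := Set.smul_mem_smul_set hp
  rw [← convexHull_smul] at h
  refine convexHull_mono ?_ h
  rintro _ ⟨a, ha, rfl⟩
  exact atoms_smul h₁ h₂ ha hc

lemma sum_mem_convexHull_atoms {w₁ : X → Y₁ → ℝ} {w₂ : X → Y₂ → ℝ} (h₁ : IsChannel w₁)
    (h₂ : IsChannel w₂) {ι : Type*} (s : Finset ι) (p : ι → EntropyPoint X)
    (hp : ∀ i ∈ s, p i ∈ convexHull ℝ (atoms w₁ w₂)) :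
    ∑ i ∈ s, p i ∈ convexHull ℝ (atoms w₁ w₂) := by
  refine Finset.sum_induction _ (· ∈ convexHull ℝ (atoms w₁ w₂)) (fun a b ha hb => ?_)
    (subset_convexHull ℝ _ (zero_mem_atoms w₁ w₂)) hp
  -- A sum is twice a midpoint, so a convex set stable under scaling is closed under addition.
  have h := smul_mem_convexHull_atoms h₁ h₂ ((convex_convexHull ℝ (atoms w₁ w₂)) ha hb
    (by norm_num : (0 : ℝ) ≤ 1 / 2) (by norm_num : (0 : ℝ) ≤ 1 / 2) (by norm_num))
    (by norm_num : (0 : ℝ) ≤ 2)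
  rwa [smul_add, smul_smul, smul_smul, show (2 : ℝ) * (1 / 2) = 1 by norm_num, one_smul,
    one_smul] at h

/-- The entropy point of a constant `V₀` with arbitrary refinements. -/
lemma refined_mem_convexHull_atoms {w₁ : X → Y₁ → ℝ} {w₂ : X → Y₂ → ℝ} (h₁ : IsChannel w₁)
    (h₂ : IsChannel w₂) {K L : Type*} [Fintype K] [Fintype L] (q : X → ℝ) (A : K → X → ℝ)
    (B : L → X → ℝ) (hA : ∀ k x, 0 ≤ A k x) (hB : ∀ l x, 0 ≤ B l x) (hAq : ∑ k, A k = q)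
    (hBq : ∑ l, B l = q) :
    (q, (outEntropy w₁ q, outEntropy w₂ q),
      (∑ k, outEntropy w₁ (A k), ∑ k, outEntropy w₂ (A k)),
      (∑ l, outEntropy w₁ (B l), ∑ l, outEntropy w₂ (B l))) ∈ convexHull ℝ (atoms w₁ w₂) := by
  have hmA := sum_outEntropy_mem_convexHull h₁ h₂ A hA
  have hmB := sum_outEntropy_mem_convexHull h₁ h₂ B hB
  rw [hAq] at hmA
  rw [hBq] at hmB
  -- The refinements `V₁` and `V₂` are chosen separately, so their mixtures combine through the hull
  -- of a product.
  have hm := mk_mem_convexHull_prod hmA hmB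
  -- With `q` and its output entropies fixed, inserting the refinement entropies is an affine map,
  -- so the preimage of the hull is convex.
  refine convexHull_min (t := {bc : (ℝ × ℝ) × (ℝ × ℝ) |
    ((q, (outEntropy w₁ q, outEntropy w₂ q), bc) : EntropyPoint X) ∈
      convexHull ℝ (atoms w₁ w₂)}) ?_ ?_ hm
  · rintro ⟨b, c⟩ ⟨hb, hc⟩
    refine subset_convexHull ℝ _ ⟨fun x => ?_, rfl, hb, hc⟩
    simp only [← hAq, Finset.sum_apply]
    exact Finset.sum_nonneg fun k _ => hA k x
  · intro b hb c hc s t hs ht hst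
    have := (convex_convexHull ℝ (atoms w₁ w₂)) hb hc hs ht hst
    have e : ((q, (outEntropy w₁ q, outEntropy w₂ q), s • b + t • c) : EntropyPoint X) =
        s • (q, (outEntropy w₁ q, outEntropy w₂ q), b) +
          t • (q, (outEntropy w₁ q, outEntropy w₂ q), c) := by
      refine Prod.ext ?_ (Prod.ext ?_ rfl)
      · exact (Convex.combo_self hst q).symm
      · exact (Convex.combo_self hst _).symm
    rw [Set.mem_ofPred_eq, e]
    exact this

/-- A point of the convex hull is attained by a `V₀` on `|X| + 5` letters, except that
`H(Y₁ | V₀, V₁)` may decrease. -/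
lemma exists_atoms_of_mem_convexHull {w₁ : X → Y₁ → ℝ} {w₂ : X → Y₂ → ℝ} (h₁ : IsChannel w₁)
    (h₂ : IsChannel w₂) {q : X → ℝ} {a b c : ℝ × ℝ}
    (h : ((q, a, b, c) : EntropyPoint X) ∈ convexHull ℝ (atoms w₁ w₂)) :
    ∃ (p : Fin (Fintype.card X + 5) → EntropyPoint X) (b₁ : ℝ), (∀ i, p i ∈ atoms w₁ w₂) ∧
      b₁ ≤ b.1 ∧ ∑ i, p i = (q, a, (b₁, b.2), c) := by
  obtain ⟨ι, _, l, z, hl, -, hz, hsum⟩ := mem_convexHull_iff_exists_fintype.1 h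
  set P : ι → EntropyPoint X := fun i => l i • z i with hP
  have hPa : ∀ i, P i ∈ atoms w₁ w₂ := fun i => atoms_smul h₁ h₂ (hz i) (hl i)
  -- `T` forgets only `H(Y₁|V₀,V₁)`, which `B` records; its target has dimension `|X| + 5`.
  let T : EntropyPoint X →ₗ[ℝ] (X → ℝ) × (ℝ × ℝ) × ℝ × (ℝ × ℝ) :=
    { toFun := fun p => (p.1, p.2.1, p.2.2.1.2, p.2.2.2)
      map_add' := fun _ _ => rfl
      map_smul' := fun _ _ => rfl }
  let B : EntropyPoint X →ₗ[ℝ] ℝ :=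
    { toFun := fun p => p.2.2.1.1
      map_add' := fun _ _ => rfl
      map_smul' := fun _ _ => rfl }
  set u : ι → ℝ := fun i => if (P i).1 = 0 then 0 else 1 with hu
  have huP : ∑ i, u i • P i = (q, a, b, c) := by
    rw [← hsum]
    refine Finset.sum_congr rfl fun i _ => ?_
    by_cases h0 : (P i).1 = 0
    · have := eq_zero_of_mem_atoms (hPa i) h0
      simp only [hP] at this
      simp [this, hP]
    · have : u i = 1 := if_neg h0
      rw [this, one_smul]
  have hmem := mem_convexHull_smallSupport (fun i => T (P i))
    ((sumEntries X).comp (LinearMap.fst ℝ _ _)) u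
    (fun k => by simp only [hu]; split_ifs <;> norm_num) (fun i hi => by
      rw [LinearMap.comp_apply, LinearMap.fst_apply, sumEntries_apply]
      exact sum_pos_of_nonneg_of_ne_zero (hPa i).1 fun h0 => hi (if_pos h0))
  -- All small-support weights preserve `T`; since the given weights are a mixture of them, at least
  -- one does not increase `B`.
  obtain ⟨w', ⟨hw0, -, hs, hcard⟩, hle⟩ := exists_le_of_mem_convexHull hmem
    (weigh fun i => B (P i))
  have hfr : Module.finrank ℝ ((X → ℝ) × (ℝ × ℝ) × ℝ × (ℝ × ℝ)) = Fintype.card X + 5 := by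
    simp [Module.finrank_prod]
  rw [hfr] at hcard
  obtain ⟨G, hG, hGsum⟩ := exists_fin_enumeration _ hcard fun i => w' i • P i
  have hGs : ∑ i, G i = ∑ i, w' i • P i := by
    rw [hGsum (fun p => p) rfl]
    exact Finset.sum_filter_of_ne fun k _ h => left_ne_zero_of_smul h
  have hT : T (∑ i, G i) = T (q, a, b, c) := by
    rw [hGs, ← huP, map_sum, map_sum]
    simpa only [map_smul] using hs
  have hB : B (∑ i, G i) ≤ B (q, a, b, c) := by
    rw [hGs, ← huP, map_sum, map_sum]
    simpa only [map_smul, weigh_apply, smul_eq_mul] using hle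
  refine ⟨G, B (∑ i, G i), fun i => ?_, hB, ?_⟩
  · rcases hG i with h | ⟨k, -, h⟩
    · rw [h]; exact zero_mem_atoms _ _
    · rw [h]; exact atoms_smul h₁ h₂ (hPa k) (hw0 k)
  · exact Prod.ext (congrArg (fun t => t.1) hT) (Prod.ext (congrArg (fun t => t.2.1) hT)
      (Prod.ext (Prod.ext rfl (congrArg (fun t => t.2.2.1) hT)) (congrArg (fun t => t.2.2.2) hT)))

end Atoms

/-! ### Laws given by arrays of real numbers -/

section Laws

variable {Ω α β V X : Type*}

lemma exists_pmf_of_sum_eq_one [Fintype α] (q : α → ℝ) (h0 : ∀ a, 0 ≤ q a) (h1 : ∑ a, q a = 1) :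
    ∃ P : PMF α, ∀ a, (P a).toReal = q a := by
  refine ⟨PMF.ofFintype (fun a => ENNReal.ofReal (q a)) ?_, fun a => ?_⟩
  · rw [← ENNReal.ofReal_sum_of_nonneg fun a _ => h0 a, h1, ENNReal.ofReal_one]
  · simp [h0 a]

/-- A joint law with first marginal `P` has a conditional law. -/
lemma exists_kernel [Fintype X] [Fintype V] (P : PMF X) (r : V → X → ℝ) (h0 : ∀ v x, 0 ≤ r v x)
    (h1 : ∀ x, ∑ v, r v x = (P x).toReal) :
    ∃ k : X → PMF V, ∀ x v, (P x).toReal * (k x v).toReal = r v x := by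
  have hex : ∀ x, (P x).toReal ≠ 0 → ∃ k : PMF V, ∀ v, (k v).toReal = r v x / (P x).toReal :=
    fun x hx => exists_pmf_of_sum_eq_one _
      (fun v => div_nonneg (h0 v x) ENNReal.toReal_nonneg)
      (by rw [← Finset.sum_div, h1, div_self hx])
  obtain ⟨x₀, hx₀⟩ : ∃ x, (P x).toReal ≠ 0 := by
    by_contra! h
    have := sum_toReal_pmf P
    simp [h] at this
  -- A default conditional law for the letters of probability zero, where any choice will do.
  obtain ⟨k₀, -⟩ := hex x₀ hx₀
  have hk : ∀ x, ∃ k : PMF V, ∀ v, (P x).toReal * (k v).toReal = r v x := by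
    intro x
    by_cases hx : (P x).toReal = 0
    · refine ⟨k₀, fun v => ?_⟩
      rw [hx, zero_mul]
      have := h1 x
      rw [hx] at this
      exact ((Finset.sum_eq_zero_iff_of_nonneg fun v _ => h0 v x).1 this v (Finset.mem_univ v)).symm
    · obtain ⟨k, hk⟩ := hex x hx
      exact ⟨k, fun v => by rw [hk, mul_div_cancel₀ _ hx]⟩
  choose k hk using hk
  exact ⟨k, hk⟩

lemma prob_bind [Fintype α] (p : PMF α) (F : α → PMF Ω) (A : Ω → β) (b : β) :
    prob (p.bind F) A b = ∑ a, (p a).toReal * prob (F a) A b := by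
  rw [prob, PMF.map_bind, PMF.bind_apply, tsum_fintype, ENNReal.toReal_sum]
  · simp [prob]
  · exact fun a _ => ENNReal.mul_ne_top (PMF.apply_ne_top _ _) (PMF.apply_ne_top _ _)

lemma prob_const (P : PMF Ω) (a b : α) : prob P (fun _ => a) b = if b = a then 1 else 0 := by
  have : P.map (fun _ => a) = PMF.pure a := PMF.map_const P a
  rw [prob, this, PMF.pure_apply]
  split_ifs <;> simp

lemma prob_const_pair [Fintype Ω] (P : PMF Ω) (a a' : α) (b : Ω) :
    prob P (fun ω => (a, ω)) (a', b) = if a' = a then (P b).toReal else 0 := by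
  have h := prob_comp P (fun ω => ω) (fun b => (a, b)) (a', b)
  rw [h]
  simp only [Prod.mk.injEq, prob_id]
  by_cases haa : a' = a
  · simp [haa]
  · simp [haa, Ne.symm haa]

end Laws

/-! ### Test distributions as arrays, and their entropy points -/

section Channel

variable {Ω V V₀ V₁ V₂ X Y Z Y₁ Y₂ : Type*}

/-- The transition probabilities from the input to a function of the output. -/
def outProb (W : X → PMF Y) (ψ : Y → Z) : X → Z → ℝ := fun x z => prob (W x) ψ z

lemma isChannel_outProb [Fintype Z] (W : X → PMF Y) (ψ : Y → Z) : IsChannel (outProb W ψ) :=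
  ⟨fun _ _ => prob_nonneg _ _ _, fun _ => sum_prob _ _⟩

variable [Fintype V] [Fintype V₀] [Fintype V₁] [Fintype V₂] [Fintype X]

lemma IsMarkov.comp_output [Fintype Y] {P : PMF Ω} {v : Ω → V} {x : Ω → X} {y : Ω → Y}
    {W : X → PMF Y} (h : IsMarkov P v x y fun a b => (W a b).toReal) (ψ : Y → Z) :
    IsMarkov P v x (fun ω => ψ (y ω)) (outProb W ψ) := by
  intro a b c
  have h1 := prob_comp P (pair (pair v x) y) (fun z => (z.1, ψ z.2)) ((a, b), c)
  have h2 := prob_comp (W b) (fun y => y) ψ c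
  change prob P (fun ω => ((v ω, x ω), ψ (y ω))) ((a, b), c) = _
  simp only [pair] at h1
  rw [h1, Fintype.sum_prod_type, outProb, h2, Finset.mul_sum, Finset.sum_comm]
  refine Finset.sum_congr rfl fun z _ => ?_
  simp only [Prod.mk.injEq, ite_and, Finset.sum_ite_eq', Finset.mem_univ, if_true, prob_id]
  by_cases hz : ψ z = c
  · simp only [hz, if_true]
    exact h a b z
  · simp [hz]

/-- The joint probabilities of the auxiliary variables and the input. -/
def inputArray (pX : PMF X) (pV : X → PMF V) : V × X → ℝ :=
  fun z => (pX z.2).toReal * (pV z.2 z.1).toReal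

lemma prob_channelJoint (pX : PMF X) (pV : X → PMF (V₀ × V₁ × V₂)) (W : X → PMF (Y₁ × Y₂))
    (v : V₀ × V₁ × V₂) (x : X) :
    prob (channelJoint pX pV W) (pair (fun ω => ω.1) fun ω => ω.2.1) (v, x) =
      inputArray pX pV (v, x) := by
  rw [channelJoint, prob_bind]
  simp_rw [prob_bind, prob_map, pair, prob_const, Prod.mk.injEq, Finset.mul_sum]
  rw [Finset.sum_eq_single x, Finset.sum_eq_single v]
  · simp [inputArray]
  · intro b _ hb
    simp [Ne.symm hb]
  · simp
  · intro b _ hb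
    simp [Ne.symm hb]
  · simp

lemma isMarkov_channelJoint [Fintype Y₁] [Fintype Y₂] (pX : PMF X) (pV : X → PMF (V₀ × V₁ × V₂))
    (W : X → PMF (Y₁ × Y₂)) :
    IsMarkov (channelJoint pX pV W) (fun ω => ω.1) (fun ω => ω.2.1) (fun ω => ω.2.2)
      fun a b => (W a b).toReal := by
  intro v x y
  rw [prob_channelJoint, channelJoint, prob_bind]
  simp_rw [prob_bind, prob_map, pair, prob_const_pair, Prod.mk.injEq, Finset.mul_sum]
  rw [Finset.sum_eq_single x, Finset.sum_eq_single v]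
  · simp [inputArray, mul_assoc]
  · intro b _ hb
    simp [Ne.symm hb]
  · simp
  · intro b _ hb
    simp [Ne.symm hb]
  · simp

/-- The measures of the input on the events `φ(V) = c`. -/
def inputPart {C : Type*} (r : V × X → ℝ) (φ : V → C) (c : C) : X → ℝ :=
  fun x => ∑ v, if φ v = c then r (v, x) else 0

lemma inputPart_nonneg {V X C : Type*} [Fintype V] {r : V × X → ℝ} (hr : ∀ z, 0 ≤ r z)
    (φ : V → C) (c : C) (x : X) : 0 ≤ inputPart r φ c x := by
  refine Finset.sum_nonneg fun v _ => ?_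
  split_ifs
  · exact hr _
  · exact le_rfl

lemma sum_inputPart_pair {V X C D : Type*} [Fintype D] [Fintype V] (r : V × X → ℝ) (φ : V → C)
    (ψ : V → D) (c : C) :
    ∑ d, inputPart r (fun v => (φ v, ψ v)) (c, d) = inputPart r φ c := by
  ext x
  simp only [Finset.sum_apply, inputPart]
  rw [Finset.sum_comm]
  refine Finset.sum_congr rfl fun v _ => ?_
  by_cases h : φ v = c <;> simp [h]

lemma sum_inputPart {V X C : Type*} [Fintype C] [Fintype V] (r : V × X → ℝ) (φ : V → C) :
    ∑ c, inputPart r φ c = fun x => ∑ v, r (v, x) := by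
  ext x
  simp only [Finset.sum_apply, inputPart]
  rw [Finset.sum_comm]
  simp

lemma prob_comp_input {C : Type*} {P : PMF Ω} {v : Ω → V} {x : Ω → X} {r : V × X → ℝ}
    (h : ∀ a b, prob P (pair v x) (a, b) = r (a, b)) (φ : V → C) (c : C) (b : X) :
    prob P (pair (fun ω => φ (v ω)) x) (c, b) = inputPart r φ c b := by
  have h1 := prob_comp P (pair v x) (fun z => (φ z.1, z.2)) (c, b)
  change prob P (fun ω => (φ (v ω), x ω)) (c, b) = _
  simp only [pair] at h1
  rw [h1, Fintype.sum_prod_type]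
  simp only [Prod.mk.injEq, ite_and, inputPart]
  refine Finset.sum_congr rfl fun a _ => ?_
  by_cases ha : φ a = c
  · simp only [ha, if_true, Finset.sum_ite_eq', Finset.mem_univ]
    exact h a b
  · simp [ha]

lemma IsMarkov.condEntropy_comp_eq {C : Type*} [Fintype C] [Fintype Y] {P : PMF Ω} {v : Ω → V}
    {x : Ω → X} {y : Ω → Y} {w : X → Y → ℝ} (h : IsMarkov P v x y w) (φ : V → C) :
    condEntropy P y (fun ω => φ (v ω)) =
      ∑ c, outEntropy w (inputPart (fun z => prob P (pair v x) z) φ c) := by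
  rw [(h.comp φ).condEntropy_eq]
  refine Finset.sum_congr rfl fun c _ => congrArg _ (funext fun b => ?_)
  exact prob_comp_input (fun _ _ => rfl) φ c b

lemma continuous_sum_outEntropy_inputPart {C : Type*} [Fintype C] [Fintype Y] (w : X → Y → ℝ)
    (φ : V → C) : Continuous fun r : V × X → ℝ => ∑ c, outEntropy w (inputPart r φ c) := by
  refine continuous_finsetSum _ fun c _ => (continuous_outEntropy w).comp ?_
  unfold inputPart
  refine continuous_pi fun x => continuous_finsetSum _ fun v _ => ?_
  split_ifs
  · exact continuous_apply _
  · exact continuous_const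

variable [Fintype Y₁] [Fintype Y₂]

/-- The entropy point of an array of joint probabilities of `(V₀, V₁, V₂)` and `X`. -/
def arrayPoint (w₁ : X → Y₁ → ℝ) (w₂ : X → Y₂ → ℝ) (r : (V₀ × V₁ × V₂) × X → ℝ) : EntropyPoint X :=
  (fun x => ∑ v, r (v, x),
    (∑ c, outEntropy w₁ (inputPart r (fun v => v.1) c),
      ∑ c, outEntropy w₂ (inputPart r (fun v => v.1) c)),
    (∑ c, outEntropy w₁ (inputPart r (fun v => (v.1, v.2.1)) c),
      ∑ c, outEntropy w₂ (inputPart r (fun v => (v.1, v.2.1)) c)),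
    (∑ c, outEntropy w₁ (inputPart r (fun v => (v.1, v.2.2)) c),
      ∑ c, outEntropy w₂ (inputPart r (fun v => (v.1, v.2.2)) c)))

/-- Continuity in the joint array is what carries the inequalities to limits of test distributions.
-/
lemma continuous_arrayPoint (w₁ : X → Y₁ → ℝ) (w₂ : X → Y₂ → ℝ) :
    Continuous (arrayPoint (V₀ := V₀) (V₁ := V₁) (V₂ := V₂) w₁ w₂) := by
  refine Continuous.prodMk (by fun_prop) (Continuous.prodMk (Continuous.prodMk ?_ ?_)
    (Continuous.prodMk (Continuous.prodMk ?_ ?_) (Continuous.prodMk ?_ ?_))) <;>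
  exact continuous_sum_outEntropy_inputPart _ _

/-- Each letter of `V₀` contributes the point of a constant `V₀` refined by `V₁` and by `V₂`, and
the hull of the cone is closed under sums. -/
lemma arrayPoint_mem_convexHull {w₁ : X → Y₁ → ℝ} {w₂ : X → Y₂ → ℝ} (h₁ : IsChannel w₁)
    (h₂ : IsChannel w₂) {r : (V₀ × V₁ × V₂) × X → ℝ} (hr : ∀ z, 0 ≤ r z) :
    arrayPoint w₁ w₂ r ∈ convexHull ℝ (atoms w₁ w₂) := by
  have h := sum_mem_convexHull_atoms h₁ h₂ Finset.univ _ fun c _ =>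
    refined_mem_convexHull_atoms h₁ h₂ (inputPart r (fun v => v.1) c)
      (fun k => inputPart r (fun v => (v.1, v.2.1)) (c, k))
      (fun l => inputPart r (fun v => (v.1, v.2.2)) (c, l))
      (fun k x => inputPart_nonneg hr _ _ x) (fun l x => inputPart_nonneg hr _ _ x)
      (sum_inputPart_pair r (fun v => v.1) (fun v => v.2.1) c)
      (sum_inputPart_pair r (fun v => v.1) (fun v => v.2.2) c)
  convert h using 1
  simp only [arrayPoint]
  refine Prod.ext ?_ (Prod.ext (Prod.ext ?_ ?_) (Prod.ext (Prod.ext ?_ ?_) (Prod.ext ?_ ?_)))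
  · simp only [Prod.fst_sum, sum_inputPart]
  all_goals simp only [Prod.fst_sum, Prod.snd_sum, Fintype.sum_prod_type]

/-- Every point of the convex hull is attained by an array with bounded alphabets, except that
`H(Y₁ | V₀, V₁)` may decrease. -/
lemma exists_array_of_mem_convexHull {w₁ : X → Y₁ → ℝ} {w₂ : X → Y₂ → ℝ} (h₁ : IsChannel w₁)
    (h₂ : IsChannel w₂) {q : X → ℝ} {a b c : ℝ × ℝ}
    (h : ((q, a, b, c) : EntropyPoint X) ∈ convexHull ℝ (atoms w₁ w₂)) :
    ∃ (r : (Fin (Fintype.card X + 5) × Fin (Fintype.card X) × Fin (Fintype.card X)) × X → ℝ)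
      (b₁ : ℝ), (∀ z, 0 ≤ r z) ∧ b₁ ≤ b.1 ∧ arrayPoint w₁ w₂ r = (q, a, (b₁, b.2), c) := by
  obtain ⟨p, b₁, hp, hb, hsum⟩ := exists_atoms_of_mem_convexHull h₁ h₂ h
  have hA := fun i => (hp i).2.2.1
  have hB := fun i => (hp i).2.2.2
  choose A hA0 hAs hAe using hA
  choose B hB0 hBs hBe using hB
  have hAx : ∀ i x, ∑ k, A i k x = (p i).1 x := fun i x => by
    rw [← hAs i, Finset.sum_apply]
  have hBx : ∀ i x, ∑ k, B i k x = (p i).1 x := fun i x => by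
    rw [← hBs i, Finset.sum_apply]
  -- `V₁` and `V₂` are made conditionally independent given `V₀` and `X`: only the laws of
  -- `(V₀,V₁,X)` and `(V₀,V₂,X)` enter the entropies. Where the denominator vanishes so do both
  -- factors, and division by zero gives the right value `0`.
  set r : (Fin (Fintype.card X + 5) × Fin (Fintype.card X) × Fin (Fintype.card X)) × X → ℝ :=
    fun z => A z.1.1 z.1.2.1 z.2 * B z.1.1 z.1.2.2 z.2 / (p z.1.1).1 z.2 with hr
  have hz : ∀ {C : Fin (Fintype.card X) → X → ℝ} {q : X → ℝ}, (∀ k x, 0 ≤ C k x) →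
      (∀ x, ∑ k, C k x = q x) → ∀ k x, q x = 0 → C k x = 0 := by
    intro C q hC0 hCs k x hx
    rw [← hCs x] at hx
    exact (Finset.sum_eq_zero_iff_of_nonneg fun k _ => hC0 k x).1 hx k (Finset.mem_univ k)
  have h01 : ∀ i k, inputPart r (fun v => (v.1, v.2.1)) (i, k) = A i k := by
    intro i k
    ext x
    simp only [inputPart, Fintype.sum_prod_type, Prod.mk.injEq, ite_and, hr]
    rw [Finset.sum_eq_single i (fun b _ hb => by simp [hb]) (by simp),
      Finset.sum_eq_single k (fun b _ hb => by simp [hb]) (by simp)]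
    simp only [if_true]
    rw [← Finset.sum_div, ← Finset.mul_sum, hBx]
    exact mul_div_cancel_of_imp (hz (hA0 i) (hAx i) k x)
  have h02 : ∀ i k, inputPart r (fun v => (v.1, v.2.2)) (i, k) = B i k := by
    intro i k
    ext x
    simp only [inputPart, Fintype.sum_prod_type, Prod.mk.injEq, ite_and, hr]
    rw [Finset.sum_eq_single i (fun b _ hb => by simp [hb]) (by simp)]
    simp only [if_true, Finset.sum_ite_eq', Finset.mem_univ]
    rw [← Finset.sum_div, ← Finset.sum_mul, hAx, mul_comm]
    exact mul_div_cancel_of_imp (hz (hB0 i) (hBx i) k x)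
  have h0 : ∀ i, inputPart r (fun v => v.1) i = (p i).1 := by
    intro i
    rw [← sum_inputPart_pair r (fun v => v.1) (fun v => v.2.1) i]
    simp_rw [h01]
    exact hAs i
  refine ⟨r, b₁, fun z => ?_, hb, ?_⟩
  · exact div_nonneg (mul_nonneg (hA0 _ _ _) (hB0 _ _ _)) ((hp _).1 _)
  · rw [← hsum]
    have he : ∀ i, (p i).2.1 = (outEntropy w₁ (p i).1, outEntropy w₂ (p i).1) :=
      fun i => (hp i).2.1
    simp only [arrayPoint]
    refine Prod.ext ?_ (Prod.ext (Prod.ext ?_ ?_) (Prod.ext (Prod.ext ?_ ?_) (Prod.ext ?_ ?_)))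
    · rw [Prod.fst_sum]
      exact (sum_inputPart r fun v => v.1).symm.trans (Finset.sum_congr rfl fun i _ => h0 i)
    all_goals simp only [Prod.fst_sum, Prod.snd_sum, Fintype.sum_prod_type, h0, h01, h02, he, hAe,
      hBe]

end Channel

/-! ### The ten inequalities in terms of conditional entropies -/

section TenInequalities

variable {Ω Ω' U S₁ S₂ V₀ V₁ V₂ X Y₁ Y₂ : Type*} [Fintype U] [Fintype S₁] [Fintype S₂]
  [Fintype V₀] [Fintype V₁] [Fintype V₂] [Fintype X] [Fintype Y₁] [Fintype Y₂]

/-- The left-hand sides, for `k = (H(S₁), H(S₂))` and `a = (H(S₁|U), H(S₂|U), H(S₁,S₂|U))`. -/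
def sourceSide (k : ℝ × ℝ) (a : ℝ × ℝ × ℝ) : Fin 10 → ℝ :=
  ![k.1 - a.1, k.2 - a.2.1, k.1, k.2, k.1 - a.1 + a.2.1, k.2 - a.2.1 + a.1,
    k.1 - a.1 + a.2.2, k.2 - a.2.1 + a.2.2, k.1 - a.1 + a.2.2, k.2 - a.2.1 + a.2.2]

/-- The right-hand sides, for `h = (H(Y₁), H(Y₂))`, `e = (H(Y₁|X), H(Y₂|X))` and the conditional
entropies `z` of `Y₁` and `Y₂` given `V₀`, given `V₀, V₁` and given `V₀, V₂`. -/
def channelSide (h e : ℝ × ℝ) (z : (ℝ × ℝ) × (ℝ × ℝ) × (ℝ × ℝ)) : Fin 10 → ℝ :=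
  ![h.1 - z.1.1, h.2 - z.1.2, h.1 - z.2.1.1, h.2 - z.2.2.2,
    h.1 - z.1.1 + z.1.2 - z.2.2.2, h.2 - z.1.2 + z.1.1 - z.2.1.1,
    h.1 - z.2.1.1 + z.2.1.2 - e.2, h.2 - z.2.2.2 + z.2.2.1 - e.1,
    h.1 - z.1.1 + z.1.2 - z.2.2.2 + z.2.2.1 - e.1,
    h.2 - z.1.2 + z.1.1 - z.2.1.1 + z.2.1.2 - e.2]

lemma forall_fin_ten {q : Fin 10 → Prop} : (∀ i, q i) ↔
    q 0 ∧ q 1 ∧ q 2 ∧ q 3 ∧ q 4 ∧ q 5 ∧ q 6 ∧ q 7 ∧ q 8 ∧ q 9 := by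
  constructor
  · intro h
    exact ⟨h _, h _, h _, h _, h _, h _, h _, h _, h _, h _⟩
  · rintro ⟨h0, h1, h2, h3, h4, h5, h6, h7, h8, h9⟩ i
    fin_cases i <;> assumption

/-- The entropies `(H(S₁|U), H(S₂|U), H(S₁,S₂|U))`. -/
def sourceEntropies (P : PMF Ω) (u : Ω → U) (s₁ : Ω → S₁) (s₂ : Ω → S₂) : ℝ × ℝ × ℝ :=
  (condEntropy P s₁ u, condEntropy P s₂ u, condEntropy P (pair s₁ s₂) u)

/-- The entropies of `Y₁` and `Y₂` given `V₀`, given `V₀, V₁` and given `V₀, V₂`. -/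
def channelEntropies (Q : PMF Ω') (v₀ : Ω' → V₀) (v₁ : Ω' → V₁) (v₂ : Ω' → V₂) (y₁ : Ω' → Y₁)
    (y₂ : Ω' → Y₂) : (ℝ × ℝ) × (ℝ × ℝ) × (ℝ × ℝ) :=
  ((condEntropy Q y₁ v₀, condEntropy Q y₂ v₀),
    (condEntropy Q y₁ (pair v₀ v₁), condEntropy Q y₂ (pair v₀ v₁)),
    (condEntropy Q y₁ (pair v₀ v₂), condEntropy Q y₂ (pair v₀ v₂)))

/-- Each entry is a sum of mutual informations. Nonnegativity is needed when the ratio `n / m` is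
replaced by its upper bound. -/
lemma channelSide_nonneg (Q : PMF Ω') (v₀ : Ω' → V₀) (v₁ : Ω' → V₁) (v₂ : Ω' → V₂) (x : Ω' → X)
    (y₁ : Ω' → Y₁) (y₂ : Ω' → Y₂) (i : Fin 10) :
    0 ≤ channelSide (entropy Q y₁, entropy Q y₂)
      (condEntropy Q y₁ (pair (pair v₀ v₂) x), condEntropy Q y₂ (pair (pair v₀ v₁) x))
      (channelEntropies Q v₀ v₁ v₂ y₁ y₂) i := by
  have a1 := mutualInfo_nonneg Q v₀ y₁
  have a2 := mutualInfo_nonneg Q v₀ y₂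
  have b1 := mutualInfo_nonneg Q (pair v₀ v₁) y₁
  have b2 := mutualInfo_nonneg Q (pair v₀ v₂) y₂
  have c1 := condMutualInfo_nonneg Q v₁ y₁ v₀
  have c2 := condMutualInfo_nonneg Q v₂ y₂ v₀
  have d1 := condMutualInfo_nonneg Q x y₂ (pair v₀ v₁)
  have d2 := condMutualInfo_nonneg Q x y₁ (pair v₀ v₂)
  simp only [mutualInfo_eq, condMutualInfo_eq] at a1 a2 b1 b2 c1 c2 d1 d2
  revert i
  rw [forall_fin_ten]
  simp only [channelSide, channelEntropies, Matrix.cons_val]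
  refine ⟨?_, ?_, ?_, ?_, ?_, ?_, ?_, ?_, ?_, ?_⟩ <;> linarith

/-- By symmetry every mutual information is a drop in the entropy of a source or of an output, which
makes the system affine in conditional entropies. -/
lemma dominated_iff (κ : ℝ) (P : PMF Ω) (u : Ω → U) (s₁ : Ω → S₁) (s₂ : Ω → S₂)
    (Q : PMF Ω') (v₀ : Ω' → V₀) (v₁ : Ω' → V₁) (v₂ : Ω' → V₂) (x : Ω' → X)
    (y₁ : Ω' → Y₁) (y₂ : Ω' → Y₂) :
    Dominated κ P u s₁ s₂ Q v₀ v₁ v₂ x y₁ y₂ ↔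
      ∀ i, sourceSide (entropy P s₁, entropy P s₂) (sourceEntropies P u s₁ s₂) i ≤
        κ * channelSide (entropy Q y₁, entropy Q y₂)
          (condEntropy Q y₁ (pair (pair v₀ v₂) x), condEntropy Q y₂ (pair (pair v₀ v₁) x))
          (channelEntropies Q v₀ v₁ v₂ y₁ y₂) i := by
  rw [forall_fin_ten]
  simp only [channelSide, channelEntropies, sourceSide, sourceEntropies, Matrix.cons_val]
  constructor
  · rintro ⟨h0, h1, h2, h3, h4, h5, h6, h7, h8, h9⟩
    simp only [mutualInfo_eq, condMutualInfo_eq] at h0 h1 h2 h3 h4 h5 h6 h7 h8 h9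
    refine ⟨?_, ?_, ?_, ?_, ?_, ?_, ?_, ?_, ?_, ?_⟩ <;> linarith
  · rintro ⟨h0, h1, h2, h3, h4, h5, h6, h7, h8, h9⟩
    constructor <;> simp only [mutualInfo_eq, condMutualInfo_eq] <;> linarith

/-- The right-hand sides at an entropy point whose first entry is the input law. -/
def pointSide (w₁ : X → Y₁ → ℝ) (w₂ : X → Y₂ → ℝ) (p : EntropyPoint X) : Fin 10 → ℝ :=
  channelSide (outEntropy w₁ p.1, outEntropy w₂ p.1)
    (∑ x, p.1 x * ∑ y, negMulLog (w₁ x y), ∑ x, p.1 x * ∑ y, negMulLog (w₂ x y)) p.2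

/-- The entropy point of the joint law of `(V₀, V₁, V₂)` and `X`. -/
lemma arrayPoint_eq {P : PMF Ω} {v₀ : Ω → V₀} {v₁ : Ω → V₁} {v₂ : Ω → V₂} {x : Ω → X}
    {y₁ : Ω → Y₁} {y₂ : Ω → Y₂} {w₁ : X → Y₁ → ℝ} {w₂ : X → Y₂ → ℝ}
    (h₁ : IsMarkov P (pair v₀ (pair v₁ v₂)) x y₁ w₁)
    (h₂ : IsMarkov P (pair v₀ (pair v₁ v₂)) x y₂ w₂) :
    arrayPoint w₁ w₂ (fun z => prob P (pair (pair v₀ (pair v₁ v₂)) x) z) =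
      (fun a => prob P x a, channelEntropies P v₀ v₁ v₂ y₁ y₂) := by
  refine Prod.ext ?_ (Prod.ext (Prod.ext ?_ ?_) (Prod.ext (Prod.ext ?_ ?_) (Prod.ext ?_ ?_)))
  · funext a
    exact (prob_snd_eq_sum P _ x a).symm
  · exact (h₁.condEntropy_comp_eq fun v => v.1).symm
  · exact (h₂.condEntropy_comp_eq fun v => v.1).symm
  · exact (h₁.condEntropy_comp_eq fun v => (v.1, v.2.1)).symm
  · exact (h₂.condEntropy_comp_eq fun v => (v.1, v.2.1)).symm
  · exact (h₁.condEntropy_comp_eq fun v => (v.1, v.2.2)).symm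
  · exact (h₂.condEntropy_comp_eq fun v => (v.1, v.2.2)).symm

/-- Given `X`, an output depends on no auxiliary variable, so the entropies conditioned on `X` are
linear in the input law alone; this is why an entropy point determines the right-hand sides. -/
lemma pointSide_eq {P : PMF Ω} {v₀ : Ω → V₀} {v₁ : Ω → V₁} {v₂ : Ω → V₂} {x : Ω → X}
    {y₁ : Ω → Y₁} {y₂ : Ω → Y₂} {w₁ : X → Y₁ → ℝ} {w₂ : X → Y₂ → ℝ} (hw₁ : IsChannel w₁)
    (hw₂ : IsChannel w₂) (h₁ : IsMarkov P (pair v₀ (pair v₁ v₂)) x y₁ w₁)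
    (h₂ : IsMarkov P (pair v₀ (pair v₁ v₂)) x y₂ w₂) :
    pointSide w₁ w₂ (fun a => prob P x a, channelEntropies P v₀ v₁ v₂ y₁ y₂) =
      channelSide (entropy P y₁, entropy P y₂)
        (condEntropy P y₁ (pair (pair v₀ v₂) x), condEntropy P y₂ (pair (pair v₀ v₁) x))
        (channelEntropies P v₀ v₁ v₂ y₁ y₂) := by
  have e₁ : condEntropy P y₁ (pair (pair v₀ v₂) x) = _ :=
    (h₁.comp fun v => (v.1, v.2.2)).pair_input.condEntropy_eq_of_functionOf hw₁
      fun ω ω' h => congrArg Prod.snd h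
  have e₂ : condEntropy P y₂ (pair (pair v₀ v₁) x) = _ :=
    (h₂.comp fun v => (v.1, v.2.1)).pair_input.condEntropy_eq_of_functionOf hw₂
      fun ω ω' h => congrArg Prod.snd h
  rw [pointSide, h₁.entropy_eq, h₂.entropy_eq, e₁, e₂]

variable (W : X → PMF (Y₁ × Y₂))

lemma pointSide_inputArray (pX : PMF X) (pV : X → PMF (V₀ × V₁ × V₂)) :
    pointSide (outProb W Prod.fst) (outProb W Prod.snd)
      (arrayPoint (outProb W Prod.fst) (outProb W Prod.snd) (inputArray pX pV)) =
    channelSide (entropy (channelJoint pX pV W) (fun ω => ω.2.2.1),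
        entropy (channelJoint pX pV W) (fun ω => ω.2.2.2))
      (condEntropy (channelJoint pX pV W) (fun ω => ω.2.2.1)
        (pair (pair (fun ω => ω.1.1) (fun ω => ω.1.2.2)) fun ω => ω.2.1),
        condEntropy (channelJoint pX pV W) (fun ω => ω.2.2.2)
        (pair (pair (fun ω => ω.1.1) (fun ω => ω.1.2.1)) fun ω => ω.2.1))
      (channelEntropies (channelJoint pX pV W) (fun ω => ω.1.1) (fun ω => ω.1.2.1)
        (fun ω => ω.1.2.2) (fun ω => ω.2.2.1) (fun ω => ω.2.2.2)) := by
  set Q := channelJoint pX pV W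
  have h₁ : IsMarkov Q (pair (fun ω => ω.1.1) (pair (fun ω => ω.1.2.1) fun ω => ω.1.2.2))
      (fun ω => ω.2.1) (fun ω => ω.2.2.1) (outProb W Prod.fst) :=
    (isMarkov_channelJoint pX pV W).comp_output Prod.fst
  have h₂ : IsMarkov Q (pair (fun ω => ω.1.1) (pair (fun ω => ω.1.2.1) fun ω => ω.1.2.2))
      (fun ω => ω.2.1) (fun ω => ω.2.2.2) (outProb W Prod.snd) :=
    (isMarkov_channelJoint pX pV W).comp_output Prod.snd
  have hr : inputArray pX pV = fun z => prob Q
      (pair (pair (fun ω => ω.1.1) (pair (fun ω => ω.1.2.1) fun ω => ω.1.2.2))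
        fun ω => ω.2.1) z :=
    funext fun z => (prob_channelJoint pX pV W z.1 z.2).symm
  rw [hr, arrayPoint_eq h₁ h₂,
    pointSide_eq (isChannel_outProb W Prod.fst) (isChannel_outProb W Prod.snd) h₁ h₂]

/-- The form in which convexity and limits can act: `pV` enters only through the entropy point of
its joint array. -/
lemma boundHolds_iff (κ : ℝ) (p : PMF (S₁ × S₂)) (pX : PMF X) (pU : S₁ × S₂ → PMF U)
    (pV : X → PMF (V₀ × V₁ × V₂)) :
    BoundHolds κ p W pX pU pV ↔ ∀ i,
      sourceSide (entropy (sourceJoint p pU) (fun ω => ω.2.1),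
          entropy (sourceJoint p pU) (fun ω => ω.2.2))
        (sourceEntropies (sourceJoint p pU) (fun ω => ω.1) (fun ω => ω.2.1) (fun ω => ω.2.2)) i ≤
      κ * pointSide (outProb W Prod.fst) (outProb W Prod.snd)
        (arrayPoint (outProb W Prod.fst) (outProb W Prod.snd) (inputArray pX pV)) i := by
  rw [pointSide_inputArray]
  exact dominated_iff κ _ _ _ _ _ _ _ _ _ _ _

lemma pointSide_inputArray_nonneg (pX : PMF X) (pV : X → PMF (V₀ × V₁ × V₂)) (i : Fin 10) :
    0 ≤ pointSide (outProb W Prod.fst) (outProb W Prod.snd)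
      (arrayPoint (outProb W Prod.fst) (outProb W Prod.snd) (inputArray pX pV)) i := by
  rw [pointSide_inputArray]
  exact channelSide_nonneg _ _ _ _ _ _ _ i

end TenInequalities

/-! ### Bounds on the alphabets -/

section Alphabets

variable {Ω V U S₁ S₂ V₀ V₁ V₂ X Y₁ Y₂ : Type*}

lemma inputArray_nonneg (pX : PMF X) (pV : X → PMF V) (z : V × X) : 0 ≤ inputArray pX pV z :=
  mul_nonneg ENNReal.toReal_nonneg ENNReal.toReal_nonneg

lemma sum_inputArray [Fintype V] (pX : PMF X) (pV : X → PMF V) (x : X) :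
    ∑ v, inputArray pX pV (v, x) = (pX x).toReal := by
  simp [inputArray, ← Finset.mul_sum, sum_toReal_pmf]

lemma sourceJoint_map_snd (p : PMF (S₁ × S₂)) (pU : S₁ × S₂ → PMF U) :
    (sourceJoint p pU).map Prod.snd = p := by
  rw [sourceJoint, PMF.map_bind]
  simp_rw [PMF.map_comp]
  have : ∀ s : S₁ × S₂, (pU s).map (Prod.snd ∘ fun u => (u, s)) = PMF.pure s :=
    fun s => PMF.map_const _ _
  simp_rw [this]
  exact PMF.bind_pure p

lemma entropy_sourceJoint {T : Type*} [Fintype T] (p : PMF (S₁ × S₂)) (pU : S₁ × S₂ → PMF U)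
    (A : S₁ × S₂ → T) : entropy (sourceJoint p pU) (fun ω => A ω.2) = entropy p A := by
  rw [← entropy_map (sourceJoint p pU) Prod.snd A, sourceJoint_map_snd]

variable [Fintype V] [Fintype U] [Fintype S₁] [Fintype S₂]
  [Fintype V₀] [Fintype V₁] [Fintype V₂] [Fintype X] [Fintype Y₁] [Fintype Y₂]

lemma sourceSide_combo (k : ℝ × ℝ) (e e' : ℝ × ℝ × ℝ) {s t : ℝ} (h : s + t = 1) (i : Fin 10) :
    sourceSide k (s • e + t • e') i = s * sourceSide k e i + t * sourceSide k e' i := by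
  obtain rfl : t = 1 - s := by linarith
  fin_cases i <;> simp [sourceSide] <;> ring

lemma pointSide_combo (w₁ : X → Y₁ → ℝ) (w₂ : X → Y₂ → ℝ) (q : X → ℝ)
    (z z' : (ℝ × ℝ) × (ℝ × ℝ) × (ℝ × ℝ)) {s t : ℝ} (h : s + t = 1) (i : Fin 10) :
    pointSide w₁ w₂ (q, s • z + t • z') i =
      s * pointSide w₁ w₂ (q, z) i + t * pointSide w₁ w₂ (q, z') i := by
  obtain rfl : t = 1 - s := by linarith
  simp only [pointSide]
  generalize outEntropy w₁ q = h₁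
  generalize outEntropy w₂ q = h₂
  generalize ∑ x, q x * ∑ y, negMulLog (w₁ x y) = e₁
  generalize ∑ x, q x * ∑ y, negMulLog (w₂ x y) = e₂
  fin_cases i <;> simp [channelSide] <;> ring

/-- `H(Y₁|V₀,V₁)` occurs only with a minus sign; this saves one letter of `V₀`. -/
lemma pointSide_mono (w₁ : X → Y₁ → ℝ) (w₂ : X → Y₂ → ℝ) (q : X → ℝ) (a c : ℝ × ℝ)
    {b₁ b₁' : ℝ} (b₂ : ℝ) (h : b₁' ≤ b₁) (i : Fin 10) :
    pointSide w₁ w₂ (q, a, (b₁, b₂), c) i ≤ pointSide w₁ w₂ (q, a, (b₁', b₂), c) i := by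
  simp only [pointSide]
  fin_cases i <;> simp [channelSide] <;> linarith

/-- Any attainable entropies can be improved to those of auxiliary variables with bounded
alphabets. -/
lemma exists_test_of_mem_convexHull (W : X → PMF (Y₁ × Y₂)) (pX : PMF X)
    {z : (ℝ × ℝ) × (ℝ × ℝ) × (ℝ × ℝ)}
    (hz : ((fun x => (pX x).toReal, z) : EntropyPoint X) ∈
      convexHull ℝ (atoms (outProb W Prod.fst) (outProb W Prod.snd))) :
    ∃ pV : X → PMF (Fin (Fintype.card X + 5) × Fin (Fintype.card X) × Fin (Fintype.card X)),
      ∀ i, pointSide (outProb W Prod.fst) (outProb W Prod.snd) (fun x => (pX x).toReal, z) i ≤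
        pointSide (outProb W Prod.fst) (outProb W Prod.snd)
          (arrayPoint (outProb W Prod.fst) (outProb W Prod.snd) (inputArray pX pV)) i := by
  obtain ⟨a, b, c⟩ := z
  obtain ⟨r, b₁, hr, hb, he⟩ := exists_array_of_mem_convexHull (isChannel_outProb W Prod.fst)
    (isChannel_outProb W Prod.snd) hz
  obtain ⟨pV, hpV⟩ := exists_kernel pX (fun v x => r (v, x)) (fun v x => hr _)
    fun x => congrFun (congrArg Prod.fst he) x
  have hrV : inputArray pX pV = r := funext fun z => hpV z.2 z.1
  refine ⟨pV, fun i => ?_⟩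
  rw [hrV, he]
  exact pointSide_mono _ _ _ _ _ _ hb i

/-- A variable is its own output over a noiseless channel, so source entropies given `U` obey the
same formula as output entropies given `V`. -/
lemma isMarkov_self (P : PMF Ω) (v : Ω → V) (x : Ω → X) :
    IsMarkov P v x x fun a b => (PMF.pure a b).toReal := by
  intro a b c
  simp only [PMF.pure_apply]
  by_cases hb : c = b
  · subst hb
    rw [if_pos rfl, ENNReal.toReal_one, mul_one]
    exact prob_comp_of_injective P (pair v x) (φ := fun z => (z, z.2))
      (fun z z' hz => congrArg Prod.fst hz) (a, c)
  · rw [if_neg hb, ENNReal.toReal_zero, mul_zero]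
    refine prob_eq_zero P fun ω hω => ?_
    simp only [pair, Prod.mk.injEq] at hω
    exact hb (hω.2.symm.trans hω.1.2)

lemma prob_sourceJoint (p : PMF (S₁ × S₂)) (pU : S₁ × S₂ → PMF U) (u : U) (s : S₁ × S₂) :
    prob (sourceJoint p pU) (pair (fun ω => ω.1) fun ω => ω.2) (u, s) = inputArray p pU (u, s) := by
  rw [sourceJoint, prob_bind, Finset.sum_eq_single s]
  · rw [prob_map]
    have := prob_comp_of_injective (pU s) (fun u => u) (φ := fun u => (u, s))
      (fun u u' h => congrArg Prod.fst h) u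
    simp only [pair]
    rw [this, prob_id, inputArray]
  · intro s' _ hs
    rw [prob_map, prob_eq_zero, mul_zero]
    intro u' h
    exact hs (congrArg Prod.snd h)
  · simp

/-- The contributions to `H(S₁ | U)`, `H(S₂ | U)` and `H(S₁, S₂ | U)` of a letter `u` with
`q s = Pr(U = u, (S₁, S₂) = s)`. -/
def sourcePart (q : S₁ × S₂ → ℝ) : ℝ × ℝ × ℝ :=
  (outEntropy (outProb PMF.pure Prod.fst) q, outEntropy (outProb PMF.pure Prod.snd) q,
    outEntropy (outProb PMF.pure fun s => s) q)

lemma sourcePart_smul (c : ℝ) (q : S₁ × S₂ → ℝ) : sourcePart (c • q) = c • sourcePart q := by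
  simp [sourcePart, outEntropy_smul (isChannel_outProb _ _)]

@[simp] lemma sourcePart_zero : sourcePart (0 : S₁ × S₂ → ℝ) = 0 := by
  simp [sourcePart]

lemma sourceEntropies_eq_sum (p : PMF (S₁ × S₂)) (pU : S₁ × S₂ → PMF U) :
    sourceEntropies (sourceJoint p pU) (fun ω => ω.1) (fun ω => ω.2.1) (fun ω => ω.2.2) =
      ∑ u, sourcePart fun s => inputArray p pU (u, s) := by
  have hm := isMarkov_self (sourceJoint p pU) (fun ω => ω.1) (fun ω => ω.2)
  have h₁ := (hm.comp_output (W := PMF.pure) Prod.fst).condEntropy_eq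
  have h₂ := (hm.comp_output (W := PMF.pure) Prod.snd).condEntropy_eq
  have h₃ := (hm.comp_output (W := PMF.pure) fun s => s).condEntropy_eq
  simp only [prob_sourceJoint] at h₁ h₂ h₃
  refine Prod.ext ?_ (Prod.ext ?_ ?_)
  · simp only [Prod.fst_sum]
    exact h₁
  · simp only [Prod.fst_sum, Prod.snd_sum]
    exact h₂
  · simp only [Prod.snd_sum]
    exact h₃

/-- The source entropies of any `U` are a mixture of those of variables on `|S₁| |S₂|` letters. -/
lemma sourceEntropies_mem_convexHull {U : Type w} [Fintype U] (p : PMF (S₁ × S₂))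
    (pU : S₁ × S₂ → PMF U) :
    sourceEntropies (sourceJoint p pU) (fun ω => ω.1) (fun ω => ω.2.1) (fun ω => ω.2.2) ∈
      convexHull ℝ {e | ∃ (U' : Type w) (_ : Fintype U') (pU' : S₁ × S₂ → PMF U'),
        Fintype.card U' ≤ Fintype.card S₁ * Fintype.card S₂ ∧
        e = sourceEntropies (sourceJoint p pU') (fun ω => ω.1) (fun ω => ω.2.1)
          (fun ω => ω.2.2)} := by
  set A : U → S₁ × S₂ → ℝ := fun u s => inputArray p pU (u, s) with hA
  set v : U → ℝ := fun u => if A u = 0 then 0 else 1 with hv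
  have hA0 : ∀ u s, 0 ≤ A u s := fun u s => inputArray_nonneg _ _ _
  have hmem := mem_convexHull_smallSupport A (sumEntries _) v
    (fun k => by simp only [hv]; split_ifs <;> norm_num) (fun k hk => by
      rw [sumEntries_apply]
      exact sum_pos_of_nonneg_of_ne_zero (hA0 k) fun h0 => hk (if_pos h0))
  have hvA : ∑ u, v u • A u = fun s => (p s).toReal := by
    rw [show ∑ u, v u • A u = ∑ u, A u from Finset.sum_congr rfl fun k _ => by
      by_cases h : A k = 0 <;> simp [hv, h]]
    ext s
    rw [Finset.sum_apply]
    exact sum_inputArray p pU s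
  let Φ : (U → ℝ) →ₗ[ℝ] ℝ × ℝ × ℝ := ∑ u, (LinearMap.proj u : (U → ℝ) →ₗ[ℝ] ℝ).smulRight
    (sourcePart (A u))
  have hΦ : ∀ w, Φ w = ∑ u, w u • sourcePart (A u) := fun w => by simp [Φ]
  have hΦv : Φ v = sourceEntropies (sourceJoint p pU) (fun ω => ω.1) (fun ω => ω.2.1)
      (fun ω => ω.2.2) := by
    rw [hΦ, sourceEntropies_eq_sum]
    refine Finset.sum_congr rfl fun u _ => ?_
    change _ = sourcePart (A u)
    by_cases h : A u = 0 <;> simp [hv, h]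
  rw [← hΦv]
  have himg := Set.mem_image_of_mem Φ hmem
  rw [LinearMap.image_convexHull] at himg
  refine convexHull_mono ?_ himg
  rintro _ ⟨w', ⟨hw0, -, hsum, hcard⟩, rfl⟩
  -- The only quantity preserved is the source law `∑ u, Pr(U = u, ·)`, a vector with `|S₁||S₂|`
  -- entries; the entropies are merely averaged.
  rw [Module.finrank_fintype_fun_eq_card, Fintype.card_prod] at hcard
  have hsub : ∀ {M : Type} [AddCommMonoid M] (f : U → M), (∀ u, w' u = 0 → f u = 0) →
      ∑ u : {u // w' u ≠ 0}, f u = ∑ u, f u := by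
    intro M _ f hf
    rw [← Fintype.sum_subtype_add_sum_subtype (fun u => w' u ≠ 0) f,
      Finset.sum_eq_zero (s := Finset.univ) (f := fun u : {u // ¬ w' u ≠ 0} => f u)
        (fun u _ => hf _ (not_not.1 u.2)), add_zero]
  obtain ⟨pU', hpU'⟩ := exists_kernel p (fun (u : {u // w' u ≠ 0}) s => w' u * A u s)
    (fun u s => mul_nonneg (hw0 u) (hA0 u s)) (fun s => by
      rw [hsub (fun u => w' u * A u s) fun u hu => by rw [hu, zero_mul]]
      have h := congrFun (hsum.trans hvA) s
      simpa only [Finset.sum_apply, Pi.smul_apply, smul_eq_mul] using h)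
  -- A subtype of `U` keeps the new alphabet in the universe of `U`.
  refine ⟨{u // w' u ≠ 0}, inferInstance, pU', ?_, ?_⟩
  · rwa [Fintype.card_subtype]
  · rw [hΦ, sourceEntropies_eq_sum, ← hsub _ fun u hu => by rw [hu, zero_smul]]
    refine Finset.sum_congr rfl fun u _ => ?_
    rw [← sourcePart_smul]
    exact congrArg _ (funext fun s => (hpU' s u).symm)

/-- The source entropies compatible with some attainable output entropies form a convex set. -/
lemma convex_feasible (κ : ℝ) (k : ℝ × ℝ) (w₁ : X → Y₁ → ℝ) (w₂ : X → Y₂ → ℝ) (q : X → ℝ) :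
    Convex ℝ {e : ℝ × ℝ × ℝ | ∃ z, ((q, z) : EntropyPoint X) ∈ convexHull ℝ (atoms w₁ w₂) ∧
      ∀ i, sourceSide k e i ≤ κ * pointSide w₁ w₂ (q, z) i} := by
  rintro e ⟨z, hz, he⟩ e' ⟨z', hz', he'⟩ s t hs ht hst
  refine ⟨s • z + t • z', ?_, fun i => ?_⟩
  · have := (convex_convexHull ℝ (atoms w₁ w₂)) hz hz' hs ht hst
    convert this using 1
    exact Prod.ext (Convex.combo_self hst q).symm rfl
  · rw [sourceSide_combo k e e' hst, pointSide_combo w₁ w₂ q z z' hst]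
    have h1 := mul_le_mul_of_nonneg_left (he i) hs
    have h2 := mul_le_mul_of_nonneg_left (he' i) ht
    linarith

/-- The hypothesis puts the source entropies of all small `U` into a convex feasible set, so it
contains their mixtures, hence those of every `U`; the channel-side point so obtained is then
replaced by one with bounded alphabets. -/
theorem exists_bounded_test (p : PMF (S₁ × S₂)) (W : X → PMF (Y₁ × Y₂)) {κ : ℝ} (hκ : 0 ≤ κ)
    (pX : PMF X)
    (h : ∀ (U : Type w) [Fintype U], Fintype.card U ≤ Fintype.card S₁ * Fintype.card S₂ →
        ∀ pU : S₁ × S₂ → PMF U,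
          ∃ (V₀ V₁ V₂ : Type w) (_ : Fintype V₀) (_ : Fintype V₁) (_ : Fintype V₂)
            (pV : X → PMF (V₀ × V₁ × V₂)), BoundHolds κ p W pX pU pV)
    (U : Type w) [Fintype U] (pU : S₁ × S₂ → PMF U) :
    ∃ pV : X → PMF (Fin (Fintype.card X + 5) × Fin (Fintype.card X) × Fin (Fintype.card X)),
      BoundHolds κ p W pX pU pV := by
  have hfeas := convexHull_min ?_ (convex_feasible κ (entropy p Prod.fst, entropy p Prod.snd)
    (outProb W Prod.fst) (outProb W Prod.snd) fun x => (pX x).toReal)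
    (sourceEntropies_mem_convexHull p pU)
  · obtain ⟨z, hz, hle⟩ := hfeas
    obtain ⟨pV, hpV⟩ := exists_test_of_mem_convexHull W pX hz
    refine ⟨pV, (boundHolds_iff W κ p pX pU pV).2 fun i => ?_⟩
    rw [entropy_sourceJoint p pU fun s => s.1, entropy_sourceJoint p pU fun s => s.2]
    exact (hle i).trans (mul_le_mul_of_nonneg_left (hpV i) hκ)
  · rintro _ ⟨U', _, pU', hcard, rfl⟩
    obtain ⟨V₀, V₁, V₂, _, _, _, pV, hb⟩ := h U' hcard pU'
    rw [boundHolds_iff, entropy_sourceJoint p pU' fun s => s.1,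
      entropy_sourceJoint p pU' fun s => s.2] at hb
    have hmem := arrayPoint_mem_convexHull (isChannel_outProb W Prod.fst)
      (isChannel_outProb W Prod.snd) (inputArray_nonneg pX pV)
    -- The input marginal is `pX` whatever `pV` is, so all the points lie over one input law and may
    -- be mixed.
    have he : arrayPoint (outProb W Prod.fst) (outProb W Prod.snd) (inputArray pX pV) =
        (fun x => (pX x).toReal, (arrayPoint (outProb W Prod.fst) (outProb W Prod.snd)
          (inputArray pX pV)).2) :=
      Prod.ext (funext fun x => sum_inputArray pX pV x) rfl
    rw [he] at hmem hb
    exact ⟨_, hmem, hb⟩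

end Alphabets

/-! ### The common part -/

section CommonPart

variable {Ω α S₁ S₂ T V₀ V₁ V₂ X Y₁ Y₂ : Type*}

lemma entropy_congr_support [Fintype α] (P : PMF Ω) {A A' : Ω → α}
    (h : ∀ ω ∈ P.support, A ω = A' ω) : entropy P A = entropy P A' := by
  have hm : P.map A = P.map A' := by
    ext a
    rw [PMF.map_apply, PMF.map_apply]
    refine tsum_congr fun ω => ?_
    by_cases hω : ω ∈ P.support
    · rw [h ω hω]
    · rw [PMF.mem_support_iff, not_not] at hω
      simp [hω]
  simp [entropy, prob, hm]

lemma entropy_sourceJoint_pure [Fintype α] (p : PMF (S₁ × S₂)) (ψ : S₁ × S₂ → T)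
    (A : T × S₁ × S₂ → α) :
    entropy (sourceJoint p fun s => PMF.pure (ψ s)) A = entropy p fun s => A (ψ s, s) := by
  have h : sourceJoint p (fun s => PMF.pure (ψ s)) = p.map fun s => (ψ s, s) := by
    rw [sourceJoint]
    simp_rw [PMF.pure_map]
    rfl
  rw [h, entropy_map]

variable [Fintype S₁] [Fintype S₂] [Fintype T] [Fintype V₀] [Fintype V₁] [Fintype V₂] [Fintype X]
  [Fintype Y₁] [Fintype Y₂]

lemma mutualInfo_pair (P : PMF Ω) (v₀ : Ω → V₀) (v₁ : Ω → V₁) (y : Ω → Y₁) :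
    mutualInfo P (pair v₀ v₁) y = mutualInfo P v₀ y + condMutualInfo P v₁ y v₀ := by
  simp only [mutualInfo_eq, condMutualInfo_eq]
  ring

/-- `S₀` is almost surely a function of each source, so `I(U;S_i) = H(S₀)`, `H(S_i|U) = H(S_i) -
H(S₀)` and `H(S₁,S₂|U) = H(S₁,S₂) - H(S₀)`. The ten inequalities then come in five pairs that differ
only in `I(V₀;Y₁)` against `I(V₀;Y₂)`; as `κ ≥ 0`, a pair is one inequality with the minimum. -/
theorem boundHolds_commonPart_iff (p : PMF (S₁ × S₂)) (W : X → PMF (Y₁ × Y₂)) {κ : ℝ} (hκ : 0 ≤ κ)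
    (φ₁ : S₁ → T) (φ₂ : S₂ → T) (h : IsCommonPart p φ₁ φ₂) (pX : PMF X)
    (pV : X → PMF (V₀ × V₁ × V₂)) :
    BoundHolds κ p W pX (fun s => PMF.pure (φ₁ s.1)) pV ↔
      GohariAnantharamHolds κ p W pX φ₁ pV := by
  set P := sourceJoint p fun s => PMF.pure (φ₁ s.1) with hP
  have hs₁ : entropy P (fun ω => ω.2.1) = entropy p fun s => s.1 :=
    entropy_sourceJoint_pure p _ _
  have hs₂ : entropy P (fun ω => ω.2.2) = entropy p fun s => s.2 :=
    entropy_sourceJoint_pure p _ _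
  have hu : entropy P (fun ω => ω.1) = entropy p fun s => φ₁ s.1 :=
    entropy_sourceJoint_pure p _ _
  have hus₁ : entropy P (pair (fun ω => ω.2.1) fun ω => ω.1) = entropy p fun s => s.1 := by
    rw [hP, entropy_sourceJoint_pure]
    refine entropy_congr p fun s s' => ?_
    simp only [pair, Prod.mk.injEq, and_iff_left_iff_imp]
    exact fun hs => congrArg φ₁ hs
  -- Here `φ₁(S₁)` must first be exchanged for `φ₂(S₂)`, which agrees with it on the support only.
  have hus₂ : entropy P (pair (fun ω => ω.2.2) fun ω => ω.1) = entropy p fun s => s.2 := by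
    rw [hP, entropy_sourceJoint_pure,
      entropy_congr_support p (A' := fun s => (s.2, φ₂ s.2)) fun s hs => by
        simp only [pair, h.agree s hs]]
    refine entropy_congr p fun s s' => ?_
    simp only [Prod.mk.injEq, and_iff_left_iff_imp]
    exact fun hs => congrArg φ₂ hs
  have hus : entropy P (pair (pair (fun ω => ω.2.1) fun ω => ω.2.2) fun ω => ω.1) =
      entropy p (pair (fun s => s.1) fun s => s.2) := by
    rw [hP, entropy_sourceJoint_pure]
    refine entropy_congr p fun s s' => ?_
    simp only [pair, Prod.mk.injEq, and_iff_left_iff_imp]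
    exact fun hs => congrArg φ₁ hs.1
  have hmin : ∀ a b : ℝ, κ * min a b = κ * a ∨ κ * min a b = κ * b := fun a b => by
    rcases min_choice a b with h | h <;> simp [h]
  have hminl : ∀ a b : ℝ, κ * min a b ≤ κ * a := fun a b =>
    mul_le_mul_of_nonneg_left (min_le_left a b) hκ
  have hminr : ∀ a b : ℝ, κ * min a b ≤ κ * b := fun a b =>
    mul_le_mul_of_nonneg_left (min_le_right a b) hκ
  unfold BoundHolds GohariAnantharamHolds
  rw [← hP]
  generalize channelJoint pX pV W = Q
  have hm := hmin (mutualInfo Q (fun ω => ω.1.1) fun ω => ω.2.2.1)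
    (mutualInfo Q (fun ω => ω.1.1) fun ω => ω.2.2.2)
  have hml := hminl (mutualInfo Q (fun ω => ω.1.1) fun ω => ω.2.2.1)
    (mutualInfo Q (fun ω => ω.1.1) fun ω => ω.2.2.2)
  have hmr := hminr (mutualInfo Q (fun ω => ω.1.1) fun ω => ω.2.2.1)
    (mutualInfo Q (fun ω => ω.1.1) fun ω => ω.2.2.2)
  constructor
  · rintro ⟨h0, h1, h2, h3, h4, h5, h6, h7, h8, h9⟩
    simp only [mutualInfo_pair Q, mutualInfo_eq P, condEntropy_eq P, hs₁, hs₂, hu, hus₁, hus₂,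
      hus] at h0 h1 h2 h3 h4 h5 h6 h7 h8 h9
    constructor <;> rcases hm with hm | hm <;> linarith
  · rintro ⟨h0, h1, h2, h3, h4⟩
    constructor <;>
    · simp only [mutualInfo_pair Q, mutualInfo_eq P, condEntropy_eq P, hs₁, hs₂, hu, hus₁, hus₂,
        hus]
      linarith

end CommonPart

/-! ### Blocks of random variables -/

section Blocks

variable {Ω α β γ Y Y₁ Y₂ U₀ U₁ U₂ : Type*} {n : ℕ}

/-- The block formed by a sequence of random variables. -/
def block (y : Fin n → Ω → Y) : Ω → Fin n → Y := fun ω t => y t ω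

/-- The first `k` entries of a block. -/
def blockBefore (y : Fin n → Ω → Y) (k : ℕ) : Ω → Fin n → Option Y :=
  fun ω i => if (i : ℕ) < k then some (y i ω) else none

/-- The entries of `y₁` before time `k` and those of `y₂` from time `k` on. -/
def blockSplice (y₁ : Fin n → Ω → Y₁) (y₂ : Fin n → Ω → Y₂) (k : ℕ) : Ω → Fin n → Y₁ ⊕ Y₂ :=
  fun ω i => if (i : ℕ) < k then Sum.inl (y₁ i ω) else Sum.inr (y₂ i ω)

/-- The entries of `y₁` before time `t` and those of `y₂` after time `t`. -/
def blockGap (y₁ : Fin n → Ω → Y₁) (y₂ : Fin n → Ω → Y₂) (t : Fin n) :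
    Ω → Fin n → Option (Y₁ ⊕ Y₂) :=
  fun ω i => if i < t then some (Sum.inl (y₁ i ω)) else
    if t < i then some (Sum.inr (y₂ i ω)) else none

variable [Fintype α] [Fintype β] [Fintype γ] [Fintype Y] [Fintype Y₁] [Fintype Y₂]
  [Fintype U₀] [Fintype U₁] [Fintype U₂]

/-- The chain rule for a block. -/
lemma condEntropy_block (P : PMF Ω) (y : Fin n → Ω → Y) (A : Ω → α) :
    condEntropy P (block y) A = ∑ t, condEntropy P (y t) (pair A (blockBefore y t)) := by
  -- Each term is the growth of the joint entropy when the prefix is lengthened by one entry, so the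
  -- sum telescopes.
  have hstep : ∀ t : Fin n, condEntropy P (y t) (pair A (blockBefore y t)) =
      entropy P (pair A (blockBefore y (t + 1))) - entropy P (pair A (blockBefore y t)) := by
    intro t
    rw [condEntropy_eq]
    congr 1
    refine entropy_congr P fun ω ω' => ?_
    simp only [pair, Prod.mk.injEq, funext_iff, blockBefore]
    constructor
    · rintro ⟨h1, h2, h3⟩
      refine ⟨h2, fun i => ?_⟩
      rcases lt_trichotomy i t with h | h | h
      · have := h3 i
        rw [Fin.lt_def] at h
        simpa [h, h.trans (Nat.lt_succ_self _)] using this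
      · subst h; simp [h1]
      · rw [Fin.lt_def] at h
        simp [show ¬ ((i : ℕ) < t + 1) by omega]
    · rintro ⟨h2, h3⟩
      refine ⟨by simpa using h3 t, h2, fun i => ?_⟩
      by_cases h : (i : ℕ) < t
      · have := h3 i
        simpa [h, h.trans (Nat.lt_succ_self _)] using this
      · simp [h]
  simp_rw [hstep]
  rw [Fin.sum_univ_eq_sum_range (fun k => entropy P (pair A (blockBefore y (k + 1))) -
    entropy P (pair A (blockBefore y k))) n,
    Finset.sum_range_sub (fun k => entropy P (pair A (blockBefore y k))) n, condEntropy_eq]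
  congr 1
  · refine entropy_congr P fun ω ω' => ?_
    simp only [pair, Prod.mk.injEq, funext_iff, blockBefore, block, Fin.is_lt, if_true,
      Option.some.injEq]
    exact and_comm
  · refine entropy_congr P fun ω ω' => ?_
    simp [pair, funext_iff, blockBefore]

lemma entropy_block_le (P : PMF Ω) (y : Fin n → Ω → Y) :
    entropy P (block y) ≤ ∑ t, entropy P (y t) := by
  rw [← condEntropy_unit, condEntropy_block]
  exact Finset.sum_le_sum fun t _ => condEntropy_le_entropy _ _ _

/-- Csiszár's sum identity, in terms of conditional entropies. -/
lemma condEntropy_block_sub (P : PMF Ω) (y₁ : Fin n → Ω → Y₁) (y₂ : Fin n → Ω → Y₂) (A : Ω → α) :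
    condEntropy P (block y₁) A - condEntropy P (block y₂) A =
      ∑ t, (condEntropy P (y₁ t) (pair A (blockGap y₁ y₂ t)) -
        condEntropy P (y₂ t) (pair A (blockGap y₁ y₂ t))) := by
  -- The common term `H(A, gap)` cancels. Filling the gap with `y₁ t` gives the splice at `t + 1`,
  -- filling it with `y₂ t` the splice at `t`; the differences telescope.
  have hstep : ∀ t : Fin n, condEntropy P (y₁ t) (pair A (blockGap y₁ y₂ t)) -
      condEntropy P (y₂ t) (pair A (blockGap y₁ y₂ t)) =
      entropy P (pair A (blockSplice y₁ y₂ (t + 1))) -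
        entropy P (pair A (blockSplice y₁ y₂ t)) := by
    intro t
    have h1 : entropy P (pair (y₁ t) (pair A (blockGap y₁ y₂ t))) =
        entropy P (pair A (blockSplice y₁ y₂ (t + 1))) := by
      refine entropy_congr P fun ω ω' => ?_
      simp only [pair, Prod.mk.injEq, funext_iff, blockGap, blockSplice]
      constructor
      · rintro ⟨h1, h2, h3⟩
        refine ⟨h2, fun i => ?_⟩
        have := h3 i
        rcases lt_trichotomy i t with h | h | h
        · simpa [h, show (i : ℕ) < t + 1 from (Fin.lt_def.1 h).trans (Nat.lt_succ_self _)]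
            using this
        · subst h; simp [h1]
        · simpa [h, h.not_gt, show ¬ (i : ℕ) < t + 1 by rw [Fin.lt_def] at h; omega] using this
      · rintro ⟨h2, h3⟩
        refine ⟨by simpa using h3 t, h2, fun i => ?_⟩
        have := h3 i
        rcases lt_trichotomy i t with h | h | h
        · simpa [h, show (i : ℕ) < t + 1 from (Fin.lt_def.1 h).trans (Nat.lt_succ_self _)]
            using this
        · subst h; simp
        · simpa [h, h.not_gt, show ¬ (i : ℕ) < t + 1 by rw [Fin.lt_def] at h; omega] using this
    have h2 : entropy P (pair (y₂ t) (pair A (blockGap y₁ y₂ t))) =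
        entropy P (pair A (blockSplice y₁ y₂ t)) := by
      refine entropy_congr P fun ω ω' => ?_
      simp only [pair, Prod.mk.injEq, funext_iff, blockGap, blockSplice]
      constructor
      · rintro ⟨h1, h2, h3⟩
        refine ⟨h2, fun i => ?_⟩
        have := h3 i
        rcases lt_trichotomy i t with h | h | h
        · simpa [h, Fin.lt_def.1 h] using this
        · subst h; simp [h1]
        · simpa [h, h.not_gt, show ¬ (i : ℕ) < t by rw [Fin.lt_def] at h; omega] using this
      · rintro ⟨h2, h3⟩
        refine ⟨by simpa using h3 t, h2, fun i => ?_⟩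
        have := h3 i
        rcases lt_trichotomy i t with h | h | h
        · simpa [h, Fin.lt_def.1 h] using this
        · subst h; simp
        · simpa [h, h.not_gt, show ¬ (i : ℕ) < t by rw [Fin.lt_def] at h; omega] using this
    rw [condEntropy_eq, condEntropy_eq, h1, h2]
    ring
  simp_rw [hstep]
  rw [Fin.sum_univ_eq_sum_range (fun k => entropy P (pair A (blockSplice y₁ y₂ (k + 1))) -
    entropy P (pair A (blockSplice y₁ y₂ k))) n,
    Finset.sum_range_sub (fun k => entropy P (pair A (blockSplice y₁ y₂ k))) n, condEntropy_eq,
    condEntropy_eq]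
  have h1 : entropy P (pair (block y₁) A) = entropy P (pair A (blockSplice y₁ y₂ n)) := by
    refine entropy_congr P fun ω ω' => ?_
    simp only [pair, Prod.mk.injEq, funext_iff, blockSplice, block, Fin.is_lt, if_true,
      Sum.inl.injEq]
    exact and_comm
  have h2 : entropy P (pair (block y₂) A) = entropy P (pair A (blockSplice y₁ y₂ 0)) := by
    refine entropy_congr P fun ω ω' => ?_
    simp only [pair, Prod.mk.injEq, funext_iff, blockSplice, block, Nat.not_lt_zero, if_false,
      Sum.inr.injEq]
    exact and_comm
  rw [h1, h2]
  ring

/-- The gap variable contains the past of `y₁`, so each summand is at most the corresponding term of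
the chain rule. -/
lemma sum_condEntropy_gap_le (P : PMF Ω) (y₁ : Fin n → Ω → Y₁) (y₂ : Fin n → Ω → Y₂) (A : Ω → α) :
    ∑ t, condEntropy P (y₁ t) (pair A (blockGap y₁ y₂ t)) ≤ condEntropy P (block y₁) A := by
  rw [condEntropy_block]
  refine Finset.sum_le_sum fun t _ => condEntropy_mono P _ fun ω ω' h => ?_
  simp only [pair, Prod.mk.injEq, funext_iff, blockGap, blockBefore] at h ⊢
  refine ⟨h.1, fun i => ?_⟩
  have := h.2 i
  by_cases hi : i < t
  · simpa [hi, Fin.lt_def.1 hi] using this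
  · have : ¬ (i : ℕ) < t := hi
    simp [this]

/-- If `B` is nearly determined by `Z`, then `I(A; B)` is nearly bounded by `I(A; Z)`. -/
lemma mutualInfo_le_add (P : PMF Ω) (A : Ω → α) (B : Ω → β) (Z : Ω → γ) :
    mutualInfo P A B ≤ mutualInfo P A Z + condEntropy P B Z := by
  have h1 := condEntropy_pair_le P A Z B
  have h2 := condEntropy_nonneg P B (pair Z A)
  have h3 : entropy P (pair B (pair Z A)) = entropy P (pair A (pair Z B)) :=
    entropy_congr P fun ω ω' => by simp [pair]; tauto
  have h4 := entropy_pair_comm P Z A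
  have h5 := entropy_pair_comm P Z B
  simp only [mutualInfo, condEntropy_eq] at h1 h2 ⊢
  linarith

/-- If `B` is nearly determined by `Z`, then `H(B | C)` is nearly bounded by `I(B; Z | C)`. -/
lemma condEntropy_le_add {δ : Type*} [Fintype δ] (P : PMF Ω) (B : Ω → β) (C : Ω → δ) (Z : Ω → γ) :
    condEntropy P B C ≤ condEntropy P Z C - condEntropy P Z (pair C B) + condEntropy P B Z := by
  have h1 := condEntropy_pair_le P B C Z
  have h2 : entropy P (pair B (pair C Z)) = entropy P (pair Z (pair C B)) :=
    entropy_congr P fun ω ω' => by simp [pair]; tauto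
  have h3 := entropy_pair_comm P Z C
  have h4 := entropy_pair_comm P B C
  simp only [condEntropy_eq] at h1 ⊢
  linarith

/-- The inequalities for sources `w₁`, `w₂` that are nearly determined by `y₁` and `y₂`. -/
lemma sourceSide_le_channelSide (P : PMF Ω) (w₀ : Ω → U₀) (w₁ : Ω → U₁) (w₂ : Ω → U₂)
    (y₁ : Ω → Y₁) (y₂ : Ω → Y₂) {Δ : ℝ} (h₁ : condEntropy P w₁ y₁ ≤ Δ)
    (h₂ : condEntropy P w₂ y₂ ≤ Δ) (i : Fin 10) :
    sourceSide (entropy P w₁, entropy P w₂) (sourceEntropies P w₀ w₁ w₂) i - 3 * Δ ≤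
      channelSide (entropy P y₁, entropy P y₂)
        (condEntropy P y₁ (pair w₀ (pair w₁ w₂)), condEntropy P y₂ (pair w₀ (pair w₁ w₂)))
        (channelEntropies P w₀ w₁ w₂ y₁ y₂) i := by
  have hΔ : 0 ≤ Δ := (condEntropy_nonneg _ _ _).trans h₁
  have m₁ := mutualInfo_le_add P w₀ w₁ y₁
  have m₂ := mutualInfo_le_add P w₀ w₂ y₂
  rw [mutualInfo_eq, mutualInfo_eq] at m₁ m₂
  have s₁ : entropy P w₁ ≤ entropy P y₁ - condEntropy P y₁ (pair w₀ w₁) + condEntropy P w₁ y₁ := by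
    have e₁ := condEntropy_pair_le P y₁ w₀ w₁
    have e₂ := entropy_pair_comm P y₁ w₁
    simp only [condEntropy_eq] at e₁ ⊢
    linarith
  have s₂ : entropy P w₂ ≤ entropy P y₂ - condEntropy P y₂ (pair w₀ w₂) + condEntropy P w₂ y₂ := by
    have e₁ := condEntropy_pair_le P y₂ w₀ w₂
    have e₂ := entropy_pair_comm P y₂ w₂
    simp only [condEntropy_eq] at e₁ ⊢
    linarith
  have c₁ := condEntropy_le_add P w₁ w₀ y₁
  have c₂ := condEntropy_le_add P w₂ w₀ y₂
  have d₁ := condEntropy_le_add P w₂ (pair w₀ w₁) y₂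
  have d₂ := condEntropy_le_add P w₁ (pair w₀ w₂) y₁
  rw [condEntropy_congr P (A' := y₂) (B' := pair w₀ (pair w₁ w₂)) (B := pair (pair w₀ w₁) w₂)
    (fun _ _ => Iff.rfl) fun ω ω' => by simp [pair, and_assoc]] at d₁
  rw [condEntropy_congr P (A' := y₁) (B' := pair w₀ (pair w₁ w₂)) (B := pair (pair w₀ w₂) w₁)
    (fun _ _ => Iff.rfl) fun ω ω' => by simp [pair]; tauto] at d₂
  -- The two orders of the chain rule: this one serves `total₁` and `chain₂`, the next one `total₂`
  -- and `chain₁`.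
  have k₁ : condEntropy P (pair w₁ w₂) w₀ =
      condEntropy P w₁ w₀ + condEntropy P w₂ (pair w₀ w₁) := by
    have e₁ : entropy P (pair (pair w₁ w₂) w₀) = entropy P (pair w₂ (pair w₀ w₁)) :=
      entropy_congr P fun ω ω' => by simp [pair]; tauto
    have e₂ := entropy_pair_comm P w₀ w₁
    simp only [condEntropy_eq]
    linarith
  have k₂ : condEntropy P (pair w₁ w₂) w₀ =
      condEntropy P w₂ w₀ + condEntropy P w₁ (pair w₀ w₂) := by
    have e₁ : entropy P (pair (pair w₁ w₂) w₀) = entropy P (pair w₁ (pair w₀ w₂)) :=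
      entropy_congr P fun ω ω' => by simp [pair]; tauto
    have e₂ := entropy_pair_comm P w₀ w₂
    simp only [condEntropy_eq]
    linarith
  revert i
  rw [forall_fin_ten]
  simp only [channelSide, channelEntropies, sourceSide, sourceEntropies, Matrix.cons_val]
  -- Each inequality combines at most three of the bounds above, each with an error of at most `Δ`;
  -- hence `3 * Δ`.
  refine ⟨?_, ?_, ?_, ?_, ?_, ?_, ?_, ?_, ?_, ?_⟩ <;> linarith

lemma channelSide_sum {ι : Type*} [Fintype ι] (h e : ι → ℝ × ℝ)
    (z : ι → (ℝ × ℝ) × (ℝ × ℝ) × (ℝ × ℝ)) (i : Fin 10) :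
    ∑ t, channelSide (h t) (e t) (z t) i = channelSide (∑ t, h t) (∑ t, e t) (∑ t, z t) i := by
  revert i
  rw [forall_fin_ten]
  simp only [channelSide, Matrix.cons_val, Finset.sum_add_distrib, Finset.sum_sub_distrib,
    Prod.fst_sum, Prod.snd_sum, and_self]

/-- The single-letter form of the right-hand sides for blocks. -/
lemma channelSide_block_le (P : PMF Ω) (w₀ : Ω → U₀) (w₁ : Ω → U₁) (w₂ : Ω → U₂)
    (y₁ : Fin n → Ω → Y₁) (y₂ : Fin n → Ω → Y₂) (e : Fin n → ℝ × ℝ)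
    (he₁ : ∀ t, (e t).1 ≤
      condEntropy P (y₁ t) (pair (pair w₀ (pair w₁ w₂)) (blockGap y₁ y₂ t)))
    (he₂ : ∀ t, (e t).2 ≤
      condEntropy P (y₂ t) (pair (pair w₀ (pair w₁ w₂)) (blockGap y₁ y₂ t))) (i : Fin 10) :
    channelSide (entropy P (block y₁), entropy P (block y₂))
        (condEntropy P (block y₁) (pair w₀ (pair w₁ w₂)),
          condEntropy P (block y₂) (pair w₀ (pair w₁ w₂)))
        (channelEntropies P w₀ w₁ w₂ (block y₁) (block y₂)) i ≤
      ∑ t, channelSide (entropy P (y₁ t), entropy P (y₂ t)) (e t)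
        (channelEntropies P (pair w₀ (blockGap y₁ y₂ t)) w₁ w₂ (y₁ t) (y₂ t)) i := by
  rw [channelSide_sum]
  have a₁ := entropy_block_le P y₁
  have a₂ := entropy_block_le P y₂
  have b₀ := condEntropy_block_sub P y₁ y₂ w₀
  have b₁ := condEntropy_block_sub P y₁ y₂ (pair w₀ w₁)
  have b₂ := condEntropy_block_sub P y₁ y₂ (pair w₀ w₂)
  have b₃ := condEntropy_block_sub P y₁ y₂ (pair w₀ (pair w₁ w₂))
  -- The analogous bounds for `y₂` follow from these and the identities `b₀` to `b₃`, which also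
  -- handle exactly every difference of the two outputs under the same conditioning.
  have c₀ := sum_condEntropy_gap_le P y₁ y₂ w₀
  have c₁ := sum_condEntropy_gap_le P y₁ y₂ (pair w₀ w₁)
  have c₂ := sum_condEntropy_gap_le P y₁ y₂ (pair w₀ w₂)
  have c₃ := sum_condEntropy_gap_le P y₁ y₂ (pair w₀ (pair w₁ w₂))
  have d₁ := Finset.sum_le_sum fun t (_ : t ∈ Finset.univ) => he₁ t
  have d₂ := Finset.sum_le_sum fun t (_ : t ∈ Finset.univ) => he₂ t
  have p₁ : ∀ t, ∀ ω ω', pair (pair w₀ w₁) (blockGap y₁ y₂ t) ω =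
      pair (pair w₀ w₁) (blockGap y₁ y₂ t) ω' ↔ pair (pair w₀ (blockGap y₁ y₂ t)) w₁ ω =
        pair (pair w₀ (blockGap y₁ y₂ t)) w₁ ω' := fun t ω ω' => by
    simp only [pair, Prod.mk.injEq]; tauto
  have p₂ : ∀ t, ∀ ω ω', pair (pair w₀ w₂) (blockGap y₁ y₂ t) ω =
      pair (pair w₀ w₂) (blockGap y₁ y₂ t) ω' ↔ pair (pair w₀ (blockGap y₁ y₂ t)) w₂ ω =
        pair (pair w₀ (blockGap y₁ y₂ t)) w₂ ω' := fun t ω ω' => by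
    simp only [pair, Prod.mk.injEq]; tauto
  have q₁₁ := fun t => condEntropy_congr P (A := y₁ t) (fun _ _ => Iff.rfl) (p₁ t)
  have q₂₁ := fun t => condEntropy_congr P (A := y₂ t) (fun _ _ => Iff.rfl) (p₁ t)
  have q₁₂ := fun t => condEntropy_congr P (A := y₁ t) (fun _ _ => Iff.rfl) (p₂ t)
  have q₂₂ := fun t => condEntropy_congr P (A := y₂ t) (fun _ _ => Iff.rfl) (p₂ t)
  simp only [q₁₁, q₂₁, q₁₂, q₂₂, Finset.sum_sub_distrib] at b₀ b₁ b₂ b₃ c₁ c₂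
  revert i
  rw [forall_fin_ten]
  simp only [channelSide, channelEntropies, Matrix.cons_val, Prod.fst_sum, Prod.snd_sum]
  refine ⟨?_, ?_, ?_, ?_, ?_, ?_, ?_, ?_, ?_, ?_⟩ <;> linarith

end Blocks

/-! ### Product laws -/

section ProductLaws

variable {Ω α β : Type*} [Fintype α] [Fintype β] {n : ℕ}

lemma productPMF_apply (q : Fin n → PMF α) (a : Fin n → α) :
    productPMF q a = ∏ t, q t (a t) := by
  rw [productPMF, PMF.ofFintype_apply]

lemma productPMF_toReal (q : Fin n → PMF α) (a : Fin n → α) :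
    (productPMF q a).toReal = ∏ t, (q t (a t)).toReal := by
  rw [productPMF_apply, ENNReal.toReal_prod]

lemma productPMF_map (q : Fin n → PMF α) (A : α → β) :
    (productPMF q).map (fun a t => A (a t)) = productPMF fun t => (q t).map A := by
  ext b
  rw [PMF.map_apply, tsum_fintype, productPMF_apply]
  simp_rw [PMF.map_apply, tsum_fintype]
  rw [Fintype.prod_sum]
  refine Finset.sum_congr rfl fun a _ => ?_
  rw [Finset.prod_ite_zero]
  simp only [Finset.mem_univ, true_imp_iff, funext_iff, productPMF_apply]

/-- The entries of a sequence other than the one at `t`. -/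
def offEntry (t : Fin n) (a : Fin n → α) : {j // j ≠ t} → α := fun j => a j

lemma prob_offEntry_pair (q : Fin n → PMF α) (t : Fin n) (o : {j // j ≠ t} → α) (c : α) :
    prob (productPMF q) (fun a => (offEntry t a, a t)) (o, c) =
      (∏ j : {j // j ≠ t}, (q j (o j)).toReal) * (q t c).toReal := by
  set a : Fin n → α := fun j => if h : j = t then c else o ⟨j, h⟩ with ha
  have hat : a t = c := by simp [ha]
  have hao : ∀ j : {j // j ≠ t}, a j = o j := fun j => by simp [ha, j.2]
  have hφ : Function.Injective fun a : Fin n → α => (offEntry t a, a t) := by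
    intro a b hab
    simp only [Prod.mk.injEq, funext_iff, offEntry] at hab
    ext j
    by_cases hj : j = t
    · rw [hj, hab.2]
    · exact hab.1 ⟨j, hj⟩
  have h := prob_comp_of_injective (productPMF q) (fun a => a) hφ a
  have e : (offEntry t a, a t) = (o, c) := Prod.ext (funext hao) hat
  rw [e] at h
  rw [h, prob_id, productPMF_toReal, ← Fintype.prod_subtype_mul_prod_subtype (fun j => j ≠ t)]
  congr 1
  · exact Finset.prod_congr rfl fun j _ => by rw [hao]
  · have : Unique {j // ¬ j ≠ t} := ⟨⟨⟨t, by simp⟩⟩, fun j => Subtype.ext (not_not.1 j.2)⟩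
    rw [Fintype.prod_unique]
    have hd : ((default : {j // ¬ j ≠ t}) : Fin n) = t := not_not.1 (default : {j // ¬ j ≠ t}).2
    rw [hd, hat]

lemma prob_offEntry (q : Fin n → PMF α) (t : Fin n) (o : {j // j ≠ t} → α) :
    prob (productPMF q) (offEntry t) o = ∏ j : {j // j ≠ t}, (q j (o j)).toReal := by
  rw [prob_fst_eq_sum (productPMF q) (offEntry t) (fun a => a t)]
  change ∑ c, prob (productPMF q) (fun a => (offEntry t a, a t)) (o, c) = _
  simp_rw [prob_offEntry_pair]
  rw [← Finset.mul_sum, sum_toReal_pmf, mul_one]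

/-- Independence of an entry from the others. -/
lemma prob_offEntry_mul (q : Fin n → PMF α) (t : Fin n) (o : {j // j ≠ t} → α) (c : α) :
    prob (productPMF q) (fun a => (offEntry t a, a t)) (o, c) =
      prob (productPMF q) (offEntry t) o * (q t c).toReal := by
  rw [prob_offEntry_pair, prob_offEntry]

lemma prob_entry (q : Fin n → PMF α) (t : Fin n) (c : α) :
    prob (productPMF q) (fun a => a t) c = (q t c).toReal := by
  rw [prob_snd_eq_sum (productPMF q) (offEntry t) (fun a => a t)]
  change ∑ o, prob (productPMF q) (fun a => (offEntry t a, a t)) (o, c) = _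
  simp_rw [prob_offEntry_mul]
  rw [← Finset.sum_mul, sum_prob, one_mul]

/-- The entropy of a product law. -/
lemma entropy_productPMF (q : Fin n → PMF α) :
    entropy (productPMF q) (fun a => a) = ∑ t, entropy (q t) fun a => a := by
  have h : ∀ a : Fin n → α, prob (productPMF q) (fun a => a) a *
      (-log (prob (productPMF q) (fun a => a) a)) =
      ∑ t, prob (productPMF q) (fun a => a) a * (-log (q t (a t)).toReal) := by
    intro a
    rw [prob_id, productPMF_toReal]
    rcases eq_or_ne (∏ t, (q t (a t)).toReal) 0 with h0 | h0
    · simp [h0]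
    · rw [log_prod fun t _ => (Finset.prod_ne_zero_iff.1 h0) t (Finset.mem_univ t),
        ← Finset.sum_neg_distrib, Finset.mul_sum]
  rw [entropy_eq_sum]
  simp_rw [h]
  rw [Finset.sum_comm]
  refine Finset.sum_congr rfl fun t _ => ?_
  have h1 := sum_prob_comp (productPMF q) (fun a => a) (fun a => a t)
    fun c => -log (q t c).toReal
  rw [← h1, entropy_eq_sum]
  simp_rw [prob_entry, prob_id]

lemma entropy_iid (P : PMF α) (A : α → β) :
    entropy (productPMF fun _ : Fin n => P) (fun a t => A (a t)) = n * entropy P A := by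
  have h := entropy_map (productPMF fun _ : Fin n => P) (fun a t => A (a t)) (fun b => b)
  rw [← h, productPMF_map, entropy_productPMF]
  simp [entropy_map]

lemma toReal_toOuterMeasure [Fintype Ω] (P : PMF Ω) (s : Set Ω) :
    (P.toOuterMeasure s).toReal = ∑ ω, prob P (fun ω => ω) ω * if ω ∈ s then 1 else 0 := by
  rw [PMF.toOuterMeasure_apply_fintype, ENNReal.toReal_sum]
  · refine Finset.sum_congr rfl fun ω _ => ?_
    by_cases h : ω ∈ s <;> simp [h, prob_id]
  · intro ω _
    by_cases h : ω ∈ s <;> simp [h, PMF.apply_ne_top]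

end ProductLaws

/-! ### Fano's inequality for average symbol errors -/

section Fano

variable {Ω α β : Type*} [Fintype α] [Fintype β] {m : ℕ}

/-- The bound on the conditional entropy per symbol when the average symbol error probability is at
most `ε` and the alphabet has at most `N` letters. -/
def fanoBound (N ε : ℝ) : ℝ := -log (1 - ε) + ε * log (N / ε)

lemma condEntropy_le_fanoBound (P : PMF Ω) (a : Ω → Fin m → α) (b : Ω → β) (g : β → Fin m → α)
    {N ε : ℝ} (hN : (Fintype.card α : ℝ) ≤ N) (hN1 : 1 ≤ N) (h0 : 0 < ε) (h1 : ε < 1)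
    (herr : ∑ t, ∑ z, prob P (pair a b) z * (if z.1 t ≠ g z.2 t then 1 else 0) ≤ m * ε) :
    condEntropy P a b ≤ m * fanoBound N ε := by
  have hNpos : 0 < N := by linarith
  -- Comparison kernel for one symbol: mass `1 - ε` on the decoded letter `c` and `ε / N` on every
  -- letter. A correct symbol costs at most `-log (1 - ε)`, and a wrong one exceeds this by at most
  -- `log (N / ε)`, so the cross entropy of the product kernel is bounded linearly in the average
  -- error.
  set k : α → α → ℝ := fun c d => (if d = c then 1 - ε else 0) + ε / N with hk
  have hkpos : ∀ c d, 0 < k c d := fun c d => by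
    have := div_pos h0 hNpos
    simp only [hk]
    split_ifs <;> linarith
  have hksum : ∀ c, ∑ d, k c d ≤ 1 := fun c => by
    simp only [hk, Finset.sum_add_distrib, Finset.sum_ite_eq', Finset.mem_univ, if_true,
      Finset.sum_const, Finset.card_univ, nsmul_eq_mul]
    have : (Fintype.card α : ℝ) * (ε / N) ≤ N * (ε / N) :=
      mul_le_mul_of_nonneg_right hN (div_pos h0 hNpos).le
    rw [mul_div_cancel₀ _ hNpos.ne'] at this
    linarith
  have hlog1 : 0 ≤ -log (1 - ε) := by
    have := log_nonpos (by linarith : 0 ≤ 1 - ε) (by linarith)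
    linarith
  have hklog : ∀ c d, -log (k c d) ≤ -log (1 - ε) + (if d ≠ c then 1 else 0) * log (N / ε) := by
    intro c d
    by_cases hcd : d = c
    · simp only [hk, hcd, if_true, ne_eq, not_true_eq_false, if_false, zero_mul, add_zero]
      exact neg_le_neg (log_le_log (by linarith) (by linarith [div_pos h0 hNpos]))
    · simp only [hk, hcd, if_false, ne_eq, not_false_eq_true, if_true, one_mul, zero_add]
      rw [← log_inv, inv_div]
      linarith
  refine (condEntropy_le_crossEntropy P a b (fun b a => ∏ t, k (g b t) (a t))
    (fun b a => Finset.prod_nonneg fun t _ => (hkpos _ _).le) (fun b => ?_)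
    fun a b h => ?_).trans ?_
  · rw [← Fintype.prod_sum fun t d => k (g b t) d]
    exact Finset.prod_le_one (fun t _ => Finset.sum_nonneg fun d _ => (hkpos _ _).le)
      fun t _ => hksum _
  · exact absurd h (Finset.prod_pos fun t _ => hkpos _ _).ne'
  · have hz : ∑ a', ∑ b', prob P (pair a b) (a', b') * -log (∏ t, k (g b' t) (a' t)) =
        ∑ z, prob P (pair a b) z * -log (∏ t, k (g z.2 t) (z.1 t)) := by
      rw [Fintype.sum_prod_type]
    rw [hz]
    calc ∑ z, prob P (pair a b) z * -log (∏ t, k (g z.2 t) (z.1 t))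
        ≤ ∑ z, prob P (pair a b) z * ∑ t, (-log (1 - ε) +
            (if z.1 t ≠ g z.2 t then 1 else 0) * log (N / ε)) := by
          refine Finset.sum_le_sum fun z _ => mul_le_mul_of_nonneg_left ?_ (prob_nonneg _ _ _)
          rw [log_prod fun t _ => (hkpos _ _).ne', ← Finset.sum_neg_distrib]
          exact Finset.sum_le_sum fun t _ => hklog _ _
      _ = m * (-log (1 - ε)) + (∑ t, ∑ z, prob P (pair a b) z *
            (if z.1 t ≠ g z.2 t then 1 else 0)) * log (N / ε) := by
          simp only [Finset.sum_add_distrib, mul_add, Finset.sum_const, Finset.card_univ,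
            Fintype.card_fin, nsmul_eq_mul, ← Finset.sum_mul, sum_prob, one_mul]
          congr 1
          rw [Finset.sum_comm, Finset.sum_mul]
          refine Finset.sum_congr rfl fun z _ => ?_
          rw [← Finset.mul_sum, mul_assoc]
      _ ≤ m * (-log (1 - ε)) + m * ε * log (N / ε) := by
          have hl : 0 ≤ log (N / ε) := log_nonneg (by rw [le_div_iff₀ h0]; linarith)
          linarith [mul_le_mul_of_nonneg_right herr hl]
      _ = m * fanoBound N ε := by rw [fanoBound]; ring

end Fano

/-! ### The law of a code -/

section Code

variable {U S₁ S₂ X Y₁ Y₂ T T' : Type*} [Fintype U] [Fintype S₁] [Fintype S₂]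
  [Fintype Y₁] [Fintype Y₂] {m n : ℕ}

/-- The input block of the code `f` for the source block of `a`. -/
def codeInput (f : (Fin m → S₁) × (Fin m → S₂) → (Fin n → X)) (a : Fin m → U × S₁ × S₂) :
    Fin n → X :=
  f (fun t => (a t).2.1, fun t => (a t).2.2)

/-- The joint law of the block of `U`, the source blocks and the output blocks of the code `f`. -/
def codeLaw (p : PMF (S₁ × S₂)) (W : X → PMF (Y₁ × Y₂)) (pU : S₁ × S₂ → PMF U)
    (f : (Fin m → S₁) × (Fin m → S₂) → (Fin n → X)) :
    PMF ((Fin m → U × S₁ × S₂) × (Fin n → Y₁ × Y₂)) :=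
  (productPMF fun _ : Fin m => sourceJoint p pU).bind fun a =>
    (productPMF fun t : Fin n => W (codeInput f a t)).map fun y => (a, y)

variable (p : PMF (S₁ × S₂)) (W : X → PMF (Y₁ × Y₂)) (pU : S₁ × S₂ → PMF U)
  (f : (Fin m → S₁) × (Fin m → S₂) → (Fin n → X))

lemma codeLaw_map_fst :
    (codeLaw p W pU f).map Prod.fst = productPMF fun _ : Fin m => sourceJoint p pU := by
  rw [codeLaw, PMF.map_bind]
  simp_rw [PMF.map_comp]
  have : ∀ a : Fin m → U × S₁ × S₂, (productPMF fun t : Fin n => W (codeInput f a t)).map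
      (Prod.fst ∘ fun y => (a, y)) = PMF.pure a := fun a => PMF.map_const _ _
  simp_rw [this]
  exact PMF.bind_pure _

lemma productPMF_sourceJoint_map :
    (productPMF fun _ : Fin m => sourceJoint p pU).map (fun a t => (a t).2) =
      productPMF fun _ => p := by
  rw [productPMF_map]
  simp_rw [sourceJoint_map_snd]

/-- Attaching `U` does not disturb the code: forgetting it returns the law under which the decoding
errors are measured. -/
lemma codeLaw_map_eq_blockLaw :
    (codeLaw p W pU f).map (fun ω => (fun t => (ω.1 t).2, ω.2)) = blockLaw p W f := by
  rw [codeLaw, PMF.map_bind, blockLaw, ← productPMF_sourceJoint_map p pU, PMF.bind_map]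
  simp_rw [PMF.map_comp]
  rfl

lemma entropy_codeLaw [Fintype T] (A : U × S₁ × S₂ → T) :
    entropy (codeLaw p W pU f) (fun ω t => A (ω.1 t)) = m * entropy (sourceJoint p pU) A := by
  rw [← entropy_iid, ← codeLaw_map_fst p W pU f, entropy_map]

lemma condEntropy_codeLaw [Fintype T] [Fintype T'] (A : U × S₁ × S₂ → T) (B : U × S₁ × S₂ → T') :
    condEntropy (codeLaw p W pU f) (fun ω t => A (ω.1 t)) (fun ω t => B (ω.1 t)) =
      m * condEntropy (sourceJoint p pU) A B := by
  rw [condEntropy_eq, condEntropy_eq, entropy_codeLaw, mul_sub,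
    ← entropy_codeLaw p W pU f (pair A B)]
  congr 1
  exact entropy_congr _ fun ω ω' => by simp [pair, funext_iff, forall_and]

/-- The right-hand side is free of `pU`; for this reason a single input law serves every `U`. -/
lemma prob_codeInput (t : Fin n) (x : X) :
    prob (codeLaw p W pU f) (fun ω => codeInput f ω.1 t) x =
      prob (productPMF fun _ : Fin m => p)
        (fun s => f (fun t => (s t).1, fun t => (s t).2) t) x := by
  rw [← productPMF_sourceJoint_map p pU, prob_map, ← codeLaw_map_fst p W pU f, prob_map]
  rfl

/-- The channel is memoryless and the encoder sees only the source: given the source block, the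
outputs are independent, each governed by its own input letter. -/
lemma isMarkov_codeLaw [Fintype X] (t : Fin n) :
    IsMarkov (codeLaw p W pU f) (fun ω => (ω.1, offEntry t ω.2)) (fun ω => codeInput f ω.1 t)
      (fun ω => ω.2 t) fun a b => (W a b).toReal := by
  rintro ⟨a, o⟩ x y
  have h1 : ∀ a', prob ((productPMF fun t : Fin n => W (codeInput f a' t)).map fun y => (a', y))
      (pair (pair (fun ω => (ω.1, offEntry t ω.2)) fun ω => codeInput f ω.1 t) fun ω => ω.2 t)
        (((a, o), x), y) = if a' = a ∧ codeInput f a t = x then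
          prob (productPMF fun t : Fin n => W (codeInput f a t))
            (fun y => (offEntry t y, y t)) (o, y) else 0 := by
    intro a'
    rw [prob_map]
    split_ifs with h
    · obtain ⟨rfl, rfl⟩ := h
      exact prob_comp_of_injective _ (fun y : Fin n → Y₁ × Y₂ => (offEntry t y, y t))
        (φ := fun z => (((a', z.1), codeInput f a' t), z.2))
        (fun z z' hz => by
          simp only [Prod.mk.injEq, true_and, and_true] at hz
          exact Prod.ext hz.1 hz.2) (o, y)
    · refine prob_eq_zero _ fun y' hy' => h ?_
      simp only [pair, Prod.mk.injEq] at hy'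
      exact ⟨hy'.1.1.1, by rw [← hy'.1.1.1]; exact hy'.1.2⟩
  have h2 : ∀ a', prob ((productPMF fun t : Fin n => W (codeInput f a' t)).map fun y => (a', y))
      (pair (fun ω => (ω.1, offEntry t ω.2)) fun ω => codeInput f ω.1 t)
        ((a, o), x) = if a' = a ∧ codeInput f a t = x then
          prob (productPMF fun t : Fin n => W (codeInput f a t)) (offEntry t) o else 0 := by
    intro a'
    rw [prob_map]
    split_ifs with h
    · obtain ⟨rfl, rfl⟩ := h
      exact prob_comp_of_injective _ (offEntry t)
        (φ := fun z : {j // j ≠ t} → Y₁ × Y₂ => ((a', z), codeInput f a' t))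
        (fun z z' hz => by simpa using hz) o
    · refine prob_eq_zero _ fun y' hy' => h ?_
      simp only [pair, Prod.mk.injEq] at hy'
      exact ⟨hy'.1.1, by rw [← hy'.1.1]; exact hy'.2⟩
  rw [codeLaw, prob_bind, prob_bind]
  simp_rw [h1, h2, prob_offEntry_mul]
  rw [Finset.sum_mul]
  refine Finset.sum_congr rfl fun a' _ => ?_
  split_ifs with h
  · rw [← h.2]
    ring
  · simp

/-- The symbol error probability of a decoder, in terms of the law of the code. -/
lemma blockLaw_error [Fintype T] {β : Type*} [Fintype β] (A : S₁ × S₂ → T) (B : Y₁ × Y₂ → β)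
    (g : (Fin n → β) → Fin m → T) (t : Fin m) :
    ((blockLaw p W f).toOuterMeasure {ω | A (ω.1 t) ≠ g (fun q => B (ω.2 q)) t}).toReal =
      ∑ z, prob (codeLaw p W pU f) (pair (fun ω t => A (ω.1 t).2) fun ω q => B (ω.2 q)) z *
        if z.1 t ≠ g z.2 t then 1 else 0 := by
  rw [← codeLaw_map_eq_blockLaw p W pU f, PMF.toOuterMeasure_map_apply, toReal_toOuterMeasure]
  have h := sum_prob_comp (codeLaw p W pU f) (fun ω => ω)
    (pair (fun ω t => A (ω.1 t).2) fun ω q => B (ω.2 q))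
    fun z => if z.1 t ≠ g z.2 t then (1 : ℝ) else 0
  refine Eq.trans (Finset.sum_congr rfl fun ω _ => congrArg _ ?_) h.symm
  exact if_congr Iff.rfl rfl rfl

end Code

/-! ### The single-letter bound for one code -/

section CodeBound

variable {S₁ S₂ X Y₁ Y₂ : Type*} [Fintype S₁] [Fintype S₂] [Fintype X] [Fintype Y₁] [Fintype Y₂]
  {m n : ℕ}

lemma sourceSide_smul (c : ℝ) (k : ℝ × ℝ) (e : ℝ × ℝ × ℝ) (i : Fin 10) :
    sourceSide (c • k) (c • e) i = c * sourceSide k e i := by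
  revert i
  rw [forall_fin_ten]
  simp only [sourceSide, Matrix.cons_val, Prod.smul_fst, Prod.smul_snd, smul_eq_mul]
  refine ⟨?_, ?_, trivial, trivial, ?_, ?_, ?_, ?_, ?_, ?_⟩ <;> ring

/-- The unconditional output entropies occur only with a plus sign, so concavity in the input law
helps when times are averaged. -/
lemma channelSide_mono {h h' : ℝ × ℝ} (hh : h.1 ≤ h'.1) (hh' : h.2 ≤ h'.2) (e : ℝ × ℝ)
    (z : (ℝ × ℝ) × (ℝ × ℝ) × (ℝ × ℝ)) (i : Fin 10) :
    channelSide h e z i ≤ channelSide h' e z i := by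
  revert i
  rw [forall_fin_ten]
  simp only [channelSide, Matrix.cons_val]
  refine ⟨?_, ?_, ?_, ?_, ?_, ?_, ?_, ?_, ?_, ?_⟩ <;> linarith

lemma channelSide_smul (c : ℝ) (h e : ℝ × ℝ) (z : (ℝ × ℝ) × (ℝ × ℝ) × (ℝ × ℝ)) (i : Fin 10) :
    channelSide (c • h) (c • e) (c • z) i = c * channelSide h e z i := by
  revert i
  rw [forall_fin_ten]
  simp only [channelSide, Matrix.cons_val, Prod.smul_fst, Prod.smul_snd, smul_eq_mul]
  refine ⟨?_, ?_, ?_, ?_, ?_, ?_, ?_, ?_, ?_, ?_⟩ <;> ring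

/-- The right-hand sides at an average of entropy points exceed the average right-hand side. -/
lemma sum_pointSide_le {w₁ : X → Y₁ → ℝ} {w₂ : X → Y₂ → ℝ} (h₁ : IsChannel w₁) (h₂ : IsChannel w₂)
    {ι : Type*} [Fintype ι] (c : ι → ℝ) (hc : ∀ t, 0 ≤ c t) (hc1 : ∑ t, c t = 1)
    (P : ι → EntropyPoint X) (hP : ∀ t x, 0 ≤ (P t).1 x) (hP1 : ∀ t, ∑ x, (P t).1 x = 1)
    (i : Fin 10) : ∑ t, c t * pointSide w₁ w₂ (P t) i ≤ pointSide w₁ w₂ (∑ t, c t • P t) i := by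
  simp only [pointSide, ← channelSide_smul]
  rw [channelSide_sum]
  have e₁ := sum_outEntropy_le h₁ c (fun t => (P t).1) hc hc1 hP hP1
  have e₂ := sum_outEntropy_le h₂ c (fun t => (P t).1) hc hc1 hP hP1
  refine (channelSide_mono (h' := (outEntropy w₁ (∑ t, c t • P t).1,
    outEntropy w₂ (∑ t, c t • P t).1)) ?_ ?_ _ _ i).trans (le_of_eq ?_)
  · simpa only [Prod.fst_sum, Prod.smul_fst, smul_eq_mul] using e₁
  · simpa only [Prod.fst_sum, Prod.snd_sum, Prod.smul_fst, Prod.smul_snd, smul_eq_mul] using e₂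
  · congr 1
    · have hlin : ∀ N : X → ℝ, ∑ t, c t * ∑ x, (P t).1 x * N x =
          ∑ x, (∑ t, c t • P t).1 x * N x := fun N => by
        simp only [Prod.fst_sum, Prod.smul_fst, smul_eq_mul, Finset.sum_apply, Pi.smul_apply,
          Finset.sum_mul, Finset.mul_sum]
        rw [Finset.sum_comm]
        simp only [mul_assoc]
      refine Prod.ext ?_ ?_
      · rw [Prod.fst_sum]
        exact hlin _
      · rw [Prod.snd_sum]
        exact hlin _
    · simp only [Prod.snd_sum, Prod.smul_snd]

/-- A code with small symbol error probabilities yields the inequalities up to a small error, for an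
input law that does not depend on `U`. -/
lemma exists_test_of_code [Nonempty X] (p : PMF (S₁ × S₂)) (W : X → PMF (Y₁ × Y₂))
    (f : (Fin m → S₁) × (Fin m → S₂) → (Fin n → X)) (g₁ : (Fin n → Y₁) → (Fin m → S₁))
    (g₂ : (Fin n → Y₂) → (Fin m → S₂)) {ε : ℝ} (h0 : 0 < ε) (h1 : ε < 1)
    (herr₁ : ∑ t : Fin m, ((blockLaw p W f).toOuterMeasure
      {ω | (ω.1 t).1 ≠ g₁ (fun q => (ω.2 q).1) t}).toReal ≤ m * ε)
    (herr₂ : ∑ t : Fin m, ((blockLaw p W f).toOuterMeasure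
      {ω | (ω.1 t).2 ≠ g₂ (fun q => (ω.2 q).2) t}).toReal ≤ m * ε) :
    ∃ pX : PMF X, ∀ (U : Type w) [Fintype U] (pU : S₁ × S₂ → PMF U),
      ∃ pV : X → PMF (Fin (Fintype.card X + 5) × Fin (Fintype.card X) × Fin (Fintype.card X)),
        ∀ i, m * (sourceSide (entropy p Prod.fst, entropy p Prod.snd)
            (sourceEntropies (sourceJoint p pU) (fun ω => ω.1) (fun ω => ω.2.1) fun ω => ω.2.2) i -
            3 * fanoBound (Fintype.card S₁ * Fintype.card S₂) ε) ≤
          n * pointSide (outProb W Prod.fst) (outProb W Prod.snd)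
            (arrayPoint (outProb W Prod.fst) (outProb W Prod.snd) (inputArray pX pV)) i := by
  set q : Fin n → X → ℝ := fun t x => prob (productPMF fun _ : Fin m => p)
    (fun s => f (fun t => (s t).1, fun t => (s t).2) t) x with hq
  have hq0 : ∀ t x, 0 ≤ q t x := fun t x => prob_nonneg _ _ _
  have hq1 : ∀ t, ∑ x, q t x = 1 := fun t => sum_prob _ _
  obtain ⟨s₀⟩ : Nonempty (S₁ × S₂) := p.support_nonempty.to_type
  have hc₁ : (1 : ℝ) ≤ Fintype.card S₁ := by
    have : 0 < Fintype.card S₁ := Fintype.card_pos_iff.2 ⟨s₀.1⟩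
    exact_mod_cast this
  have hc₂ : (1 : ℝ) ≤ Fintype.card S₂ := by
    have : 0 < Fintype.card S₂ := Fintype.card_pos_iff.2 ⟨s₀.2⟩
    exact_mod_cast this
  have hN : (1 : ℝ) ≤ Fintype.card S₁ * Fintype.card S₂ := one_le_mul_of_one_le_of_one_le hc₁ hc₂
  -- Bounds before averaging over time: at time `t` the auxiliary variables are `V₀ = (U^m, gap at
  -- t)` and `V_i = S_i^m`, over the input law `q t`.
  have main : ∀ (U : Type w) [Fintype U] (pU : S₁ × S₂ → PMF U),
      ∃ z : Fin n → (ℝ × ℝ) × (ℝ × ℝ) × (ℝ × ℝ),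
        (∀ t, ((q t, z t) : EntropyPoint X) ∈
          convexHull ℝ (atoms (outProb W Prod.fst) (outProb W Prod.snd))) ∧
        ∀ i, m * (sourceSide (entropy p Prod.fst, entropy p Prod.snd)
            (sourceEntropies (sourceJoint p pU) (fun ω => ω.1) (fun ω => ω.2.1) fun ω => ω.2.2) i -
            3 * fanoBound (Fintype.card S₁ * Fintype.card S₂) ε) ≤
          ∑ t, pointSide (outProb W Prod.fst) (outProb W Prod.snd) (q t, z t) i := by
    intro U _ pU
    set P := codeLaw p W pU f with hP
    let w₀ : (Fin m → U × S₁ × S₂) × (Fin n → Y₁ × Y₂) → Fin m → U := fun ω t => (ω.1 t).1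
    let w₁ : (Fin m → U × S₁ × S₂) × (Fin n → Y₁ × Y₂) → Fin m → S₁ := fun ω t => (ω.1 t).2.1
    let w₂ : (Fin m → U × S₁ × S₂) × (Fin n → Y₁ × Y₂) → Fin m → S₂ := fun ω t => (ω.1 t).2.2
    let y₁ : Fin n → (Fin m → U × S₁ × S₂) × (Fin n → Y₁ × Y₂) → Y₁ := fun t ω => (ω.2 t).1
    let y₂ : Fin n → (Fin m → U × S₁ × S₂) × (Fin n → Y₁ × Y₂) → Y₂ := fun t ω => (ω.2 t).2
    let x : Fin n → (Fin m → U × S₁ × S₂) × (Fin n → Y₁ × Y₂) → X := fun t ω => codeInput f ω.1 t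
    have hx : ∀ t, (fun b => prob P (x t) b) = q t := fun t =>
      funext fun b => prob_codeInput p W pU f t b
    have hgap : ∀ t ω ω', ω.1 = ω'.1 → offEntry t ω.2 = offEntry t ω'.2 →
        blockGap y₁ y₂ t ω = blockGap y₁ y₂ t ω' := by
      intro t ω ω' _ h
      funext i
      simp only [blockGap]
      split_ifs with hi hi'
      · have := congrFun h ⟨i, hi.ne⟩
        simp only [offEntry] at this
        simp only [y₁, this]
      · have := congrFun h ⟨i, hi'.ne'⟩
        simp only [offEntry] at this
        simp only [y₂, this]
      · rfl
    have hm := isMarkov_codeLaw p W pU f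
    have hf : ∀ t, FunctionOf (pair (pair w₀ (blockGap y₁ y₂ t)) (pair w₁ w₂))
        (fun ω => (ω.1, offEntry t ω.2)) := by
      intro t ω ω' h
      simp only [Prod.mk.injEq] at h
      simp only [pair, w₀, w₁, w₂, hgap t ω ω' h.1 h.2, h.1]
    have hf' : ∀ t, FunctionOf (pair (pair w₀ (pair w₁ w₂)) (blockGap y₁ y₂ t))
        (fun ω => (ω.1, offEntry t ω.2)) := by
      intro t ω ω' h
      simp only [Prod.mk.injEq] at h
      simp only [pair, w₀, w₁, w₂, hgap t ω ω' h.1 h.2, h.1]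
    -- The encoder is deterministic, so conditioning on both source blocks includes the input and
    -- leaves only the noise entropy, which is linear in `q t`.
    have hxf : ∀ t, FunctionOf (x t) (pair (pair w₀ (pair w₁ w₂)) (blockGap y₁ y₂ t)) := by
      intro t ω ω' h
      simp only [pair, w₁, w₂, Prod.mk.injEq] at h
      simp only [x, codeInput, h.1.2.1, h.1.2.2]
    have hM₁ : ∀ t, IsMarkov P (pair (pair w₀ (blockGap y₁ y₂ t)) (pair w₁ w₂)) (x t) (y₁ t)
        (outProb W Prod.fst) := fun t => ((hm t).comp_output Prod.fst).of_functionOf (hf t)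
    have hM₂ : ∀ t, IsMarkov P (pair (pair w₀ (blockGap y₁ y₂ t)) (pair w₁ w₂)) (x t) (y₂ t)
        (outProb W Prod.snd) := fun t => ((hm t).comp_output Prod.snd).of_functionOf (hf t)
    have hM₁' : ∀ t, IsMarkov P (pair (pair w₀ (pair w₁ w₂)) (blockGap y₁ y₂ t)) (x t) (y₁ t)
        (outProb W Prod.fst) := fun t => ((hm t).comp_output Prod.fst).of_functionOf (hf' t)
    have hM₂' : ∀ t, IsMarkov P (pair (pair w₀ (pair w₁ w₂)) (blockGap y₁ y₂ t)) (x t) (y₂ t)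
        (outProb W Prod.snd) := fun t => ((hm t).comp_output Prod.snd).of_functionOf (hf' t)
    refine ⟨fun t => channelEntropies P (pair w₀ (blockGap y₁ y₂ t)) w₁ w₂ (y₁ t) (y₂ t),
      fun t => ?_, fun i => ?_⟩
    · rw [← hx t, ← arrayPoint_eq (hM₁ t) (hM₂ t)]
      exact arrayPoint_mem_convexHull (isChannel_outProb _ _) (isChannel_outProb _ _)
        fun z => prob_nonneg _ _ _
    · have hF₁ : condEntropy P w₁ (block y₁) ≤
          m * fanoBound (Fintype.card S₁ * Fintype.card S₂) ε := by
        refine condEntropy_le_fanoBound P w₁ (block y₁) g₁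
          (le_mul_of_one_le_right (by linarith) hc₂) hN h0 h1 (le_trans (le_of_eq ?_) herr₁)
        exact Finset.sum_congr rfl fun t _ => (blockLaw_error p W pU f Prod.fst Prod.fst g₁ t).symm
      have hF₂ : condEntropy P w₂ (block y₂) ≤
          m * fanoBound (Fintype.card S₁ * Fintype.card S₂) ε := by
        refine condEntropy_le_fanoBound P w₂ (block y₂) g₂
          (le_mul_of_one_le_left (by linarith) hc₁) hN h0 h1 (le_trans (le_of_eq ?_) herr₂)
        exact Finset.sum_congr rfl fun t _ => (blockLaw_error p W pU f Prod.snd Prod.snd g₂ t).symm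
      have hstep := (sourceSide_le_channelSide P w₀ w₁ w₂ (block y₁) (block y₂) hF₁ hF₂ i).trans
        (channelSide_block_le P w₀ w₁ w₂ y₁ y₂
          (fun t => (∑ b, q t b * ∑ c, negMulLog (outProb W Prod.fst b c),
            ∑ b, q t b * ∑ c, negMulLog (outProb W Prod.snd b c)))
          (fun t => le_of_eq (by
            rw [(hM₁' t).condEntropy_eq_of_functionOf (isChannel_outProb _ _) (hxf t), ← hx t]))
          (fun t => le_of_eq (by
            rw [(hM₂' t).condEntropy_eq_of_functionOf (isChannel_outProb _ _) (hxf t), ← hx t])) i)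
      have hs : sourceSide (entropy P w₁, entropy P w₂) (sourceEntropies P w₀ w₁ w₂) i =
          m * sourceSide (entropy p Prod.fst, entropy p Prod.snd)
            (sourceEntropies (sourceJoint p pU) (fun ω => ω.1) (fun ω => ω.2.1)
              fun ω => ω.2.2) i := by
        rw [← sourceSide_smul]
        congr 1
        · refine Prod.ext ?_ ?_
          · exact (entropy_codeLaw p W pU f fun a => a.2.1).trans
              (congrArg _ (entropy_sourceJoint p pU Prod.fst))
          · exact (entropy_codeLaw p W pU f fun a => a.2.2).trans
              (congrArg _ (entropy_sourceJoint p pU Prod.snd))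
        · refine Prod.ext ?_ (Prod.ext ?_ ?_)
          · exact condEntropy_codeLaw p W pU f (fun a => a.2.1) fun a => a.1
          · exact condEntropy_codeLaw p W pU f (fun a => a.2.2) fun a => a.1
          · refine Eq.trans (condEntropy_congr P (fun ω ω' => ?_) fun _ _ => Iff.rfl)
              (condEntropy_codeLaw p W pU f (pair (fun a => a.2.1) fun a => a.2.2) fun a => a.1)
            simp only [pair, Prod.mk.injEq, funext_iff, w₁, w₂, forall_and]
      rw [hs] at hstep
      refine le_trans (le_of_eq (by ring)) (hstep.trans (le_of_eq ?_))
      refine Finset.sum_congr rfl fun t _ => ?_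
      rw [pointSide, (hM₁ t).entropy_eq, (hM₂ t).entropy_eq, hx t]
  -- With no channel use both right-hand sides are zero and any input law will do; otherwise `p_X`
  -- is the average of the `q t`.
  rcases Nat.eq_zero_or_pos n with hn | hn
  · obtain ⟨x₀⟩ := ‹Nonempty X›
    refine ⟨PMF.pure x₀, fun U _ pU => ?_⟩
    obtain ⟨z, -, hz⟩ := main U pU
    refine ⟨fun _ => PMF.pure (0, ⟨0, Fintype.card_pos_iff.2 ⟨x₀⟩⟩,
      ⟨0, Fintype.card_pos_iff.2 ⟨x₀⟩⟩), fun i => (hz i).trans (le_of_eq ?_)⟩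
    subst hn
    simp
  · have hn' : (0 : ℝ) < n := by exact_mod_cast hn
    have hsum1 : ∑ _t : Fin n, (1 / n : ℝ) = 1 := by
      simp [hn'.ne']
    obtain ⟨pX, hpX⟩ := exists_pmf_of_sum_eq_one (fun a => (∑ t, (1 / n : ℝ) • q t) a)
      (fun a => by
        simp only [Finset.sum_apply, Pi.smul_apply, smul_eq_mul]
        exact Finset.sum_nonneg fun t _ => mul_nonneg (by positivity) (hq0 t a))
      (by
        simp only [Finset.sum_apply, Pi.smul_apply, smul_eq_mul]
        rw [Finset.sum_comm]
        simp only [← Finset.mul_sum, hq1, mul_one]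
        exact hsum1)
    refine ⟨pX, fun U _ pU => ?_⟩
    obtain ⟨z, hz, hle⟩ := main U pU
    have hpt : (∑ t, (1 / n : ℝ) • ((q t, z t) : EntropyPoint X)) =
        (fun a => (pX a).toReal, ∑ t, (1 / n : ℝ) • z t) := by
      refine Prod.ext ?_ ?_
      · rw [Prod.fst_sum]
        exact funext fun a => (hpX a).symm
      · rw [Prod.snd_sum]
        rfl
    have hmem := sum_mem_convexHull_atoms (isChannel_outProb W Prod.fst)
      (isChannel_outProb W Prod.snd) Finset.univ
      (fun t => (1 / n : ℝ) • ((q t, z t) : EntropyPoint X))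
      fun t _ => smul_mem_convexHull_atoms (isChannel_outProb W Prod.fst)
        (isChannel_outProb W Prod.snd) (hz t) (by positivity)
    -- Time sharing: the averaged point has right-hand sides at least the average of those at the
    -- individual times.
    have hconc := sum_pointSide_le (isChannel_outProb W Prod.fst) (isChannel_outProb W Prod.snd)
      (fun _ : Fin n => (1 / n : ℝ)) (fun _ => by positivity) hsum1
      (fun t => ((q t, z t) : EntropyPoint X)) hq0 hq1
    rw [hpt] at hmem
    obtain ⟨pV, hpV⟩ := exists_test_of_mem_convexHull W pX hmem
    refine ⟨pV, fun i => (hle i).trans ?_⟩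
    have h3 := (hconc i).trans ((le_of_eq (by rw [hpt])).trans (hpV i))
    rw [← Finset.mul_sum, one_div, inv_mul_le_iff₀ hn'] at h3
    exact h3

end CodeBound

/-! ### The limit of vanishing error -/

section Limit

variable {S₁ S₂ X Y₁ Y₂ : Type*} [Fintype S₁] [Fintype S₂] [Fintype X] [Fintype Y₁] [Fintype Y₂]

lemma continuous_pointSide (w₁ : X → Y₁ → ℝ) (w₂ : X → Y₂ → ℝ) (i : Fin 10) :
    Continuous fun p : EntropyPoint X => pointSide w₁ w₂ p i := by
  have h₁ := (continuous_outEntropy w₁).comp (continuous_fst (X := X → ℝ)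
    (Y := (ℝ × ℝ) × (ℝ × ℝ) × (ℝ × ℝ)))
  have h₂ := (continuous_outEntropy w₂).comp (continuous_fst (X := X → ℝ)
    (Y := (ℝ × ℝ) × (ℝ × ℝ) × (ℝ × ℝ)))
  simp only [Function.comp_def] at h₁ h₂
  revert i
  rw [forall_fin_ten]
  simp only [pointSide, channelSide, Matrix.cons_val]
  refine ⟨?_, ?_, ?_, ?_, ?_, ?_, ?_, ?_, ?_, ?_⟩ <;> fun_prop

/-- `ε log (N / ε) = ε log N + negMulLog ε`, and the latter expression is continuous at `0`. -/
lemma tendsto_fanoBound {N : ℝ} (hN : 0 < N) {ε : ℕ → ℝ} (hpos : ∀ k, 0 < ε k)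
    (hε : Tendsto ε atTop (𝓝 0)) : Tendsto (fun k => fanoBound N (ε k)) atTop (𝓝 0) := by
  have hc : ContinuousAt (fun e : ℝ => -log (1 - e) + (e * log N + negMulLog e)) 0 := by
    refine ContinuousAt.add (ContinuousAt.neg (ContinuousAt.log (by fun_prop) (by norm_num)))
      (ContinuousAt.add (by fun_prop) continuous_negMulLog.continuousAt)
  have ht := hc.tendsto.comp hε
  simp only [sub_zero, log_one, neg_zero, zero_mul, negMulLog_zero, add_zero] at ht
  refine ht.congr fun k => ?_
  simp only [Function.comp_apply, fanoBound, log_div hN.ne' (hpos k).ne', negMulLog]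
  ring

lemma toReal_mem_stdSimplex {α : Type*} [Fintype α] (q : PMF α) :
    (fun a => (q a).toReal) ∈ stdSimplex ℝ α :=
  ⟨fun _ => ENNReal.toReal_nonneg, sum_toReal_pmf q⟩

lemma inputArray_mem_stdSimplex {V : Type*} [Fintype V] (pX : PMF X) (pV : X → PMF V) :
    inputArray pX pV ∈ stdSimplex ℝ (V × X) := by
  refine ⟨inputArray_nonneg pX pV, ?_⟩
  rw [Fintype.sum_prod_type_right]
  simp_rw [sum_inputArray]
  exact sum_toReal_pmf pX

/-- The outer bound for an admissible source. -/
theorem exists_test_of_admissible [Nonempty X] (p : PMF (S₁ × S₂)) (W : X → PMF (Y₁ × Y₂)) (κ : ℝ)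
    (h : Admissible p W κ) :
    ∃ pX : PMF X, ∀ (U : Type w) [Fintype U] (pU : S₁ × S₂ → PMF U),
      ∃ pV : X → PMF (Fin (Fintype.card X + 5) × Fin (Fintype.card X) × Fin (Fintype.card X)),
        BoundHolds κ p W pX pU pV := by
  -- The shift by two makes every term strictly less than `1`, as the Fano bound requires.
  set ε : ℕ → ℝ := fun k => 1 / ((k : ℝ) + 1 + 1) with hε
  have hpos : ∀ k, 0 < ε k := fun k => by simp only [hε]; positivity
  have hlt : ∀ k, ε k < 1 := fun k => by
    simp only [hε]
    rw [div_lt_one (by positivity)]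
    have : (0 : ℝ) ≤ k := Nat.cast_nonneg k
    linarith
  have hlim : Tendsto ε atTop (𝓝 0) := by
    have := (tendsto_add_atTop_iff_nat 1).2 (tendsto_one_div_add_atTop_nhds_zero_nat (𝕜 := ℝ))
    simpa [hε] using this
  set N : ℝ := Fintype.card S₁ * Fintype.card S₂ with hN
  have hNpos : 0 < N := by
    obtain ⟨s₀⟩ : Nonempty (S₁ × S₂) := p.support_nonempty.to_type
    have h₁ : 0 < Fintype.card S₁ := Fintype.card_pos_iff.2 ⟨s₀.1⟩
    have h₂ : 0 < Fintype.card S₂ := Fintype.card_pos_iff.2 ⟨s₀.2⟩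
    positivity
  have hk : ∀ k, ∃ pX : PMF X, ∀ (U : Type w) [Fintype U] (pU : S₁ × S₂ → PMF U),
      ∃ pV : X → PMF (Fin (Fintype.card X + 5) × Fin (Fintype.card X) × Fin (Fintype.card X)),
        ∀ i, sourceSide (entropy p Prod.fst, entropy p Prod.snd)
            (sourceEntropies (sourceJoint p pU) (fun ω => ω.1) (fun ω => ω.2.1) fun ω => ω.2.2) i -
            3 * fanoBound N (ε k) ≤
          (κ + ε k) * pointSide (outProb W Prod.fst) (outProb W Prod.snd)
            (arrayPoint (outProb W Prod.fst) (outProb W Prod.snd) (inputArray pX pV)) i := by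
    intro k
    obtain ⟨m, n, f, g₁, g₂, hm, hr, he₁, he₂⟩ := h (ε k) (hpos k)
    have hm' : (0 : ℝ) < m := by exact_mod_cast hm
    rw [one_div, inv_mul_le_iff₀ hm'] at he₁ he₂
    obtain ⟨pX, hpX⟩ := exists_test_of_code.{w} p W f g₁ g₂ (hpos k) (hlt k) he₁ he₂
    refine ⟨pX, fun U _ pU => ?_⟩
    obtain ⟨pV, hpV⟩ := hpX U pU
    refine ⟨pV, fun i => ?_⟩
    refine le_trans ?_ (mul_le_mul_of_nonneg_right hr (pointSide_inputArray_nonneg W pX pV i))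
    rw [div_mul_eq_mul_div, le_div_iff₀ hm', mul_comm]
    exact hpV i
  choose pXs hpXs using hk
  -- The limit input law is extracted before `U` is introduced; a further subsequence, depending on
  -- `U`, is taken only for the joint arrays.
  obtain ⟨q, hq, φ, hφ, hqlim⟩ := (isCompact_stdSimplex ℝ X).tendsto_subseq
    fun k => toReal_mem_stdSimplex (pXs k)
  obtain ⟨pX, hpX⟩ := exists_pmf_of_sum_eq_one q hq.1 hq.2
  refine ⟨pX, fun U _ pU => ?_⟩
  choose pVs hpVs using fun k => hpXs (φ k) U pU
  obtain ⟨r, hr, ψ, hψ, hrlim⟩ := (isCompact_stdSimplex ℝ _).tendsto_subseq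
    fun k => inputArray_mem_stdSimplex (pXs (φ k)) (pVs k)
  -- Limits are taken of joint laws; since the limit array has marginal `pX`, it disintegrates into
  -- a kernel, arbitrary where `pX` vanishes.
  have hmarg : ∀ x, ∑ v, r (v, x) = (pX x).toReal := by
    intro x
    have h1 : Tendsto (fun k => ∑ v, inputArray (pXs (φ (ψ k))) (pVs (ψ k)) (v, x)) atTop
        (𝓝 (∑ v, r (v, x))) :=
      tendsto_finsetSum _ fun v _ => (tendsto_pi_nhds.1 hrlim) (v, x)
    simp_rw [sum_inputArray] at h1
    have h2 := ((tendsto_pi_nhds.1 hqlim) x).comp hψ.tendsto_atTop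
    rw [hpX]
    exact tendsto_nhds_unique h1 h2
  obtain ⟨pV, hpV⟩ := exists_kernel pX (fun v x => r (v, x)) (fun v x => hr.1 _) hmarg
  have hrV : inputArray pX pV = r := funext fun z => hpV z.2 z.1
  refine ⟨pV, (boundHolds_iff W κ p pX pU pV).2 fun i => ?_⟩
  rw [entropy_sourceJoint p pU fun s => s.1, entropy_sourceJoint p pU fun s => s.2, hrV]
  have hεlim : Tendsto (fun k => ε (φ (ψ k))) atTop (𝓝 0) :=
    hlim.comp (hφ.tendsto_atTop.comp hψ.tendsto_atTop)
  have hL : Tendsto (fun k => sourceSide (entropy p Prod.fst, entropy p Prod.snd)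
      (sourceEntropies (sourceJoint p pU) (fun ω => ω.1) (fun ω => ω.2.1) fun ω => ω.2.2) i -
      3 * fanoBound N (ε (φ (ψ k)))) atTop (𝓝 (sourceSide (entropy p Prod.fst, entropy p Prod.snd)
      (sourceEntropies (sourceJoint p pU) (fun ω => ω.1) (fun ω => ω.2.1) fun ω => ω.2.2) i)) := by
    have := (tendsto_const_nhds (x := sourceSide (entropy p Prod.fst, entropy p Prod.snd)
      (sourceEntropies (sourceJoint p pU) (fun ω => ω.1) (fun ω => ω.2.1) fun ω => ω.2.2) i)).sub
      ((tendsto_fanoBound hNpos (fun k => hpos (φ (ψ k))) hεlim).const_mul 3)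
    simpa using this
  have hR : Tendsto (fun k => (κ + ε (φ (ψ k))) *
      pointSide (outProb W Prod.fst) (outProb W Prod.snd)
      (arrayPoint (outProb W Prod.fst) (outProb W Prod.snd)
        (inputArray (pXs (φ (ψ k))) (pVs (ψ k)))) i) atTop
      (𝓝 (κ * pointSide (outProb W Prod.fst) (outProb W Prod.snd)
        (arrayPoint (outProb W Prod.fst) (outProb W Prod.snd) r) i)) := by
    have hc : Continuous fun r : (Fin (Fintype.card X + 5) × Fin (Fintype.card X) ×
        Fin (Fintype.card X)) × X → ℝ => pointSide (outProb W Prod.fst) (outProb W Prod.snd)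
          (arrayPoint (outProb W Prod.fst) (outProb W Prod.snd) r) i :=
      (continuous_pointSide _ _ i).comp (continuous_arrayPoint _ _)
    have h1 := (hc.tendsto r).comp hrlim
    have h2 := (hεlim.const_add κ).mul h1
    rw [add_zero] at h2
    exact h2
  exact le_of_tendsto_of_tendsto' hL hR fun k => hpVs (ψ k) i

end Limit

end BroadcastSource

end

/-! ### Assembly of the three claims -/

theorem theorem3 {S₁ S₂ X Y₁ Y₂ : Type*}
    [Fintype S₁] [Fintype S₂] [Fintype X] [Nonempty X] [Fintype Y₁] [Fintype Y₂]
    (p : PMF (S₁ × S₂)) (W : X → PMF (Y₁ × Y₂)) (κ : ℝ) (hκ : 0 ≤ κ) :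
    -- the outer bound, with bounded alphabets for `V₀`, `V₁`, `V₂`
    (Admissible p W κ →
      ∃ pX : PMF X, ∀ (U : Type w) [Fintype U] (pU : S₁ × S₂ → PMF U),
        ∃ pV : X → PMF (Fin (Fintype.card X + 5) × Fin (Fintype.card X) × Fin (Fintype.card X)),
          BoundHolds κ p W pX pU pV) ∧
    -- for each input distribution it suffices to consider `|U| ≤ |S₁| |S₂|`, `|V₀| ≤ |X| + 5` and
    -- `|V₁|, |V₂| ≤ |X|`
    (∀ pX : PMF X,
      (∀ (U : Type w) [Fintype U], Fintype.card U ≤ Fintype.card S₁ * Fintype.card S₂ →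
        ∀ pU : S₁ × S₂ → PMF U,
          ∃ (V₀ V₁ V₂ : Type w) (_ : Fintype V₀) (_ : Fintype V₁) (_ : Fintype V₂)
            (pV : X → PMF (V₀ × V₁ × V₂)), BoundHolds κ p W pX pU pV) →
      ∀ (U : Type w) [Fintype U] (pU : S₁ × S₂ → PMF U),
        ∃ pV : X → PMF (Fin (Fintype.card X + 5) × Fin (Fintype.card X) × Fin (Fintype.card X)),
          BoundHolds κ p W pX pU pV) ∧
    -- the choice `U = S₀` recovers the Gohari–Anantharam inequalities
    (∀ (T : Type w) [Fintype T] (φ₁ : S₁ → T) (φ₂ : S₂ → T), IsCommonPart p φ₁ φ₂ →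
      ∀ (V₀ V₁ V₂ : Type w) [Fintype V₀] [Fintype V₁] [Fintype V₂]
        (pX : PMF X) (pV : X → PMF (V₀ × V₁ × V₂)),
        BoundHolds κ p W pX (fun s => PMF.pure (φ₁ s.1)) pV ↔
          GohariAnantharamHolds κ p W pX φ₁ pV) := by
  refine ⟨exists_test_of_admissible p W κ, fun pX h U _ pU => exists_bounded_test p W hκ pX h U pU,
    fun T _ φ₁ φ₂ h V₀ V₁ V₂ _ _ _ pX pV => boundHolds_commonPart_iff p W hκ φ₁ φ₂ h pX pV⟩
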